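/- **Setting.** Let $\alpha$ be an infinite set (the dimension; infinite ordinals are a special case), $G$ a semigroup of maps $\alpha\to\alpha$ under composition, and $\mathcal J$ a family of subsets of $\alpha$ (below: all finite subsets, or all subsets). A $GPHA_\alpha$ is an algebra $(A,\lor,\land,\to,0,\mathsf s_\tau,\mathsf c_{(J)},\mathsf q_{(J)})_{\tau\in G,\,J\in\mathcal J}$ such that $(A,\lor,\land,\to,0)$ is a Heyting algebra, each $\mathsf s_\tau$ is a Heyting endomorphism, each $\exists=\mathsf c_{(J)}$ is an existential quantifier ($\exists 0=0$, $p\le\exists p$, $\exists(p\land\exists r)=\exists p\land\exists r$, $\exists(\exists p\to\exists r)=\exists p\to\exists r$, $\exists(\exists p\lor\exists r)=\exists p\lor\exists r$, $\exists\exists p=\exists p$), each $\forall=\mathsf q_{(J)}$ is a universal quantifier ($\forall1=1$, $\forall p\le p$, $\forall(p\to r)\le\forall p\to\forall r$, $\forall\forall p=\forall p$), and, for all $\sigma,\tau\in G$, $J,J'\in\mathcal J$ and $p\in A$, and for $\mathsf Q=\mathsf c$ as well as $\mathsf Q=\mathsf q$: $\mathsf s_{Id}p=p$ (if $Id\in G$);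 $\mathsf s_{\sigma\circ\tau}p=\mathsf s_\sigma\mathsf s_\tau p$; $\mathsf Q_{(\emptyset)}p=p$; $\mathsf Q_{(J\cup J')}p=\mathsf Q_{(J)}\mathsf Q_{(J')}p$; $\mathsf s_\sigma\mathsf Q_{(J)}p=\mathsf s_\tau\mathsf Q_{(J)}p$ if $\sigma$ and $\tau$ agree off $J$; $\mathsf Q_{(J)}\mathsf s_\sigma p=\mathsf s_\sigma\mathsf Q_{(\sigma^{-1}(J))}p$ if $\sigma$ is injective on $\sigma^{-1}(J)$. $GPHA_\alpha$ also denotes the class of these algebras. A *Kripke system* of dimension $\alpha$ is $\mathfrak K=(K,\le,\{X_k\}_{k\in K},\{V_k\}_{k\in K})$ with $(K,\le)$ a preorder, $X_k\neq\emptyset$, $\emptyset\ne V_k\subseteq{}^\alpha X_k$, $X_k\subseteq X_l$ and $V_k\subseteq V_l$ for $k\le l$, such that $x\circ\tau\in V_k$ for $x\in V_k$, $\tau\in G$, and $y\in V_k$ whenever $y\in{}^\alpha X_k$ agrees off some $J\in\mathcal J$ with some $x\in V_k$. Its set algebra $\mathfrak F_{\mathfrak K}$ consists of the families $(f_k)_{k\in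 K}$, $f_k:V_k\to\{0,1\}$, with $f_k\le f_l$ on $V_k$ for $k\le l$; $\lor,\land,0$ are pointwise; $(f\to g)_k(x)=1$ iff for all $l\ge k$, $f_l(x)=1$ implies $g_l(x)=1$; $(\mathsf s_\tau f)_k(x)=f_k(x\circ\tau)$; $(\mathsf c_{(J)}f)_k(x)=1$ iff $f_k(y)=1$ for some $y\in V_k$ that agrees with $x$ off $J$; $(\mathsf q_{(J)}f)_k(x)=1$ iff $f_l(y)=1$ for all $l\ge k$ and all $y\in V_l$ that agree with $x$ off $J$. $RGA_\alpha$ is the class of all algebras that embed in a direct product of algebras $\mathfrak F_{\mathfrak K}$. For a map $f$, $f[H|g]$ agrees with $g$ on $H$ and with $f$ off $H$; $\mathrm{supp}(f)=\{i:f(i)\ne i\}$, $Rg f$ is the range of $f$, and $f$ is *finite* if $\mathrm{supp}(f)$ is finite. For $\alpha$ countable, $G$ is *strongly rich* if $\tau[\{i\}|j]\in G$ for all $\tau\in G$, $i,j\in\alpha$, and there are $\sigma,\pi\in G$ with $\pi\circ\sigma=Id$, $Rg\,\sigma\neq\alpha$, $(\sigma\circ\tau\circ\pi)[(\alpha\setminus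 Rg\,\sigma)|Id]\in G$ for all $\tau\in G$, and, for all $n\in\omega$, $\mathrm{supp}(\sigma^n\circ\pi^n)$ is finite and contained in $\alpha\setminus Rg(\sigma^n)$. Let $\alpha\subseteq\beta$ be infinite sets, let $G_\alpha$, $G_\beta$ be the semigroups of all finite transformations of $\alpha$ and $\beta$, and let $\mathcal J$ be the finite subsets in both cases. For $\mathfrak B\in G_\beta PHA_\beta$, the neat reduct $\mathfrak{Nr}_\alpha\mathfrak B$ has universe $\{p:\mathsf c_{(\{i\})}p=p\text{ for all }i\in\beta\setminus\alpha\}$, the Heyting operations of $\mathfrak B$, the $\mathsf c_{(J)},\mathsf q_{(J)}$ with finite $J\subseteq\alpha$, and, as $\mathsf s_\tau$ for $\tau\in G_\alpha$, the operation $\mathsf s_{\tau\cup Id_{\beta\setminus\alpha}}$ of $\mathfrak B$. $\mathbf S\mathfrak{Nr}_\alpha G_\beta PHA_\beta$ is the class of the $\mathfrak A\in G_\alpha PHA_\alpha$ that embed in $\mathfrak{Nr}_\alpha\mathfrak B$ for some $\mathfrak B\in G_\beta PHA_\beta$. A variety is a class closed under homomorphic images, (isomorphic copies of) subalgebras and direct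 products. **Theorem.** Let $\alpha$ be an infinite set. 1. (a) If $\alpha$ is countable, $G$ is strongly rich and $\mathcal J$ is the family of finite subsets of $\alpha$, then $RGA_\alpha=GPHA_\alpha$. (b) If $G$ consists of all transformations of $\alpha$, then $RGA_\alpha=GPHA_\alpha$, both when $\mathcal J$ consists of all subsets of $\alpha$ and when it consists of the finite ones. 2. If $G$ consists of all finite transformations of $\alpha$ and $\mathcal J$ of all finite subsets, then $RGA_\alpha=\mathbf S\mathfrak{Nr}_\alpha G_{\alpha+\omega}PHA_{\alpha+\omega}$, where $\alpha+\omega$ is the disjoint union of $\alpha$ and $\omega$, and $RGA_\alpha$ is a variety. Moreover, for all infinite $\alpha\subseteq\beta$, the class $\mathbf S\mathfrak{Nr}_\alpha G_\beta PHA_\beta$ is a variety. -/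

import Mathlib

universe u

namespace HeytingPolyadic

/-! Algebras of the similarity type of Heyting polyadic `G`-algebras. -/

/-- The algebras `(A, ∨, ∧, →, 0, s_τ, c_(J), q_(J))`, with `τ ∈ G` and `J ∈ 𝒥`, whose reduct
`(A, ∨, ∧, →, 0)` is a Heyting algebra. `G` is a semigroup of transformations of the dimension
`α` under composition, and `𝒥` is the family of the sets of indices that may be quantified.
No law is imposed here on `s`, `c`, `q`; see `IsGPHA`. -/
structure GAlg {α : Type u} (G : Subsemigroup (Function.End α)) (𝒥 : Set (Set α)) :
    Type (u + 1) where
  carrier : Type u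
  [heyting : HeytingAlgebra carrier]
  s : G → carrier → carrier
  c : 𝒥 → carrier → carrier
  q : 𝒥 → carrier → carrier

attribute [instance] GAlg.heyting

/-- Existential quantifiers on a Heyting algebra. -/
structure IsExistentialQuantifier {H : Type u} [HeytingAlgebra H] (e : H → H) : Prop where
  map_bot : e ⊥ = ⊥
  le_apply : ∀ p, p ≤ e p
  map_inf : ∀ p r, e (p ⊓ e r) = e p ⊓ e r
  map_himp : ∀ p r, e (e p ⇨ e r) = e p ⇨ e r
  map_sup : ∀ p r, e (e p ⊔ e r) = e p ⊔ e r
  idem : ∀ p, e (e p) = e p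

/-- Universal quantifiers on a Heyting algebra. -/
structure IsUniversalQuantifier {H : Type u} [HeytingAlgebra H] (a : H → H) : Prop where
  map_top : a ⊤ = ⊤
  apply_le : ∀ p, a p ≤ p
  map_himp : ∀ p r, a (p ⇨ r) ≤ a p ⇨ a r
  idem : ∀ p, a (a p) = a p

section Classes

variable {α : Type u} {G : Subsemigroup (Function.End α)} {𝒥 : Set (Set α)}

/-- The axioms of polyadic Heyting `G`-algebras of dimension `α`. -/
structure IsGPHA (A : GAlg G 𝒥) : Prop where
  s_sup : ∀ (τ : G) (p r : A.carrier), A.s τ (p ⊔ r) = A.s τ p ⊔ A.s τ r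
  s_inf : ∀ (τ : G) (p r : A.carrier), A.s τ (p ⊓ r) = A.s τ p ⊓ A.s τ r
  s_himp : ∀ (τ : G) (p r : A.carrier), A.s τ (p ⇨ r) = A.s τ p ⇨ A.s τ r
  s_bot : ∀ τ : G, A.s τ ⊥ = ⊥
  c_quantifier : ∀ J : 𝒥, IsExistentialQuantifier (A.c J)
  q_quantifier : ∀ J : 𝒥, IsUniversalQuantifier (A.q J)
  s_id : ∀ (ε : G), (∀ i, ε.1 i = i) → ∀ p, A.s ε p = p
  s_comp : ∀ (σ τ : G) (p : A.carrier), A.s (σ * τ) p = A.s σ (A.s τ p)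
  c_empty : ∀ J : 𝒥, J.1 = ∅ → ∀ p, A.c J p = p
  q_empty : ∀ J : 𝒥, J.1 = ∅ → ∀ p, A.q J p = p
  c_union : ∀ J J' L : 𝒥, L.1 = J.1 ∪ J'.1 → ∀ p, A.c L p = A.c J (A.c J' p)
  q_union : ∀ J J' L : 𝒥, L.1 = J.1 ∪ J'.1 → ∀ p, A.q L p = A.q J (A.q J' p)
  s_c : ∀ (σ τ : G) (J : 𝒥), (∀ i, i ∉ J.1 → σ.1 i = τ.1 i) →
    ∀ p, A.s σ (A.c J p) = A.s τ (A.c J p)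
  s_q : ∀ (σ τ : G) (J : 𝒥), (∀ i, i ∉ J.1 → σ.1 i = τ.1 i) →
    ∀ p, A.s σ (A.q J p) = A.s τ (A.q J p)
  c_s : ∀ (σ : G) (J J' : 𝒥), (∀ i, i ∈ J'.1 ↔ σ.1 i ∈ J.1) →
    (∀ i j, i ∈ J'.1 → j ∈ J'.1 → σ.1 i = σ.1 j → i = j) →
    ∀ p, A.c J (A.s σ p) = A.s σ (A.c J' p)
  q_s : ∀ (σ : G) (J J' : 𝒥), (∀ i, i ∈ J'.1 ↔ σ.1 i ∈ J.1) →
    (∀ i j, i ∈ J'.1 → j ∈ J'.1 → σ.1 i = σ.1 j → i = j) →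
    ∀ p, A.q J (A.s σ p) = A.s σ (A.q J' p)

/-- The class `GPHA_α`, with quantifiers over the sets in `𝒥`. -/
def GPHA (G : Subsemigroup (Function.End α)) (𝒥 : Set (Set α)) : Set (GAlg G 𝒥) :=
  {A | IsGPHA A}

/-- Homomorphisms (of the full similarity type). -/
structure GAlg.Hom (A B : GAlg G 𝒥) where
  toFun : A.carrier → B.carrier
  map_sup : ∀ p r, toFun (p ⊔ r) = toFun p ⊔ toFun r
  map_inf : ∀ p r, toFun (p ⊓ r) = toFun p ⊓ toFun r
  map_himp : ∀ p r, toFun (p ⇨ r) = toFun p ⇨ toFun r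
  map_bot : toFun ⊥ = ⊥
  map_s : ∀ τ p, toFun (A.s τ p) = B.s τ (toFun p)
  map_c : ∀ J p, toFun (A.c J p) = B.c J (toFun p)
  map_q : ∀ J p, toFun (A.q J p) = B.q J (toFun p)

/-- Direct products. -/
def GAlg.prod {I : Type u} (B : I → GAlg G 𝒥) : GAlg G 𝒥 where
  carrier := ∀ i, (B i).carrier
  s τ p := fun i => (B i).s τ (p i)
  c J p := fun i => (B i).c J (p i)
  q J p := fun i => (B i).q J (p i)

/-- `SP 𝒞`: the algebras that embed in a direct product of members of `𝒞`. -/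
def SP (𝒞 : Set (GAlg G 𝒥)) : Set (GAlg G 𝒥) :=
  {A | ∃ (I : Type u) (B : I → GAlg G 𝒥), (∀ i, B i ∈ 𝒞) ∧
    ∃ f : GAlg.Hom A (GAlg.prod B), Function.Injective f.toFun}

/-- Varieties: classes closed under homomorphic images, (isomorphic copies of) subalgebras
and direct products. -/
structure IsVariety (𝒞 : Set (GAlg G 𝒥)) : Prop where
  hom_image : ∀ (A B : GAlg G 𝒥) (f : GAlg.Hom A B), Function.Surjective f.toFun →
    A ∈ 𝒞 → B ∈ 𝒞
  subalgebra : ∀ (A B : GAlg G 𝒥) (f : GAlg.Hom A B), Function.Injective f.toFun →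
    B ∈ 𝒞 → A ∈ 𝒞
  prod : ∀ (I : Type u) (B : I → GAlg G 𝒥), (∀ i, B i ∈ 𝒞) → GAlg.prod B ∈ 𝒞

end Classes

/-! Kripke systems and the set algebras based on them. -/

/-- Kripke systems `(K, ≤, (X_k), (V_k))` of dimension `α`, where `V_k ⊆ ^αX_k`. The domains `X_k`
are subsets of one ambient type. The last two fields say that the admissible assignments are
closed under the operations of the similarity type: composition with the members of `G`, and
change (within `X_k`) on a set that may be quantified. -/
structure KripkeSystem {α : Type u} (G : Subsemigroup (Function.End α)) (𝒥 : Set (Set α)) :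
    Type (u + 1) where
  K : Type u
  [preorder : Preorder K]
  Dom : Type u
  X : K → Set Dom
  V : K → Set (α → Dom)
  X_nonempty : ∀ k, (X k).Nonempty
  X_mono : ∀ k l, k ≤ l → X k ⊆ X l
  V_nonempty : ∀ k, (V k).Nonempty
  V_mono : ∀ k l, k ≤ l → V k ⊆ V l
  V_mem : ∀ k, ∀ x ∈ V k, ∀ i, x i ∈ X k
  V_comp : ∀ k, ∀ x ∈ V k, ∀ τ ∈ G, (fun i => x (τ i)) ∈ V k
  V_change : ∀ k, ∀ x ∈ V k, ∀ J ∈ 𝒥, ∀ y : α → Dom, (∀ i, y i ∈ X k) →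
    (∀ i, i ∉ J → y i = x i) → y ∈ V k

attribute [instance] KripkeSystem.preorder

namespace KripkeSystem

variable {α : Type u} {G : Subsemigroup (Function.End α)} {𝒥 : Set (Set α)}

/-- The families `(f_k)` of two-valued functions `f_k : V_k → {0, 1}` with `f_k ≤ f_l` for
`k ≤ l`. The two truth values are the two propositions. -/
@[ext]
structure Fam (𝔎 : KripkeSystem G 𝒥) : Type u where
  val : ∀ k, 𝔎.V k → Prop
  mono : ∀ (k l : 𝔎.K) (h : k ≤ l) (x : 𝔎.V k), val k x → val l ⟨x.1, 𝔎.V_mono k l h x.2⟩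

variable (𝔎 : KripkeSystem G 𝒥)

instance : LE (Fam 𝔎) := ⟨fun f g => ∀ k x, f.val k x → g.val k x⟩

instance : Max (Fam 𝔎) :=
  ⟨fun f g => ⟨fun k x => f.val k x ∨ g.val k x,
    fun k l h x => Or.imp (f.mono k l h x) (g.mono k l h x)⟩⟩

instance : Min (Fam 𝔎) :=
  ⟨fun f g => ⟨fun k x => f.val k x ∧ g.val k x,
    fun k l h x => And.imp (f.mono k l h x) (g.mono k l h x)⟩⟩

instance : Bot (Fam 𝔎) := ⟨⟨fun _ _ => False, fun _ _ _ _ h => h⟩⟩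

instance : Top (Fam 𝔎) := ⟨⟨fun _ _ => True, fun _ _ _ _ h => h⟩⟩

/-- `(f → g)_k (x) = 1` iff for all `l ≥ k`, `f_l (x) = 1` implies `g_l (x) = 1`. -/
instance : HImp (Fam 𝔎) :=
  ⟨fun f g => ⟨fun k x => ∀ (l : 𝔎.K) (h : k ≤ l),
      f.val l ⟨x.1, 𝔎.V_mono k l h x.2⟩ → g.val l ⟨x.1, 𝔎.V_mono k l h x.2⟩,
    fun _ _ h _ hx m h' => hx m (h.trans h')⟩⟩

/-- The Heyting algebra of all these families. -/
instance : HeytingAlgebra (Fam 𝔎) where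
  le_refl _ _ _ h := h
  le_trans _ _ _ h₁ h₂ k x h := h₂ k x (h₁ k x h)
  le_antisymm f g h₁ h₂ := by
    ext k x
    exact ⟨h₁ k x, h₂ k x⟩
  sup := max
  inf := min
  le_sup_left _ _ _ _ := Or.inl
  le_sup_right _ _ _ _ := Or.inr
  sup_le _ _ _ h₁ h₂ k x h := h.elim (h₁ k x) (h₂ k x)
  inf_le_left _ _ _ _ h := h.1
  inf_le_right _ _ _ _ h := h.2
  le_inf _ _ _ h₁ h₂ k x h := ⟨h₁ k x h, h₂ k x h⟩
  le_top _ _ _ _ := trivial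
  bot_le _ _ _ h := h.elim
  le_himp_iff f g h :=
    ⟨fun H k x hx => H k x hx.1 k le_rfl hx.2,
      fun H k x hf l hl hg => H l _ ⟨f.mono k l hl x hf, hg⟩⟩
  compl f := f ⇨ ⊥
  himp_bot _ := rfl

/-- The set algebra `𝔉_𝔎` based on the Kripke system `𝔎`. -/
def setAlgebra : GAlg G 𝒥 where
  carrier := Fam 𝔎
  s τ f := ⟨fun k x => f.val k ⟨fun i => x.1 (τ.1 i), 𝔎.V_comp k x.1 x.2 τ.1 τ.2⟩,
    fun k l h _ hx => f.mono k l h _ hx⟩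
  c J f := ⟨fun k x => ∃ y : 𝔎.V k, (∀ i, i ∉ J.1 → y.1 i = x.1 i) ∧ f.val k y,
    fun k l h _ hx =>
      hx.elim fun y hy => ⟨⟨y.1, 𝔎.V_mono k l h y.2⟩, hy.1, f.mono k l h y hy.2⟩⟩
  q J f := ⟨fun k x => ∀ l, k ≤ l → ∀ y : 𝔎.V l, (∀ i, i ∉ J.1 → y.1 i = x.1 i) → f.val l y,
    fun _ _ h _ hx m h' => hx m (h.trans h')⟩

end KripkeSystem

/-- The class `RGA_α` of representable `G`-algebras. -/
def RGA {α : Type u} (G : Subsemigroup (Function.End α)) (𝒥 : Set (Set α)) : Set (GAlg G 𝒥) :=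
  SP {A | ∃ 𝔎 : KripkeSystem G 𝒥, A = 𝔎.setAlgebra}

/-! Semigroups of transformations and families of index sets. -/

/-- The family of the finite subsets of `α`. -/
def finiteSets (α : Type u) : Set (Set α) := {J | J.Finite}

/-- The support of a transformation. -/
def supp {α : Type u} (τ : α → α) : Set α := {i | τ i ≠ i}

/-- The semigroup of all finite transformations, those that move only finitely many points. -/
def finTrans (α : Type u) : Subsemigroup (Function.End α) where
  carrier := {τ | (supp τ).Finite}
  mul_mem' := by
    intro σ τ hσ hτ
    refine (Set.Finite.union hσ hτ).subset ?_
    intro i hi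
    by_contra h
    simp only [supp, Set.mem_union, Set.mem_ofPred_eq, not_or, not_not] at h
    apply hi
    change σ (τ i) = i
    rw [h.2, h.1]

open Classical in
/-- `modify f H g` is the function `f[H | g]` that agrees with `g` on `H` and with `f`
elsewhere. -/
noncomputable def modify {α : Type u} (f : α → α) (H : Set α) (g : α → α) : α → α :=
  fun i => if i ∈ H then g i else f i

/-- Strongly rich semigroups of transformations of a countably infinite set. -/
def IsStronglyRich {α : Type u} (T : Subsemigroup (Function.End α)) : Prop :=
  (∀ τ ∈ T, ∀ i j : α, modify τ {i} (fun _ => j) ∈ T) ∧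
  ∃ σ ∈ T, ∃ π ∈ T,
    (∀ i, π (σ i) = i) ∧ Set.range σ ≠ Set.univ ∧
    (∀ τ ∈ T, modify (fun i => σ (τ (π i))) (Set.range σ)ᶜ id ∈ T) ∧
    (∀ n : ℕ, (supp fun i => σ^[n] (π^[n] i)).Finite) ∧
    (∀ n : ℕ, (supp fun i => σ^[n] (π^[n] i)) ⊆ (Set.range σ^[n])ᶜ)

/-! Neat reducts, for semigroups of all finite transformations. -/

section NeatReducts

variable {α β : Type u}

/-- The transformation `τ ∪ Id` of `β`, for a transformation `τ` of `α` and an embedding of `α`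
in `β`. -/
noncomputable def extendId (ι : α ↪ β) (τ : finTrans α) : finTrans β :=
  ⟨Function.extend ι (fun i => ι (τ.1 i)) id, by
    refine (Set.Finite.image ι τ.2).subset ?_
    intro j hj
    by_cases h : ∃ i, ι i = j
    · obtain ⟨i, rfl⟩ := h
      refine ⟨i, fun hi => hj ?_, rfl⟩
      rw [ι.injective.extend_apply, hi]
    · exact absurd (Function.extend_apply' _ _ _ h) hj⟩

/-- The image of a finite set of indices. -/
def imageSet (ι : α ↪ β) (J : finiteSets α) : finiteSets β := ⟨ι '' J.1, Set.Finite.image ι J.2⟩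

/-- The reduct `Rd_α B` of an algebra of dimension `β` to the dimension `α`. -/
noncomputable def reduct (ι : α ↪ β) (B : GAlg (finTrans β) (finiteSets β)) :
    GAlg (finTrans α) (finiteSets α) where
  carrier := B.carrier
  s τ := B.s (extendId ι τ)
  c J := B.c (imageSet ι J)
  q J := B.q (imageSet ι J)

/-- The dimension set `Δ p = {i : c_i p ≠ p}`. -/
def dimSet (B : GAlg (finTrans β) (finiteSets β)) (p : B.carrier) : Set β :=
  {i | B.c ⟨{i}, Set.finite_singleton i⟩ p ≠ p}

/-- The class `S Nr_α G_βPHA_β`: the members `A` of `G_αPHA_α` for which there is `B` in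
`G_βPHA_β` such that `A` embeds in `Nr_α B`, the subalgebra of `Rd_α B` with universe
`{p : Δ p ⊆ α}`. -/
def SNr (ι : α ↪ β) : Set (GAlg (finTrans α) (finiteSets α)) :=
  {A | A ∈ GPHA (finTrans α) (finiteSets α) ∧
    ∃ B ∈ GPHA (finTrans β) (finiteSets β), ∃ f : GAlg.Hom A (reduct ι B),
      Function.Injective f.toFun ∧ ∀ a, dimSet B (f.toFun a) ⊆ Set.range ι}

end NeatReducts

end HeytingPolyadic

/-!
The set algebras of Kripke systems satisfy the axioms (`RGA_subset_GPHA`); the substance is the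
converse, a completeness theorem for an intuitionistic logic with infinitely long atomic formulas,
proved by a Henkin construction.

*Dilation.* Suppose that `D` is a large set of constants, and that there is a directed system of
injections `m : α → D`, the charts, whose transition maps lie in `G` and have left inverses in `G`
(`ChartSystem`). The copies of `A` indexed by the charts form a direct system with injective
connecting maps `s_ρ`. Its limit is a Heyting algebra whose elements are the "sentences" `p(x)`,
for `p ∈ A` and an admissible assignment `x = m ∘ ρ` of constants (`ChartSystem.ev`). The two axioms
on the interaction of substitutions and quantifiers give the rules for fresh constants: existential
elimination (`inf_ev_c_le`) and generalization (`le_ev_q`).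

*Canonical model.* Let `κ` be a cardinal below that of `D` that bounds the language over any `κ`
constants, infinite sequences of constants included. A world is a set `X` of at most `κ` constants
with a prime filter that contains witnesses in `X` for its existential members. Adding `κ` new
constants, a consistent theory over `X` extends to such a world (`exists_saturated`): witnesses are
adopted along a well-order of type `κ`, each one only if the formula is consistent with the
witnesses adopted before, and then one passes to a prime filter. No later step has to be taken
care of, because a prime filter containing an existential formula shows that the formula was
consistent at its stage. Hence `A` is representable if chart systems exist for large `D`
(`RGA_eq_GPHA_of_chartSystem`).

*Charts.* For the semigroup of all transformations, all injections are charts. For a strongly rich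
semigroup, with `σ` and `π`, a typical chart is `π^n` on the range of `σ^n` and enumerates new
constants on its complement, which is finite but arbitrarily large; closing up under finite
modifications gives a chart system (`richChartSystem`), for `α` of any infinite cardinality.

*Finite transformations.* If `A` is neatly embedded in `B` of dimension `α ⊕ ℕ`, then the elements of
`B` that depend on finitely many of the coordinates in `ℕ` admit the action of all transformations
that are finite on `α` and arbitrary on `ℕ` (`boundedAlg`). These form a strongly rich semigroup, so
this algebra is representable, and fixing the values of the coordinates in `ℕ` yields a
representation of `A` (`sliceHom`). Conversely, set algebras are neatly embedded in those of
cylinders (`cylinderHom`). Finally, the class of neat subreducts is closed under homomorphic images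
since a filter of `A` closed under the universal quantifiers generates a filter of `B` of the same
kind that has the same trace on `A` (`SNr_hom_image`).
-/

namespace HeytingPolyadic

/-! ### Elementary properties of quantifiers -/

section Quantifiers

variable {H : Type u} [HeytingAlgebra H]

theorem IsExistentialQuantifier.monotone {e : H → H} (he : IsExistentialQuantifier e) :
    Monotone e := by
  intro p r h
  have h1 : p ⊓ e r = p := inf_eq_left.2 (h.trans (he.le_apply r))
  have h2 := he.map_inf p r
  rw [h1] at h2
  exact inf_eq_left.1 h2.symm

theorem IsUniversalQuantifier.monotone {a : H → H} (ha : IsUniversalQuantifier a) :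
    Monotone a := by
  intro p r h
  have h1 := ha.map_himp p r
  rw [himp_eq_top_iff.2 h, ha.map_top] at h1
  exact himp_eq_top_iff.1 (top_le_iff.1 h1)

theorem IsUniversalQuantifier.inf_le {a : H → H} (ha : IsUniversalQuantifier a) (p r : H) :
    a p ⊓ a r ≤ a (p ⊓ r) := by
  have h1 : p ≤ r ⇨ p ⊓ r := le_himp_iff.2 le_rfl
  exact le_himp_iff.1 ((ha.monotone h1).trans (ha.map_himp _ _))

end Quantifiers

/-! ### Set algebras satisfy the axioms -/

section SetAlgebra

variable {α : Type u} {G : Subsemigroup (Function.End α)} {𝒥 : Set (Set α)}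

namespace KripkeSystem

variable (𝔎 : KripkeSystem G 𝒥)

open Classical in
/-- An assignment that agrees with `x` off `J ∪ J'` is reached from `x` by a change on `J`
followed by a change on `J'`. -/
theorem exists_interpolant {k : 𝔎.K} {x : α → 𝔎.Dom} (hx : x ∈ 𝔎.V k) {y : α → 𝔎.Dom}
    (hy : y ∈ 𝔎.V k) {J : Set α} (hJ : J ∈ 𝒥) {J' : Set α} (h : ∀ i, i ∉ J ∪ J' → y i = x i) :
    ∃ z ∈ 𝔎.V k, (∀ i, i ∉ J → z i = x i) ∧ ∀ i, i ∉ J' → y i = z i := by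
  refine ⟨fun i => if i ∈ J then y i else x i, ?_, ?_, ?_⟩
  · refine 𝔎.V_change k x hx J hJ _ (fun i => ?_) (fun i hi => if_neg hi)
    split_ifs
    · exact 𝔎.V_mem k y hy i
    · exact 𝔎.V_mem k x hx i
  · intro i hi
    exact if_neg hi
  · intro i hi
    dsimp only
    split_ifs with h'
    · rfl
    · exact h i (by simp [hi, h'])

open Classical in
/-- If `σ` is injective on `σ⁻¹(J)`, then a change of `x ∘ σ` on `σ⁻¹(J)` is induced by a change
of `x` on `J`. -/
theorem exists_comp_eq {k : 𝔎.K} {x : α → 𝔎.Dom} (hx : x ∈ 𝔎.V k) {z : α → 𝔎.Dom}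
    (hz : z ∈ 𝔎.V k) {σ : α → α} {J : Set α} (hJ : J ∈ 𝒥) {J' : Set α}
    (hJ' : ∀ i, i ∈ J' ↔ σ i ∈ J) (hσ : ∀ i j, i ∈ J' → j ∈ J' → σ i = σ j → i = j)
    (h : ∀ i, i ∉ J' → z i = x (σ i)) :
    ∃ y ∈ 𝔎.V k, (∀ i, i ∉ J → y i = x i) ∧ (fun i => y (σ i)) = z := by
  have hoff : ∀ j, j ∉ J → ¬ ∃ i ∈ J', σ i = j := by
    rintro _ hj ⟨i, hi, rfl⟩
    exact hj ((hJ' i).1 hi)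
  refine ⟨fun j => if h : ∃ i ∈ J', σ i = j then z h.choose else x j, ?_, ?_, ?_⟩
  · refine 𝔎.V_change k x hx J hJ _ (fun i => ?_) (fun i hi => dif_neg (hoff i hi))
    split_ifs
    · exact 𝔎.V_mem k z hz _
    · exact 𝔎.V_mem k x hx i
  · intro i hi
    exact dif_neg (hoff i hi)
  · funext i
    by_cases hi : i ∈ J'
    · have hex : ∃ i' ∈ J', σ i' = σ i := ⟨i, hi, rfl⟩
      dsimp only
      rw [dif_pos hex, hσ _ _ hex.choose_spec.1 hi hex.choose_spec.2]
    · dsimp only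
      rw [dif_neg (hoff _ fun hJ => hi ((hJ' i).2 hJ)), h i hi]

theorem isGPHA_setAlgebra : IsGPHA 𝔎.setAlgebra where
  s_sup _ _ _ := rfl
  s_inf _ _ _ := rfl
  s_himp _ _ _ := rfl
  s_bot _ := rfl
  c_quantifier J := by
    -- the truth of `c_(J) p` at an assignment does not depend on the values on `J`
    have key : ∀ (p : Fam 𝔎) (k) (x y : 𝔎.V k), (∀ i, i ∉ J.1 → y.1 i = x.1 i) →
        (𝔎.setAlgebra.c J p).val k x → (𝔎.setAlgebra.c J p).val k y := by
      rintro p k x y h ⟨z, hz, hp⟩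
      exact ⟨z, fun i hi => (hz i hi).trans (h i hi).symm, hp⟩
    have le_c : ∀ p : Fam 𝔎, p ≤ 𝔎.setAlgebra.c J p := fun p k x h => ⟨x, fun _ _ => rfl, h⟩
    refine ⟨?_, le_c, ?_, ?_, ?_, ?_⟩
    · refine le_antisymm ?_ (le_c _)
      rintro k x ⟨y, _, h⟩
      exact h
    · refine fun p r => le_antisymm ?_ ?_
      · rintro k x ⟨y, hy, h1, h2⟩
        exact ⟨⟨y, hy, h1⟩, key r k y x (fun i hi => (hy i hi).symm) h2⟩
      · rintro k x ⟨⟨y, hy, h1⟩, h2⟩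
        exact ⟨y, hy, h1, key r k x y hy h2⟩
    · refine fun p r => le_antisymm ?_ (le_c _)
      rintro k x ⟨y, hy, h⟩ l hl hp
      have hy' : ∀ i, i ∉ J.1 → x.1 i = y.1 i := fun i hi => (hy i hi).symm
      exact key r l ⟨y.1, 𝔎.V_mono k l hl y.2⟩ ⟨x.1, 𝔎.V_mono k l hl x.2⟩ hy'
        (h l hl (key p l ⟨x.1, 𝔎.V_mono k l hl x.2⟩ ⟨y.1, 𝔎.V_mono k l hl y.2⟩ hy hp))
    · refine fun p r => le_antisymm ?_ (le_c _)
      rintro k x ⟨y, hy, h⟩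
      exact h.imp (key p k y x fun i hi => (hy i hi).symm)
        (key r k y x fun i hi => (hy i hi).symm)
    · refine fun p => le_antisymm ?_ (le_c _)
      rintro k x ⟨y, hy, h⟩
      exact key p k y x (fun i hi => (hy i hi).symm) h
  q_quantifier J := by
    refine ⟨?_, ?_, ?_, ?_⟩
    · exact le_antisymm le_top fun k x _ l _ y _ => trivial
    · exact fun p k x h => h k le_rfl x fun _ _ => rfl
    · intro p r k x h l hl hp m hm y hy
      exact h m (hl.trans hm) y hy m le_rfl (hp m hm y hy)
    · refine fun p => le_antisymm (fun k x h => h k le_rfl x fun _ _ => rfl) ?_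
      intro k x h l hl y hy m hm z hz
      exact h m (hl.trans hm) z fun i hi => (hz i hi).trans (hy i hi)
  s_id ε hε p := by
    refine KripkeSystem.Fam.ext ?_
    funext k x
    change p.val k _ = p.val k x
    congr 1
    exact Subtype.ext (funext fun i => congrArg x.1 (hε i))
  s_comp _ _ _ := rfl
  c_empty J hJ p := by
    refine le_antisymm ?_ fun k x h => ⟨x, fun _ _ => rfl, h⟩
    rintro k x ⟨y, hy, h⟩
    rwa [show x = y from Subtype.ext (funext fun i => (hy i (by simp [hJ])).symm)]
  q_empty J hJ p := by
    refine le_antisymm (fun k x h => h k le_rfl x fun _ _ => rfl) ?_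
    intro k x h l hl y hy
    rw [show y = ⟨x.1, 𝔎.V_mono k l hl x.2⟩ from
      Subtype.ext (funext fun i => hy i (by simp [hJ]))]
    exact p.mono k l hl x h
  c_union J J' L hL p := by
    refine le_antisymm ?_ ?_
    · rintro k x ⟨y, hy, h⟩
      obtain ⟨z, hz, hzx, hzy⟩ := 𝔎.exists_interpolant x.2 y.2 J.2 (J' := J'.1) (by rwa [← hL])
      exact ⟨⟨z, hz⟩, hzx, y, hzy, h⟩
    · rintro k x ⟨z, hz, y, hy, h⟩
      refine ⟨y, fun i hi => ?_, h⟩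
      rw [hL, Set.mem_union, not_or] at hi
      exact (hy i hi.2).trans (hz i hi.1)
  q_union J J' L hL p := by
    refine le_antisymm ?_ ?_
    · intro k x h l hl z hz m hm y hy
      refine h m (hl.trans hm) y fun i hi => ?_
      rw [hL, Set.mem_union, not_or] at hi
      exact (hy i hi.2).trans (hz i hi.1)
    · intro k x h l hl y hy
      obtain ⟨z, hz, hzx, hzy⟩ := 𝔎.exists_interpolant (𝔎.V_mono k l hl x.2) y.2 J.2
        (J' := J'.1) (by rwa [← hL])
      exact h l hl ⟨z, hz⟩ hzx l le_rfl y hzy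
  s_c σ τ J h p := by
    refine le_antisymm ?_ ?_
    · rintro k x ⟨y, hy, hp⟩
      exact ⟨y, fun i hi => (hy i hi).trans (congrArg x.1 (h i hi)), hp⟩
    · rintro k x ⟨y, hy, hp⟩
      exact ⟨y, fun i hi => (hy i hi).trans (congrArg x.1 (h i hi).symm), hp⟩
  s_q σ τ J h p := by
    refine le_antisymm ?_ ?_
    · intro k x hp l hl y hy
      exact hp l hl y fun i hi => (hy i hi).trans (congrArg x.1 (h i hi).symm)
    · intro k x hp l hl y hy
      exact hp l hl y fun i hi => (hy i hi).trans (congrArg x.1 (h i hi))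
  c_s σ J J' hJ hσ p := by
    refine le_antisymm ?_ ?_
    · rintro k x ⟨y, hy, hp⟩
      exact ⟨_, fun i hi => hy _ fun h => hi ((hJ i).2 h), hp⟩
    · rintro k x ⟨z, hz, hp⟩
      obtain ⟨y, hy, hyx, hyz⟩ := 𝔎.exists_comp_eq x.2 z.2 J.2 hJ hσ hz
      refine ⟨⟨y, hy⟩, hyx, ?_⟩
      change p.val k ⟨fun i => y (σ.1 i), _⟩
      rwa [show (⟨fun i => y (σ.1 i), 𝔎.V_comp k y hy σ.1 σ.2⟩ : 𝔎.V k) = z from Subtype.ext hyz]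
  q_s σ J J' hJ hσ p := by
    refine le_antisymm ?_ ?_
    · intro k x hp l hl z hz
      obtain ⟨y, hy, hyx, hyz⟩ := 𝔎.exists_comp_eq (𝔎.V_mono k l hl x.2) z.2 J.2 hJ hσ hz
      have := hp l hl ⟨y, hy⟩ hyx
      change p.val l ⟨fun i => y (σ.1 i), _⟩ at this
      rwa [show (⟨fun i => y (σ.1 i), 𝔎.V_comp l y hy σ.1 σ.2⟩ : 𝔎.V l) = z from
        Subtype.ext hyz] at this
    · intro k x hp l hl y hy
      exact hp l hl _ fun i hi => hy _ fun h => hi ((hJ i).2 h)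

end KripkeSystem

/-! ### Homomorphisms, products and the axioms -/

namespace GAlg

variable {A B C : GAlg G 𝒥}

theorem Hom.map_top (f : Hom A B) : f.toFun ⊤ = ⊤ := by
  simpa only [himp_self] using f.map_himp ⊥ ⊥

theorem Hom.monotone (f : Hom A B) : Monotone f.toFun := by
  intro p r h
  rw [← inf_eq_left, ← f.map_inf, inf_eq_left.2 h]

theorem Hom.le_iff (f : Hom A B) (hf : Function.Injective f.toFun) {p r : A.carrier} :
    f.toFun p ≤ f.toFun r ↔ p ≤ r := by
  rw [← inf_eq_left, ← f.map_inf, hf.eq_iff, inf_eq_left]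

/-- Composition of homomorphisms. -/
def Hom.comp (g : Hom B C) (f : Hom A B) : Hom A C where
  toFun := g.toFun ∘ f.toFun
  map_sup p r := by simp only [Function.comp, f.map_sup, g.map_sup]
  map_inf p r := by simp only [Function.comp, f.map_inf, g.map_inf]
  map_himp p r := by simp only [Function.comp, f.map_himp, g.map_himp]
  map_bot := by simp only [Function.comp, f.map_bot, g.map_bot]
  map_s τ p := by simp only [Function.comp, f.map_s, g.map_s]
  map_c J p := by simp only [Function.comp, f.map_c, g.map_c]
  map_q J p := by simp only [Function.comp, f.map_q, g.map_q]

/-- The homomorphism into a direct product with given components. -/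
def Hom.pi {I : Type u} {B : I → GAlg G 𝒥} (f : ∀ i, Hom A (B i)) : Hom A (GAlg.prod B) where
  toFun p i := (f i).toFun p
  map_sup p r := funext fun i => (f i).map_sup p r
  map_inf p r := funext fun i => (f i).map_inf p r
  map_himp p r := funext fun i => (f i).map_himp p r
  map_bot := funext fun i => (f i).map_bot
  map_s τ p := funext fun i => (f i).map_s τ p
  map_c J p := funext fun i => (f i).map_c J p
  map_q J p := funext fun i => (f i).map_q J p

/-- The projections of a direct product. -/
def Hom.proj {I : Type u} (B : I → GAlg G 𝒥) (i : I) : Hom (GAlg.prod B) (B i) where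
  toFun p := p i
  map_sup _ _ := rfl
  map_inf _ _ := rfl
  map_himp _ _ := rfl
  map_bot := rfl
  map_s _ _ := rfl
  map_c _ _ := rfl
  map_q _ _ := rfl

end GAlg

open GAlg

theorem IsGPHA.of_injective {A B : GAlg G 𝒥} (f : Hom A B) (hf : Function.Injective f.toFun)
    (hB : IsGPHA B) : IsGPHA A where
  s_sup _ _ _ := hf (by simp only [f.map_s, f.map_sup, hB.s_sup])
  s_inf _ _ _ := hf (by simp only [f.map_s, f.map_inf, hB.s_inf])
  s_himp _ _ _ := hf (by simp only [f.map_s, f.map_himp, hB.s_himp])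
  s_bot _ := hf (by simp only [f.map_s, f.map_bot, hB.s_bot])
  c_quantifier J :=
    { map_bot := hf (by simp only [f.map_c, f.map_bot, (hB.c_quantifier J).map_bot])
      le_apply := fun p => (f.le_iff hf).1 (by
        simpa only [f.map_c] using (hB.c_quantifier J).le_apply _)
      map_inf := fun _ _ => hf (by
        simpa only [f.map_c, f.map_inf] using (hB.c_quantifier J).map_inf _ _)
      map_himp := fun _ _ => hf (by
        simpa only [f.map_c, f.map_himp] using (hB.c_quantifier J).map_himp _ _)
      map_sup := fun _ _ => hf (by
        simpa only [f.map_c, f.map_sup] using (hB.c_quantifier J).map_sup _ _)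
      idem := fun _ => hf (by simpa only [f.map_c] using (hB.c_quantifier J).idem _) }
  q_quantifier J :=
    { map_top := hf (by simp only [f.map_q, f.map_top, (hB.q_quantifier J).map_top])
      apply_le := fun p => (f.le_iff hf).1 (by
        simpa only [f.map_q] using (hB.q_quantifier J).apply_le _)
      map_himp := fun _ _ => (f.le_iff hf).1 (by
        simpa only [f.map_q, f.map_himp] using (hB.q_quantifier J).map_himp _ _)
      idem := fun _ => hf (by simpa only [f.map_q] using (hB.q_quantifier J).idem _) }
  s_id ε hε p := hf (by rw [f.map_s, hB.s_id ε hε])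
  s_comp σ τ p := hf (by simp only [f.map_s, hB.s_comp])
  c_empty J hJ p := hf (by rw [f.map_c, hB.c_empty J hJ])
  q_empty J hJ p := hf (by rw [f.map_q, hB.q_empty J hJ])
  c_union J J' L h p := hf (by simp only [f.map_c, hB.c_union J J' L h])
  q_union J J' L h p := hf (by simp only [f.map_q, hB.q_union J J' L h])
  s_c σ τ J h p := hf (by simp only [f.map_c, f.map_s, hB.s_c σ τ J h])
  s_q σ τ J h p := hf (by simp only [f.map_q, f.map_s, hB.s_q σ τ J h])
  c_s σ J J' h h' p := hf (by simp only [f.map_c, f.map_s, hB.c_s σ J J' h h'])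
  q_s σ J J' h h' p := hf (by simp only [f.map_q, f.map_s, hB.q_s σ J J' h h'])

theorem IsGPHA.of_surjective {A B : GAlg G 𝒥} (f : Hom A B) (hf : Function.Surjective f.toFun)
    (hA : IsGPHA A) : IsGPHA B where
  s_sup τ := hf.forall₂.2 fun p r => by simp only [← f.map_s, ← f.map_sup, hA.s_sup]
  s_inf τ := hf.forall₂.2 fun p r => by simp only [← f.map_s, ← f.map_inf, hA.s_inf]
  s_himp τ := hf.forall₂.2 fun p r => by simp only [← f.map_s, ← f.map_himp, hA.s_himp]
  s_bot τ := by simp only [← f.map_s, ← f.map_bot, hA.s_bot]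
  c_quantifier J :=
    { map_bot := by simp only [← f.map_c, ← f.map_bot, (hA.c_quantifier J).map_bot]
      le_apply := hf.forall.2 fun p => by
        rw [← f.map_c]
        exact f.monotone ((hA.c_quantifier J).le_apply p)
      map_inf := hf.forall₂.2 fun p r => by
        simp only [← f.map_c, ← f.map_inf, (hA.c_quantifier J).map_inf]
      map_himp := hf.forall₂.2 fun p r => by
        simp only [← f.map_c, ← f.map_himp, (hA.c_quantifier J).map_himp]
      map_sup := hf.forall₂.2 fun p r => by
        simp only [← f.map_c, ← f.map_sup, (hA.c_quantifier J).map_sup]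
      idem := hf.forall.2 fun p => by simp only [← f.map_c, (hA.c_quantifier J).idem] }
  q_quantifier J :=
    { map_top := by simp only [← f.map_q, ← f.map_top, (hA.q_quantifier J).map_top]
      apply_le := hf.forall.2 fun p => by
        rw [← f.map_q]
        exact f.monotone ((hA.q_quantifier J).apply_le p)
      map_himp := hf.forall₂.2 fun p r => by
        simp only [← f.map_q, ← f.map_himp]
        exact f.monotone ((hA.q_quantifier J).map_himp p r)
      idem := hf.forall.2 fun p => by simp only [← f.map_q, (hA.q_quantifier J).idem] }
  s_id ε hε := hf.forall.2 fun p => by rw [← f.map_s, hA.s_id ε hε]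
  s_comp σ τ := hf.forall.2 fun p => by simp only [← f.map_s, hA.s_comp]
  c_empty J hJ := hf.forall.2 fun p => by rw [← f.map_c, hA.c_empty J hJ]
  q_empty J hJ := hf.forall.2 fun p => by rw [← f.map_q, hA.q_empty J hJ]
  c_union J J' L h := hf.forall.2 fun p => by simp only [← f.map_c, hA.c_union J J' L h]
  q_union J J' L h := hf.forall.2 fun p => by simp only [← f.map_q, hA.q_union J J' L h]
  s_c σ τ J h := hf.forall.2 fun p => by simp only [← f.map_c, ← f.map_s, hA.s_c σ τ J h]
  s_q σ τ J h := hf.forall.2 fun p => by simp only [← f.map_q, ← f.map_s, hA.s_q σ τ J h]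
  c_s σ J J' h h' := hf.forall.2 fun p => by
    simp only [← f.map_c, ← f.map_s, hA.c_s σ J J' h h']
  q_s σ J J' h h' := hf.forall.2 fun p => by
    simp only [← f.map_q, ← f.map_s, hA.q_s σ J J' h h']

theorem IsGPHA.prod {I : Type u} {B : I → GAlg G 𝒥} (hB : ∀ i, IsGPHA (B i)) :
    IsGPHA (GAlg.prod B) where
  s_sup τ _ _ := funext fun i => (hB i).s_sup τ _ _
  s_inf τ _ _ := funext fun i => (hB i).s_inf τ _ _
  s_himp τ _ _ := funext fun i => (hB i).s_himp τ _ _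
  s_bot τ := funext fun i => (hB i).s_bot τ
  c_quantifier J :=
    { map_bot := funext fun i => ((hB i).c_quantifier J).map_bot
      le_apply := fun _ i => ((hB i).c_quantifier J).le_apply _
      map_inf := fun _ _ => funext fun i => ((hB i).c_quantifier J).map_inf _ _
      map_himp := fun _ _ => funext fun i => ((hB i).c_quantifier J).map_himp _ _
      map_sup := fun _ _ => funext fun i => ((hB i).c_quantifier J).map_sup _ _
      idem := fun _ => funext fun i => ((hB i).c_quantifier J).idem _ }
  q_quantifier J :=
    { map_top := funext fun i => ((hB i).q_quantifier J).map_top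
      apply_le := fun _ i => ((hB i).q_quantifier J).apply_le _
      map_himp := fun _ _ i => ((hB i).q_quantifier J).map_himp _ _
      idem := fun _ => funext fun i => ((hB i).q_quantifier J).idem _ }
  s_id ε hε _ := funext fun i => (hB i).s_id ε hε _
  s_comp σ τ _ := funext fun i => (hB i).s_comp σ τ _
  c_empty J hJ _ := funext fun i => (hB i).c_empty J hJ _
  q_empty J hJ _ := funext fun i => (hB i).q_empty J hJ _
  c_union J J' L h _ := funext fun i => (hB i).c_union J J' L h _
  q_union J J' L h _ := funext fun i => (hB i).q_union J J' L h _
  s_c σ τ J h _ := funext fun i => (hB i).s_c σ τ J h _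
  s_q σ τ J h _ := funext fun i => (hB i).s_q σ τ J h _
  c_s σ J J' h h' _ := funext fun i => (hB i).c_s σ J J' h h' _
  q_s σ J J' h h' _ := funext fun i => (hB i).q_s σ J J' h h' _

theorem RGA_subset_GPHA : RGA G 𝒥 ⊆ GPHA G 𝒥 := by
  rintro A ⟨I, B, hB, f, hf⟩
  refine IsGPHA.of_injective f hf (IsGPHA.prod fun i => ?_)
  obtain ⟨𝔎, h𝔎⟩ := hB i
  rw [h𝔎]
  exact 𝔎.isGPHA_setAlgebra

/-- An algebra embeds in a product of members of `𝒞` as soon as homomorphisms to members of `𝒞`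
separate its points. -/
theorem mem_SP_of_separating {𝒞 : Set (GAlg G 𝒥)} {A : GAlg G 𝒥}
    (h : ∀ a b : A.carrier, ¬ a ≤ b → ∃ B ∈ 𝒞, ∃ f : Hom A B, ¬ f.toFun a ≤ f.toFun b) :
    A ∈ SP 𝒞 := by
  choose B hB f hf using h
  refine ⟨{ab : A.carrier × A.carrier // ¬ ab.1 ≤ ab.2}, fun i => B _ _ i.2,
    fun i => hB _ _ i.2, Hom.pi fun i => f _ _ i.2, ?_⟩
  have key : ∀ a b, (fun i : {ab : A.carrier × A.carrier // ¬ ab.1 ≤ ab.2} =>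
      (f _ _ i.2).toFun a) = (fun i => (f _ _ i.2).toFun b) → a ≤ b := by
    intro a b hab
    by_contra hn
    exact hf a b hn (congrFun hab ⟨(a, b), hn⟩).le
  exact fun a b hab => le_antisymm (key a b hab) (key b a hab.symm)

end SetAlgebra

/-! ### Heyting algebras presented by preorders -/

/-- Operations on a preordered set that satisfy the order-theoretic axioms of Heyting algebras.
The partial order associated with the preorder is then a Heyting algebra; direct limits and
quotients by filters are presented in this way. -/
structure PreHeyting (S : Type u) where
  le : S → S → Prop
  sup : S → S → S
  inf : S → S → S
  himp : S → S → S
  bot : S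
  top : S
  le_refl : ∀ a, le a a
  le_trans : ∀ a b c, le a b → le b c → le a c
  le_sup_left : ∀ a b, le a (sup a b)
  le_sup_right : ∀ a b, le b (sup a b)
  sup_le : ∀ a b c, le a c → le b c → le (sup a b) c
  inf_le_left : ∀ a b, le (inf a b) a
  inf_le_right : ∀ a b, le (inf a b) b
  le_inf : ∀ a b c, le a b → le a c → le a (inf b c)
  bot_le : ∀ a, le bot a
  le_top : ∀ a, le a top
  le_himp_iff : ∀ a b c, le a (himp b c) ↔ le (inf a b) c

namespace PreHeyting

variable {S : Type u} (h : PreHeyting S)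

/-- Equivalence in the preorder. -/
def setoid : Setoid S where
  r a b := h.le a b ∧ h.le b a
  iseqv :=
    { refl := fun a => ⟨h.le_refl a, h.le_refl a⟩
      symm := fun hab => ⟨hab.2, hab.1⟩
      trans := fun hab hbc =>
        ⟨h.le_trans _ _ _ hab.1 hbc.1, h.le_trans _ _ _ hbc.2 hab.2⟩ }

/-- The Heyting algebra presented by a preorder with operations. -/
def Quot : Type u := Quotient h.setoid

/-- The class of an element. -/
def cls (a : S) : h.Quot := Quotient.mk h.setoid a

theorem cls_surjective : Function.Surjective h.cls := Quotient.exists_rep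

theorem sup_mono {a a' b b' : S} (ha : h.le a a') (hb : h.le b b') :
    h.le (h.sup a b) (h.sup a' b') :=
  h.sup_le _ _ _ (h.le_trans _ _ _ ha (h.le_sup_left _ _))
    (h.le_trans _ _ _ hb (h.le_sup_right _ _))

theorem inf_mono {a a' b b' : S} (ha : h.le a a') (hb : h.le b b') :
    h.le (h.inf a b) (h.inf a' b') :=
  h.le_inf _ _ _ (h.le_trans _ _ _ (h.inf_le_left _ _) ha)
    (h.le_trans _ _ _ (h.inf_le_right _ _) hb)

theorem himp_mono {a a' b b' : S} (ha : h.le a' a) (hb : h.le b b') :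
    h.le (h.himp a b) (h.himp a' b') := by
  rw [h.le_himp_iff]
  exact h.le_trans _ _ _ (h.inf_mono (h.le_refl _) ha)
    (h.le_trans _ _ _ ((h.le_himp_iff _ _ _).1 (h.le_refl _)) hb)

/-- The implication of the Heyting algebra presented by a preorder. -/
def quotHImp : h.Quot → h.Quot → h.Quot :=
  Quotient.map₂ h.himp fun _ _ ha _ _ hb => ⟨h.himp_mono ha.2 hb.1, h.himp_mono ha.1 hb.2⟩

instance : HeytingAlgebra h.Quot where
  le := Quotient.lift₂ h.le fun _ _ _ _ ha hb => propext
    ⟨fun hab => h.le_trans _ _ _ ha.2 (h.le_trans _ _ _ hab hb.1),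
      fun hab => h.le_trans _ _ _ ha.1 (h.le_trans _ _ _ hab hb.2)⟩
  le_refl := Quotient.ind h.le_refl
  le_trans := by
    rintro ⟨a⟩ ⟨b⟩ ⟨c⟩
    exact h.le_trans a b c
  le_antisymm := by
    rintro ⟨a⟩ ⟨b⟩ hab hba
    exact Quotient.sound ⟨hab, hba⟩
  sup := Quotient.map₂ h.sup fun _ _ ha _ _ hb => ⟨h.sup_mono ha.1 hb.1, h.sup_mono ha.2 hb.2⟩
  inf := Quotient.map₂ h.inf fun _ _ ha _ _ hb => ⟨h.inf_mono ha.1 hb.1, h.inf_mono ha.2 hb.2⟩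
  himp := h.quotHImp
  compl a := h.quotHImp a (h.cls h.bot)
  bot := h.cls h.bot
  top := h.cls h.top
  le_sup_left := by
    rintro ⟨a⟩ ⟨b⟩
    exact h.le_sup_left a b
  le_sup_right := by
    rintro ⟨a⟩ ⟨b⟩
    exact h.le_sup_right a b
  sup_le := by
    rintro ⟨a⟩ ⟨b⟩ ⟨c⟩
    exact h.sup_le a b c
  inf_le_left := by
    rintro ⟨a⟩ ⟨b⟩
    exact h.inf_le_left a b
  inf_le_right := by
    rintro ⟨a⟩ ⟨b⟩
    exact h.inf_le_right a b
  le_inf := by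
    rintro ⟨a⟩ ⟨b⟩ ⟨c⟩
    exact h.le_inf a b c
  bot_le := Quotient.ind h.bot_le
  le_top := Quotient.ind h.le_top
  le_himp_iff := by
    rintro ⟨a⟩ ⟨b⟩ ⟨c⟩
    exact h.le_himp_iff a b c
  himp_bot _ := rfl

end PreHeyting

/-! ### Chart systems and dilations -/

/-- A system of charts for a set `D` of constants: a directed set of injections of the dimension
`α` into `D` whose transition maps belong to the semigroup `G`, with left inverses in `G`, and
such that the assignments `m ∘ τ` (`m` a chart, `τ ∈ G`) are closed under changes on the sets
in `𝒥`. -/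
structure ChartSystem {α : Type u} (G : Subsemigroup (Function.End α)) (𝒥 : Set (Set α))
    (D : Type u) where
  charts : Set (α → D)
  charts_nonempty : charts.Nonempty
  injective : ∀ m ∈ charts, Function.Injective m
  transition : ∀ m ∈ charts, ∀ n ∈ charts, Set.range m ⊆ Set.range n →
    ∃ ρ π : G, (∀ i, m i = n (ρ.1 i)) ∧ ∀ i, π.1 (ρ.1 i) = i
  directed : ∀ m ∈ charts, ∀ n ∈ charts, ∃ l ∈ charts,
    Set.range m ⊆ Set.range l ∧ Set.range n ⊆ Set.range l
  change : ∀ m ∈ charts, ∀ (τ : G), ∀ J ∈ 𝒥, ∀ y : α → D, (∀ i, i ∉ J → y i = m (τ.1 i)) →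
    ∃ n ∈ charts, ∃ ρ : G, ∀ i, y i = n (ρ.1 i)
  preimage_mem : ∀ n ∈ charts, ∀ J ∈ 𝒥, ∀ y : α → D, {i | n i ∈ y '' J} ∈ 𝒥
  empty_mem : ∅ ∈ 𝒥

namespace ChartSystem

variable {α : Type u} {G : Subsemigroup (Function.End α)} {𝒥 : Set (Set α)} {D : Type u}
variable (S : ChartSystem G 𝒥 D)

/-- The admissible assignments of constants. -/
def V : Set (α → D) := {x | ∃ n ∈ S.charts, ∃ ρ : G, ∀ i, x i = n (ρ.1 i)}

theorem exists_id (S : ChartSystem G 𝒥 D) : ∃ ε : G, ∀ i, ε.1 i = i := by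
  obtain ⟨m, hm⟩ := S.charts_nonempty
  obtain ⟨ρ, π, -, h⟩ := S.transition m hm m hm subset_rfl
  exact ⟨π * ρ, h⟩

theorem chart_mem_V {n : α → D} (hn : n ∈ S.charts) : n ∈ S.V := by
  obtain ⟨ε, hε⟩ := S.exists_id
  exact ⟨n, hn, ε, fun i => by rw [hε]⟩

theorem comp_mem_V {x : α → D} (hx : x ∈ S.V) (τ : G) : (fun i => x (τ.1 i)) ∈ S.V := by
  obtain ⟨n, hn, ρ, h⟩ := hx
  exact ⟨n, hn, ρ * τ, fun i => h _⟩

theorem change_mem_V {x : α → D} (hx : x ∈ S.V) {J : Set α} (hJ : J ∈ 𝒥) {y : α → D}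
    (h : ∀ i, i ∉ J → y i = x i) : y ∈ S.V := by
  obtain ⟨n, hn, ρ, hρ⟩ := hx
  exact S.change n hn ρ J hJ y fun i hi => (h i hi).trans (hρ i)

/-- Finitely many admissible assignments factor through a common chart. -/
theorem exists_chart (l : List S.V) :
    ∃ n ∈ S.charts, ∀ x ∈ l, ∃ ρ : G, ∀ i, x.1 i = n (ρ.1 i) := by
  induction l with
  | nil =>
    obtain ⟨m, hm⟩ := S.charts_nonempty
    exact ⟨m, hm, by simp⟩
  | cons x l ih =>
    obtain ⟨n, hn, h⟩ := ih
    obtain ⟨m, hm, ρ, hρ⟩ := x.2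
    obtain ⟨k, hk, hmk, hnk⟩ := S.directed m hm n hn
    obtain ⟨σ, -, hσ, -⟩ := S.transition m hm k hk hmk
    obtain ⟨τ, -, hτ, -⟩ := S.transition n hn k hk hnk
    refine ⟨k, hk, List.forall_mem_cons.2 ⟨⟨σ * ρ, fun i => ?_⟩, fun y hy => ?_⟩⟩
    · rw [hρ, hσ]
      rfl
    · obtain ⟨ρ', hρ'⟩ := h y hy
      refine ⟨τ * ρ', fun i => ?_⟩
      rw [hρ', hτ]
      rfl

theorem factor_unique {n : α → D} (hn : n ∈ S.charts) {x : α → D} {ρ ρ' : G}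
    (h : ∀ i, x i = n (ρ.1 i)) (h' : ∀ i, x i = n (ρ'.1 i)) : ρ = ρ' :=
  Subtype.ext (funext fun i => S.injective n hn ((h i).symm.trans (h' i)))

end ChartSystem

/-! ### The Heyting algebra of a dilation -/

section Terms

variable {α : Type u} {G : Subsemigroup (Function.End α)} {𝒥 : Set (Set α)}
  {A : GAlg G 𝒥}

theorem IsGPHA.s_mono (hA : IsGPHA A) (τ : G) : Monotone (A.s τ) := by
  intro p r h
  rw [← inf_eq_left, ← hA.s_inf, inf_eq_left.2 h]

theorem IsGPHA.s_top (hA : IsGPHA A) (τ : G) : A.s τ ⊤ = ⊤ := by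
  simpa only [himp_self] using hA.s_himp τ ⊥ ⊥

theorem IsGPHA.s_le_iff (hA : IsGPHA A) {ρ π : G} (h : ∀ i, π.1 (ρ.1 i) = i) {p r : A.carrier} :
    A.s ρ p ≤ A.s ρ r ↔ p ≤ r := by
  refine ⟨fun hpr => ?_, fun hpr => hA.s_mono ρ hpr⟩
  have h1 := hA.s_mono π hpr
  rwa [← hA.s_comp, ← hA.s_comp, hA.s_id (π * ρ) h, hA.s_id (π * ρ) h] at h1

namespace ChartSystem

variable {D : Type u} (S : ChartSystem G 𝒥 D) (hA : IsGPHA A)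

/-- `(x, p) ≤ (y, r)` if `s_ρ p ≤ s_ρ' r` whenever `x` and `y` factor as `n ∘ ρ` and `n ∘ ρ'`
through a common chart. -/
def termLE (a b : S.V × A.carrier) : Prop :=
  ∀ n ∈ S.charts, ∀ ρ ρ' : G, (∀ i, a.1.1 i = n (ρ.1 i)) → (∀ i, b.1.1 i = n (ρ'.1 i)) →
    A.s ρ a.2 ≤ A.s ρ' b.2

/-- As the transition maps act injectively, one common chart decides. -/
theorem termLE_iff (hA : IsGPHA A) {a b : S.V × A.carrier} {n : α → D} (hn : n ∈ S.charts) {ρ ρ' : G}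
    (ha : ∀ i, a.1.1 i = n (ρ.1 i)) (hb : ∀ i, b.1.1 i = n (ρ'.1 i)) :
    S.termLE a b ↔ A.s ρ a.2 ≤ A.s ρ' b.2 := by
  refine ⟨fun h => h n hn ρ ρ' ha hb, fun h m hm σ σ' ha' hb' => ?_⟩
  obtain ⟨k, hk, hnk, hmk⟩ := S.directed n hn m hm
  obtain ⟨κ, -, hκ, -⟩ := S.transition n hn k hk hnk
  obtain ⟨μ, π, hμ, hπ⟩ := S.transition m hm k hk hmk
  have e1 : κ * ρ = μ * σ := S.factor_unique hk (x := a.1.1)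
    (fun i => by rw [ha, hκ]; rfl) (fun i => by rw [ha', hμ]; rfl)
  have e2 : κ * ρ' = μ * σ' := S.factor_unique hk (x := b.1.1)
    (fun i => by rw [hb, hκ]; rfl) (fun i => by rw [hb', hμ]; rfl)
  have := hA.s_mono κ h
  rw [← hA.s_comp, ← hA.s_comp, e1, e2, hA.s_comp, hA.s_comp] at this
  exact (hA.s_le_iff hπ).1 this

/-- A binary operation, performed in a common chart of the two assignments. -/
noncomputable def termOp (f : A.carrier → A.carrier → A.carrier) (a b : S.V × A.carrier) :
    S.V × A.carrier :=
  let h := S.exists_chart [a.1, b.1]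
  ⟨⟨h.choose, S.chart_mem_V h.choose_spec.1⟩,
    f (A.s (h.choose_spec.2 a.1 (by simp)).choose a.2)
      (A.s (h.choose_spec.2 b.1 (by simp)).choose b.2)⟩

theorem s_termOp (hA : IsGPHA A) {f : A.carrier → A.carrier → A.carrier}
    (hf : ∀ (τ : G) p r, A.s τ (f p r) = f (A.s τ p) (A.s τ r)) {a b : S.V × A.carrier}
    {n : α → D} (hn : n ∈ S.charts) {ρ ρ' τ : G} (ha : ∀ i, a.1.1 i = n (ρ.1 i))
    (hb : ∀ i, b.1.1 i = n (ρ'.1 i)) (hab : ∀ i, (S.termOp f a b).1.1 i = n (τ.1 i)) :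
    A.s τ (S.termOp f a b).2 = f (A.s ρ a.2) (A.s ρ' b.2) := by
  have h := S.exists_chart [a.1, b.1]
  have h1 := (h.choose_spec.2 a.1 (by simp)).choose_spec
  have h2 := (h.choose_spec.2 b.1 (by simp)).choose_spec
  have e1 : τ * (h.choose_spec.2 a.1 (by simp)).choose = ρ :=
    S.factor_unique hn (fun i => (h1 i).trans (hab _)) ha
  have e2 : τ * (h.choose_spec.2 b.1 (by simp)).choose = ρ' :=
    S.factor_unique hn (fun i => (h2 i).trans (hab _)) hb
  rw [← e1, ← e2, hA.s_comp, hA.s_comp, ← hf]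
  rfl

/-- The direct limit of the copies of `A` indexed by the charts, as a preorder on the pairs of
an admissible assignment and an element of `A`. -/
noncomputable def pre : PreHeyting (S.V × A.carrier) where
  le := S.termLE
  sup := S.termOp (· ⊔ ·)
  inf := S.termOp (· ⊓ ·)
  himp := S.termOp (· ⇨ ·)
  bot := ⟨⟨_, S.chart_mem_V S.charts_nonempty.choose_spec⟩, ⊥⟩
  top := ⟨⟨_, S.chart_mem_V S.charts_nonempty.choose_spec⟩, ⊤⟩
  le_refl a := by
    obtain ⟨n, hn, h⟩ := S.exists_chart [a.1]
    obtain ⟨ρ, hρ⟩ := h a.1 (by simp)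
    exact (S.termLE_iff hA hn hρ hρ).2 le_rfl
  le_trans a b c hab hbc := by
    obtain ⟨n, hn, h⟩ := S.exists_chart [a.1, b.1, c.1]
    obtain ⟨ρ, hρ⟩ := h a.1 (by simp)
    obtain ⟨σ, hσ⟩ := h b.1 (by simp)
    obtain ⟨τ, hτ⟩ := h c.1 (by simp)
    exact (S.termLE_iff hA hn hρ hτ).2
      ((hab n hn _ _ hρ hσ).trans (hbc n hn _ _ hσ hτ))
  le_sup_left a b := by
    obtain ⟨n, hn, h⟩ := S.exists_chart [a.1, b.1, (S.termOp (· ⊔ ·) a b).1]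
    obtain ⟨ρ, hρ⟩ := h a.1 (by simp)
    obtain ⟨σ, hσ⟩ := h b.1 (by simp)
    obtain ⟨τ, hτ⟩ := h (S.termOp (· ⊔ ·) a b).1 (by simp)
    rw [S.termLE_iff hA hn hρ hτ, S.s_termOp hA hA.s_sup hn hρ hσ hτ]
    exact le_sup_left
  le_sup_right a b := by
    obtain ⟨n, hn, h⟩ := S.exists_chart [a.1, b.1, (S.termOp (· ⊔ ·) a b).1]
    obtain ⟨ρ, hρ⟩ := h a.1 (by simp)
    obtain ⟨σ, hσ⟩ := h b.1 (by simp)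
    obtain ⟨τ, hτ⟩ := h (S.termOp (· ⊔ ·) a b).1 (by simp)
    rw [S.termLE_iff hA hn hσ hτ, S.s_termOp hA hA.s_sup hn hρ hσ hτ]
    exact le_sup_right
  sup_le a b c hac hbc := by
    obtain ⟨n, hn, h⟩ := S.exists_chart [a.1, b.1, c.1, (S.termOp (· ⊔ ·) a b).1]
    obtain ⟨ρ, hρ⟩ := h a.1 (by simp)
    obtain ⟨σ, hσ⟩ := h b.1 (by simp)
    obtain ⟨κ, hκ⟩ := h c.1 (by simp)
    obtain ⟨τ, hτ⟩ := h (S.termOp (· ⊔ ·) a b).1 (by simp)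
    rw [S.termLE_iff hA hn hτ hκ, S.s_termOp hA hA.s_sup hn hρ hσ hτ]
    exact _root_.sup_le (hac n hn _ _ hρ hκ) (hbc n hn _ _ hσ hκ)
  inf_le_left a b := by
    obtain ⟨n, hn, h⟩ := S.exists_chart [a.1, b.1, (S.termOp (· ⊓ ·) a b).1]
    obtain ⟨ρ, hρ⟩ := h a.1 (by simp)
    obtain ⟨σ, hσ⟩ := h b.1 (by simp)
    obtain ⟨τ, hτ⟩ := h (S.termOp (· ⊓ ·) a b).1 (by simp)
    rw [S.termLE_iff hA hn hτ hρ, S.s_termOp hA hA.s_inf hn hρ hσ hτ]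
    exact inf_le_left
  inf_le_right a b := by
    obtain ⟨n, hn, h⟩ := S.exists_chart [a.1, b.1, (S.termOp (· ⊓ ·) a b).1]
    obtain ⟨ρ, hρ⟩ := h a.1 (by simp)
    obtain ⟨σ, hσ⟩ := h b.1 (by simp)
    obtain ⟨τ, hτ⟩ := h (S.termOp (· ⊓ ·) a b).1 (by simp)
    rw [S.termLE_iff hA hn hτ hσ, S.s_termOp hA hA.s_inf hn hρ hσ hτ]
    exact inf_le_right
  le_inf a b c hab hac := by
    obtain ⟨n, hn, h⟩ := S.exists_chart [a.1, b.1, c.1, (S.termOp (· ⊓ ·) b c).1]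
    obtain ⟨ρ, hρ⟩ := h a.1 (by simp)
    obtain ⟨σ, hσ⟩ := h b.1 (by simp)
    obtain ⟨κ, hκ⟩ := h c.1 (by simp)
    obtain ⟨τ, hτ⟩ := h (S.termOp (· ⊓ ·) b c).1 (by simp)
    rw [S.termLE_iff hA hn hρ hτ, S.s_termOp hA hA.s_inf hn hσ hκ hτ]
    exact _root_.le_inf (hab n hn _ _ hρ hσ) (hac n hn _ _ hρ hκ)
  bot_le a := fun n hn ρ ρ' _ _ => by
    rw [hA.s_bot]
    exact bot_le
  le_top a := fun n hn ρ ρ' _ _ => by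
    rw [hA.s_top]
    exact le_top
  le_himp_iff a b c := by
    obtain ⟨n, hn, h⟩ := S.exists_chart
      [a.1, b.1, c.1, (S.termOp (· ⊓ ·) a b).1, (S.termOp (· ⇨ ·) b c).1]
    obtain ⟨ρ, hρ⟩ := h a.1 (by simp)
    obtain ⟨σ, hσ⟩ := h b.1 (by simp)
    obtain ⟨κ, hκ⟩ := h c.1 (by simp)
    obtain ⟨τ, hτ⟩ := h (S.termOp (· ⊓ ·) a b).1 (by simp)
    obtain ⟨μ, hμ⟩ := h (S.termOp (· ⇨ ·) b c).1 (by simp)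
    rw [S.termLE_iff hA hn hρ hμ, S.termLE_iff hA hn hτ hκ,
      S.s_termOp hA hA.s_inf hn hρ hσ hτ, S.s_termOp hA hA.s_himp hn hσ hκ hμ]
    exact _root_.le_himp_iff

/-- The dilation of `A` to the constants in `D`. -/
abbrev Dil : Type u := (S.pre hA).Quot

/-- The element `p(x)` of the dilation, for `p ∈ A` and an admissible assignment `x`. -/
noncomputable def ev (x : S.V) (p : A.carrier) : S.Dil hA := (S.pre hA).cls (x, p)

theorem exists_ev (t : S.Dil hA) : ∃ x p, t = S.ev hA x p := by
  obtain ⟨⟨x, p⟩, rfl⟩ := (S.pre hA).cls_surjective t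
  exact ⟨x, p, rfl⟩

variable {S}

theorem ev_le_ev_iff {x y : S.V} {p r : A.carrier} {n : α → D} (hn : n ∈ S.charts) {ρ ρ' : G}
    (hx : ∀ i, x.1 i = n (ρ.1 i)) (hy : ∀ i, y.1 i = n (ρ'.1 i)) :
    S.ev hA x p ≤ S.ev hA y r ↔ A.s ρ p ≤ A.s ρ' r :=
  S.termLE_iff hA hn (a := (x, p)) (b := (y, r)) hx hy

theorem ev_le_ev_of_chart {n : α → D} (hn : n ∈ S.charts) {p r : A.carrier} :
    S.ev hA ⟨n, S.chart_mem_V hn⟩ p ≤ S.ev hA ⟨n, S.chart_mem_V hn⟩ r ↔ p ≤ r := by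
  obtain ⟨ε, hε⟩ := S.exists_id
  have h : ∀ i, n i = n (ε.1 i) := fun i => by rw [hε]
  rw [ev_le_ev_iff hA hn h h, hA.s_id ε hε, hA.s_id ε hε]

theorem ev_eq_ev_iff {x y : S.V} {p r : A.carrier} {n : α → D} (hn : n ∈ S.charts) {ρ ρ' : G}
    (hx : ∀ i, x.1 i = n (ρ.1 i)) (hy : ∀ i, y.1 i = n (ρ'.1 i)) :
    S.ev hA x p = S.ev hA y r ↔ A.s ρ p = A.s ρ' r := by
  rw [le_antisymm_iff, le_antisymm_iff, ev_le_ev_iff hA hn hx hy, ev_le_ev_iff hA hn hy hx]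

theorem ev_eq_chart {x : S.V} {p : A.carrier} {n : α → D} (hn : n ∈ S.charts) {ρ : G}
    (hx : ∀ i, x.1 i = n (ρ.1 i)) :
    S.ev hA x p = S.ev hA ⟨n, S.chart_mem_V hn⟩ (A.s ρ p) := by
  obtain ⟨ε, hε⟩ := S.exists_id
  have h : ∀ i, n i = n (ε.1 i) := fun i => by rw [hε]
  rw [ev_eq_ev_iff hA hn hx h, hA.s_id ε hε]

theorem ev_comp (x : S.V) (τ : G) (p : A.carrier) :
    S.ev hA ⟨fun i => x.1 (τ.1 i), S.comp_mem_V x.2 τ⟩ p = S.ev hA x (A.s τ p) := by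
  obtain ⟨n, hn, ρ, hρ⟩ := x.2
  rw [ev_eq_ev_iff hA hn (ρ := ρ * τ) (fun i => hρ _) hρ, hA.s_comp]

theorem ev_op {f : A.carrier → A.carrier → A.carrier}
    (hf : ∀ (τ : G) p r, A.s τ (f p r) = f (A.s τ p) (A.s τ r)) (x : S.V) (p r : A.carrier) :
    S.ev hA x (f p r) = (S.pre hA).cls (S.termOp f (x, p) (x, r)) := by
  obtain ⟨n, hn, h⟩ := S.exists_chart [x, (S.termOp f (x, p) (x, r)).1]
  obtain ⟨ρ, hρ⟩ := h x (by simp)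
  obtain ⟨τ, hτ⟩ := h (S.termOp f (x, p) (x, r)).1 (by simp)
  have e := S.s_termOp hA hf hn (a := (x, p)) (b := (x, r)) hρ hρ hτ
  exact (ev_eq_ev_iff hA hn hρ hτ).2 ((hf ρ p r).trans e.symm)

theorem ev_sup (x : S.V) (p r : A.carrier) :
    S.ev hA x (p ⊔ r) = S.ev hA x p ⊔ S.ev hA x r := ev_op hA hA.s_sup x p r

theorem ev_inf (x : S.V) (p r : A.carrier) :
    S.ev hA x (p ⊓ r) = S.ev hA x p ⊓ S.ev hA x r := ev_op hA hA.s_inf x p r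

theorem ev_himp (x : S.V) (p r : A.carrier) :
    S.ev hA x (p ⇨ r) = S.ev hA x p ⇨ S.ev hA x r := ev_op hA hA.s_himp x p r

theorem ev_bot (x : S.V) : S.ev hA x ⊥ = ⊥ := by
  obtain ⟨y, r, h⟩ := S.exists_ev hA ⊥
  rw [h]
  refine le_antisymm ?_ (h ▸ bot_le)
  obtain ⟨n, hn, hxy⟩ := S.exists_chart [x, y]
  obtain ⟨ρ, hρ⟩ := hxy x (by simp)
  obtain ⟨σ, hσ⟩ := hxy y (by simp)
  rw [ev_le_ev_iff hA hn hρ hσ, hA.s_bot]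
  exact bot_le

theorem ev_top (x : S.V) : S.ev hA x ⊤ = ⊤ := by
  simpa only [himp_self] using ev_himp hA x ⊥ ⊥

theorem ev_le_ev_c {J : 𝒥} {x y : S.V} (h : ∀ i, i ∉ J.1 → y.1 i = x.1 i) (p : A.carrier) :
    S.ev hA y p ≤ S.ev hA x (A.c J p) := by
  obtain ⟨n, hn, hxy⟩ := S.exists_chart [x, y]
  obtain ⟨ρ, hρ⟩ := hxy x (by simp)
  obtain ⟨σ, hσ⟩ := hxy y (by simp)
  rw [ev_le_ev_iff hA hn hσ hρ, hA.s_c ρ σ J fun i hi => S.injective n hn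
    ((hρ i).symm.trans ((h i hi).symm.trans (hσ i)))]
  exact hA.s_mono σ ((hA.c_quantifier J).le_apply p)

theorem ev_q_le_ev {J : 𝒥} {x y : S.V} (h : ∀ i, i ∉ J.1 → y.1 i = x.1 i) (p : A.carrier) :
    S.ev hA x (A.q J p) ≤ S.ev hA y p := by
  obtain ⟨n, hn, hxy⟩ := S.exists_chart [x, y]
  obtain ⟨ρ, hρ⟩ := hxy x (by simp)
  obtain ⟨σ, hσ⟩ := hxy y (by simp)
  rw [ev_le_ev_iff hA hn hρ hσ, hA.s_q ρ σ J fun i hi => S.injective n hn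
    ((hρ i).symm.trans ((h i hi).symm.trans (hσ i)))]
  exact hA.s_mono σ ((hA.q_quantifier J).apply_le p)

/-! ### Elements independent of constants, and fresh constants -/

/-- `t` does not depend on the constants in `L`: in some chart, it is represented by an element
that is closed under both quantifiers over the coordinates of `L`. -/
def Indep (L : Set D) (t : S.Dil hA) : Prop :=
  ∃ (n : α → D) (hn : n ∈ S.charts) (J : 𝒥) (p : A.carrier),
    (∀ i, i ∈ J.1 ↔ n i ∈ L) ∧ t = S.ev hA ⟨n, S.chart_mem_V hn⟩ p ∧ A.c J p = p ∧ A.q J p = p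

/-- Independence may be tested in a larger chart. -/
theorem Indep.exists_closed {L : Set D} {t : S.Dil hA} (ht : Indep hA L t) :
    ∃ x : S.V, ∀ (m : α → D) (hm : m ∈ S.charts) (ρ : G), (∀ i, x.1 i = m (ρ.1 i)) →
      ∀ J : 𝒥, (∀ i, i ∈ J.1 ↔ m i ∈ L) →
        ∃ p, t = S.ev hA ⟨m, S.chart_mem_V hm⟩ p ∧ A.c J p = p ∧ A.q J p = p := by
  obtain ⟨n, hn, J', p, hJ', rfl, hc, hq⟩ := ht
  refine ⟨⟨n, S.chart_mem_V hn⟩, fun m hm ρ hρ J hJ => ⟨A.s ρ p, ev_eq_chart hA hm hρ, ?_, ?_⟩⟩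
  · rw [hA.c_s ρ J J' (fun i => by rw [hJ', hJ, show n i = m (ρ.1 i) from hρ i])
      (fun i j _ _ h => S.injective n hn ((hρ i).trans ((congrArg m h).trans (hρ j).symm))), hc]
  · rw [hA.q_s ρ J J' (fun i => by rw [hJ', hJ, show n i = m (ρ.1 i) from hρ i])
      (fun i j _ _ h => S.injective n hn ((hρ i).trans ((congrArg m h).trans (hρ j).symm))), hq]

theorem indep_inf {J : Set α} (hJ : J ∈ 𝒥) {y : α → D} {t t' : S.Dil hA}
    (ht : Indep hA (y '' J) t) (ht' : Indep hA (y '' J) t') : Indep hA (y '' J) (t ⊓ t') := by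
  obtain ⟨x, hx⟩ := ht.exists_closed
  obtain ⟨x', hx'⟩ := ht'.exists_closed
  obtain ⟨n, hn, h⟩ := S.exists_chart [x, x']
  obtain ⟨ρ, hρ⟩ := h x (by simp)
  obtain ⟨σ, hσ⟩ := h x' (by simp)
  let J' : 𝒥 := ⟨_, S.preimage_mem n hn J hJ y⟩
  obtain ⟨p, rfl, hc, hq⟩ := hx n hn ρ hρ J' fun i => Iff.rfl
  obtain ⟨p', rfl, hc', hq'⟩ := hx' n hn σ hσ J' fun i => Iff.rfl
  refine ⟨n, hn, J', p ⊓ p', fun i => Iff.rfl, (ev_inf hA _ _ _).symm, ?_, ?_⟩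
  · have := (hA.c_quantifier J').map_inf p p'
    rwa [hc, hc'] at this
  · refine le_antisymm ((hA.q_quantifier J').apply_le _) ?_
    have := (hA.q_quantifier J').inf_le p p'
    rwa [hq, hq'] at this

theorem indep_ev {J : Set α} (hJ : J ∈ 𝒥) {y : α → D} {x : S.V}
    (h : ∀ i, x.1 i ∉ y '' J) (p : A.carrier) : Indep hA (y '' J) (S.ev hA x p) := by
  obtain ⟨n, hn, ρ, hρ⟩ := x.2
  let J' : 𝒥 := ⟨_, S.preimage_mem n hn J hJ y⟩
  have h0 : ∀ i, i ∈ (⟨∅, S.empty_mem⟩ : 𝒥).1 ↔ ρ.1 i ∈ J'.1 := by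
    intro i
    have := h i
    rw [hρ] at this
    exact ⟨fun h => h.elim, fun h => this h⟩
  refine ⟨n, hn, J', A.s ρ p, fun i => Iff.rfl, ev_eq_chart hA hn hρ, ?_, ?_⟩
  · rw [hA.c_s ρ J' ⟨∅, S.empty_mem⟩ h0 (fun i j hi => hi.elim), hA.c_empty _ rfl]
  · rw [hA.q_s ρ J' ⟨∅, S.empty_mem⟩ h0 (fun i j hi => hi.elim), hA.q_empty _ rfl]

/-- The elimination of fresh existential witnesses. -/
theorem inf_ev_c_le {J : 𝒥} {x y : S.V} (h : ∀ i, i ∉ J.1 → y.1 i = x.1 i)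
    (hy : Set.InjOn y.1 J.1) (hxy : ∀ i, x.1 i ∉ y.1 '' J.1) {p : A.carrier} {t b : S.Dil hA}
    (ht : Indep hA (y.1 '' J.1) t) (hb : Indep hA (y.1 '' J.1) b) (hle : t ⊓ S.ev hA y p ≤ b) :
    t ⊓ S.ev hA x (A.c J p) ≤ b := by
  obtain ⟨u, hu⟩ := ht.exists_closed
  obtain ⟨v, hv⟩ := hb.exists_closed
  obtain ⟨n, hn, hf⟩ := S.exists_chart [x, y, u, v]
  obtain ⟨ρ, hρ⟩ := hf x (by simp)
  obtain ⟨ρ', hρ'⟩ := hf y (by simp)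
  obtain ⟨σ, hσ⟩ := hf u (by simp)
  obtain ⟨τ, hτ⟩ := hf v (by simp)
  let J' : 𝒥 := ⟨_, S.preimage_mem n hn J.1 J.2 y.1⟩
  obtain ⟨t', rfl, hct, -⟩ := hu n hn σ hσ J' fun i => Iff.rfl
  obtain ⟨b', rfl, hcb, -⟩ := hv n hn τ hτ J' fun i => Iff.rfl
  rw [ev_eq_chart hA hn hρ', ← ev_inf, ev_le_ev_of_chart hA hn] at hle
  rw [ev_eq_chart hA hn hρ, ← ev_inf, ev_le_ev_of_chart hA hn]
  have hJ : ∀ i, i ∈ J.1 ↔ ρ'.1 i ∈ J'.1 := by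
    intro i
    change _ ↔ n (ρ'.1 i) ∈ y.1 '' J.1
    rw [← hρ']
    refine ⟨fun hi => ⟨i, hi, rfl⟩, fun hi => ?_⟩
    by_contra hn
    rw [h i hn] at hi
    exact hxy i hi
  have hinj : ∀ i j, i ∈ J.1 → j ∈ J.1 → ρ'.1 i = ρ'.1 j → i = j :=
    fun i j hi hj hij => hy hi hj (by rw [hρ', hρ', hij])
  have hoff : ∀ i, i ∉ J.1 → ρ.1 i = ρ'.1 i := fun i hi =>
    S.injective n hn ((hρ i).symm.trans ((h i hi).symm.trans (hρ' i)))
  have h1 := (hA.c_quantifier J').monotone hle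
  rw [inf_comm] at h1
  rw [← hct, (hA.c_quantifier J').map_inf, hct, hcb, hA.c_s ρ' J' J hJ hinj] at h1
  rwa [hA.s_c ρ ρ' J hoff, inf_comm]

/-- Generalization over fresh constants. -/
theorem le_ev_q {J : 𝒥} {x y : S.V} (h : ∀ i, i ∉ J.1 → y.1 i = x.1 i)
    (hy : Set.InjOn y.1 J.1) (hxy : ∀ i, x.1 i ∉ y.1 '' J.1) {p : A.carrier} {t : S.Dil hA}
    (ht : Indep hA (y.1 '' J.1) t) (hle : t ≤ S.ev hA y p) :
    t ≤ S.ev hA x (A.q J p) := by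
  obtain ⟨u, hu⟩ := ht.exists_closed
  obtain ⟨n, hn, hf⟩ := S.exists_chart [x, y, u]
  obtain ⟨ρ, hρ⟩ := hf x (by simp)
  obtain ⟨ρ', hρ'⟩ := hf y (by simp)
  obtain ⟨σ, hσ⟩ := hf u (by simp)
  let J' : 𝒥 := ⟨_, S.preimage_mem n hn J.1 J.2 y.1⟩
  obtain ⟨t', rfl, -, hqt⟩ := hu n hn σ hσ J' fun i => Iff.rfl
  rw [ev_eq_chart hA hn hρ', ev_le_ev_of_chart hA hn] at hle
  rw [ev_eq_chart hA hn hρ, ev_le_ev_of_chart hA hn]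
  have hJ : ∀ i, i ∈ J.1 ↔ ρ'.1 i ∈ J'.1 := by
    intro i
    change _ ↔ n (ρ'.1 i) ∈ y.1 '' J.1
    rw [← hρ']
    refine ⟨fun hi => ⟨i, hi, rfl⟩, fun hi => ?_⟩
    by_contra hn
    rw [h i hn] at hi
    exact hxy i hi
  have hinj : ∀ i j, i ∈ J.1 → j ∈ J.1 → ρ'.1 i = ρ'.1 j → i = j :=
    fun i j hi hj hij => hy hi hj (by rw [hρ', hρ', hij])
  have hoff : ∀ i, i ∉ J.1 → ρ.1 i = ρ'.1 i := fun i hi =>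
    S.injective n hn ((hρ i).symm.trans ((h i hi).symm.trans (hρ' i)))
  have h1 := (hA.q_quantifier J').monotone hle
  rwa [hqt, hA.q_s ρ' J' J hJ hinj, ← hA.s_q ρ ρ' J hoff] at h1

end ChartSystem

end Terms

open Cardinal

/-! ### Prime filters with witnesses -/

/-- Prime filters of a bounded lattice, as sets. -/
structure IsPrimeFilter {C : Type u} [Lattice C] [BoundedOrder C] (P : Set C) : Prop where
  top_mem : ⊤ ∈ P
  bot_notMem : ⊥ ∉ P
  mem_of_le : ∀ {a b}, a ≤ b → a ∈ P → b ∈ P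
  inf_mem : ∀ {a b}, a ∈ P → b ∈ P → a ⊓ b ∈ P
  mem_or_mem : ∀ {a b}, a ⊔ b ∈ P → a ∈ P ∨ b ∈ P

section Witnesses

variable {C : Type u} [DistribLattice C] [BoundedOrder C] {I : Type u} [LinearOrder I]
  [WellFoundedLT I]

/-- The prime filter theorem, with witnesses: if `w i` may conservatively be added as a witness
of `φ i` in the presence of the earlier witnesses, then `b` can be avoided by a prime filter that
contains `w i` whenever it contains `φ i`. The witness `w i` is adopted when `φ i` is consistent
with the witnesses adopted before. -/
theorem exists_prime_filter_with_witnesses (F : Set C) (hF : ⊤ ∈ F)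
    (hinf : ∀ f ∈ F, ∀ g ∈ F, f ⊓ g ∈ F) (b : C) (hb : ∀ f ∈ F, ¬ f ≤ b) (φ w : I → C)
    (hw : ∀ i, ∀ f ∈ F, ∀ s : Finset I, (∀ j ∈ s, j < i) → f ⊓ s.inf w ⊓ w i ≤ b →
      f ⊓ s.inf w ⊓ φ i ≤ b) :
    ∃ P : Set C, IsPrimeFilter P ∧ F ⊆ P ∧ b ∉ P ∧ ∀ i, φ i ∈ P → w i ∈ P := by
  classical
  let step : ∀ i : I, (∀ j, j < i → Prop) → Prop := fun i g =>
    ∀ f ∈ F, ∀ s : Finset I, (∀ j ∈ s, ∃ h : j < i, g j h) → ¬ f ⊓ s.inf w ⊓ φ i ≤ b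
  obtain ⟨T, hT⟩ : ∃ T : I → Prop, ∀ i, T i ↔ ∀ f ∈ F, ∀ s : Finset I,
      (∀ j ∈ s, ∃ _ : j < i, T j) → ¬ f ⊓ s.inf w ⊓ φ i ≤ b :=
    ⟨wellFounded_lt.fix step, fun i => by rw [wellFounded_lt.fix_eq step i]⟩
  -- consistency of the adopted witnesses, by elimination of the last one that is used
  have key : ∀ s : Finset I, (∀ j ∈ s, T j) → ∀ f ∈ F, ¬ f ⊓ s.inf w ≤ b := by
    intro s hs f hf hle
    rcases s.eq_empty_or_nonempty with rfl | hne
    · exact hb f hf (by simpa using hle)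
    · have hmax := s.max'_mem hne
      have hs' : (s.erase (s.max' hne)).inf w ⊓ w (s.max' hne) = s.inf w := by
        conv_rhs => rw [← Finset.insert_erase hmax, Finset.inf_insert, inf_comm]
      have hlt : ∀ j ∈ s.erase (s.max' hne), j < s.max' hne := fun j hj =>
        s.lt_max'_of_mem_erase_max' hne hj
      refine (hT _).1 (hs _ hmax) f hf (s.erase (s.max' hne))
        (fun j hj => ⟨hlt j hj, hs j (Finset.mem_of_mem_erase hj)⟩) ?_
      refine hw _ f hf _ hlt ?_
      rwa [inf_assoc, hs']
  let Q : Set C := {c | ∃ f ∈ F, ∃ s : Finset I, (∀ j ∈ s, T j) ∧ f ⊓ s.inf w ≤ c}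
  have hQ : Order.IsPFilter Q := by
    refine Order.IsPFilter.of_def ⟨⊤, ⊤, hF, ∅, by simp, le_top⟩ ?_ ?_
    · rintro c ⟨f, hf, s, hs, hc⟩ d ⟨g, hg, t, ht, hd⟩
      refine ⟨c ⊓ d, ⟨f ⊓ g, hinf f hf g hg, s ∪ t, ?_, ?_⟩, inf_le_left, inf_le_right⟩
      · intro j hj
        exact (Finset.mem_union.1 hj).elim (hs j) (ht j)
      · rw [Finset.inf_union]
        exact le_inf ((inf_le_inf inf_le_left inf_le_left).trans hc)
          ((inf_le_inf inf_le_right inf_le_right).trans hd)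
    · rintro c d hcd ⟨f, hf, s, hs, hc⟩
      exact ⟨f, hf, s, hs, hc.trans hcd⟩
  obtain ⟨M, hM, hbM, hdisj⟩ := DistribLattice.prime_ideal_of_disjoint_filter_ideal
    (F := hQ.toPFilter) (I := Order.Ideal.principal b) (by
      rw [Set.disjoint_left]
      rintro c ⟨f, hf, s, hs, hc⟩ hcb
      exact key s hs f hf (hc.trans hcb))
  have hQM : ∀ c ∈ Q, c ∉ M := fun c hc hcM => Set.disjoint_left.1 hdisj hc hcM
  have hP : IsPrimeFilter ((M : Set C)ᶜ) :=
    { top_mem := fun h => hM.toIsProper.top_notMem h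
      bot_notMem := fun h => h M.bot_mem
      mem_of_le := fun hab ha hb => ha (M.lower hab hb)
      inf_mem := fun ha hb hab => (hM.mem_or_mem hab).elim ha hb
      mem_or_mem := fun {a b} hab => by
        by_contra! hcon
        exact hab (M.sup_mem (not_not.1 hcon.1) (not_not.1 hcon.2)) }
  have hFP : ∀ f ∈ F, f ∈ ((M : Set C)ᶜ) := fun f hf =>
    hQM f ⟨f, hf, ∅, by simp, inf_le_left⟩
  have hTP : ∀ i, T i → w i ∈ ((M : Set C)ᶜ) := fun i hi =>
    hQM _ ⟨⊤, hF, {i}, by simpa using hi, by simp⟩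
  have hbP : b ∉ ((M : Set C)ᶜ) := fun h => h (hbM (Order.Ideal.mem_principal.2 le_rfl))
  refine ⟨_, hP, hFP, hbP, fun i hi => hTP i ((hT i).2 fun f hf s hs hle => hbP ?_)⟩
  refine hP.mem_of_le hle (hP.inf_mem (hP.inf_mem (hFP f hf) ?_) hi)
  exact Finset.inf_induction hP.top_mem (fun _ h₁ _ h₂ => hP.inf_mem h₁ h₂)
    fun j hj => hTP j (hs j hj).2

end Witnesses

/-- Fresh constants can be chosen successively: at stage `i`, a copy of `α` in `Y` that avoids the
given small set `N i` and the copies chosen before. -/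
theorem exists_fresh {α D I : Type u} [LinearOrder I] [WellFoundedLT I] (Y : Set D)
    (hY : ℵ₀ ≤ #Y) (hI : ∀ i : I, #(Set.Iio i) < #Y) (hα : #α < #Y) (N : I → Set D)
    (hN : ∀ i, #(N i) < #Y) :
    ∃ e : I → α → D, ∀ i, Function.Injective (e i) ∧
      ∀ a, e i a ∈ Y ∧ e i a ∉ N i ∧ ∀ j < i, ∀ c, e i a ≠ e j c := by
  have step : ∀ (i : I) (g : ∀ j, j < i → α → D), ∃ f : α → D, Function.Injective f ∧
      ∀ a, f a ∈ Y ∧ f a ∉ N i ∧ ∀ j (h : j < i), ∀ c, f a ≠ g j h c := by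
    intro i g
    let B : Set D := N i ∪ Set.range fun q : Set.Iio i × α => g q.1.1 q.1.2 q.2
    have hB : #B < #Y := by
      refine (mk_union_le _ _).trans_lt (add_lt_of_lt hY (hN i) ?_)
      refine mk_range_le.trans_lt ?_
      rw [mk_prod, lift_id, lift_id]
      exact mul_lt_of_lt hY (hI i) hα
    have hle : #α ≤ #(Y \ B : Set D) := by
      by_contra! hlt
      have h1 : #Y ≤ #(Y \ B : Set D) + #B :=
        (mk_le_mk_of_subset (by rw [Set.sdiff_union_self]; exact Set.subset_union_left)).trans
          (mk_union_le _ _)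
      exact absurd h1 (add_lt_of_lt hY (hlt.trans hα) hB).not_ge
    obtain ⟨f⟩ := hle
    refine ⟨fun a => (f a).1, fun a c hac => f.injective (Subtype.ext hac), fun a => ?_⟩
    refine ⟨(f a).2.1, fun h => (f a).2.2 (Or.inl h), fun j hj c hac => (f a).2.2 (Or.inr ?_)⟩
    exact ⟨(⟨j, hj⟩, c), hac.symm⟩
  choose f hf using step
  refine ⟨wellFounded_lt.fix f, fun i => ?_⟩
  rw [wellFounded_lt.fix_eq f i]
  exact hf i _

/-! ### The extension of theories -/

namespace ChartSystem

variable {α : Type u} {G : Subsemigroup (Function.End α)} {𝒥 : Set (Set α)} {A : GAlg G 𝒥}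
  {D : Type u} {S : ChartSystem G 𝒥 D} (hA : IsGPHA A)

variable (S) in
/-- The elements of the dilation that depend only on the constants in `X`. -/
def Over (X : Set D) : Set (S.Dil hA) :=
  {t | ∀ J ∈ 𝒥, ∀ y : α → D, (∀ i ∈ J, y i ∉ X) → Indep hA (y '' J) t}

theorem over_mono {X X' : Set D} (h : X ⊆ X') : S.Over hA X ⊆ S.Over hA X' :=
  fun _ ht J hJ y hy => ht J hJ y fun i hi hX => hy i hi (h hX)

theorem inf_mem_over {X : Set D} {t t' : S.Dil hA} (ht : t ∈ S.Over hA X)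
    (ht' : t' ∈ S.Over hA X) : t ⊓ t' ∈ S.Over hA X :=
  fun J hJ y hy => indep_inf hA hJ (ht J hJ y hy) (ht' J hJ y hy)

theorem ev_mem_over {X : Set D} {x : S.V} (hx : ∀ i, x.1 i ∈ X) (p : A.carrier) :
    S.ev hA x p ∈ S.Over hA X := by
  intro J hJ y hy
  refine indep_ev hA hJ ?_ p
  rintro i ⟨j, hj, h⟩
  exact hy j hj (h ▸ hx i)

theorem top_mem_over (X : Set D) : ⊤ ∈ S.Over hA X := by
  intro J hJ y _
  obtain ⟨n, hn⟩ := S.charts_nonempty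
  refine ⟨n, hn, ⟨_, S.preimage_mem n hn J hJ y⟩, ⊤, fun i => Iff.rfl, (ev_top hA _).symm, ?_, ?_⟩
  · exact top_le_iff.1 ((hA.c_quantifier _).le_apply _)
  · exact (hA.q_quantifier _).map_top

variable (S) in
/-- `P` contains witnesses, among the constants in `X`, for its existential members. -/
def IsSaturated (X : Set D) (P : Set (S.Dil hA)) : Prop :=
  ∀ (J : 𝒥) (x : S.V) (p : A.carrier), (∀ i, x.1 i ∈ X) → S.ev hA x (A.c J p) ∈ P →
    ∃ y : S.V, (∀ i, y.1 i ∈ X) ∧ (∀ i, i ∉ J.1 → y.1 i = x.1 i) ∧ S.ev hA y p ∈ P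

/-- A cardinal at least as large as the language, and closed under the formation of
`α`-sequences. -/
structure IsLarge (A : GAlg G 𝒥) (κ : Cardinal.{u}) : Prop where
  aleph0_le : ℵ₀ ≤ κ
  carrier_le : #A.carrier ≤ κ
  index_le : #𝒥 ≤ κ
  dim_lt : #α < κ
  power_eq : κ ^ #α = κ

theorem mk_assignments_le {κ : Cardinal.{u}} (hκ : IsLarge A κ) {X : Set D} (hX : #X ≤ κ) :
    #{x : S.V // ∀ i, x.1 i ∈ X} ≤ κ := by
  have hinj : Function.Injective fun (x : {x : S.V // ∀ i, x.1 i ∈ X}) (i : α) =>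
      (⟨x.1.1 i, x.2 i⟩ : X) := by
    intro x y h
    exact Subtype.ext (Subtype.ext (funext fun i => congrArg Subtype.val (congrFun h i)))
  refine (mk_le_of_injective hinj).trans ?_
  rw [← power_def, ← hκ.power_eq]
  exact power_le_power_right hX

theorem exists_subset_compl {κ : Cardinal.{u}} (hκ : ℵ₀ ≤ κ) (hD : κ < #D) {X : Set D}
    (hX : #X ≤ κ) : ∃ Y : Set D, #Y = κ ∧ ∀ d ∈ Y, d ∉ X := by
  have h : κ ≤ #(Xᶜ : Set D) := by
    by_contra! hlt
    have h1 := mk_sum_compl X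
    exact absurd h1 (add_lt_of_lt (hκ.trans hD.le) (hX.trans_lt hD) (hlt.trans hD)).ne
  obtain ⟨Y, hYX, hY⟩ := le_mk_iff_exists_subset.1 h
  exact ⟨Y, hY, hYX⟩

open Classical in
/-- If no element of `F` is below `b`, then after adding few new constants, `F` extends to a
saturated prime filter that avoids `b`. -/
theorem exists_saturated {κ : Cardinal.{u}} (hκ : IsLarge A κ) (hD : κ < #D) {X : Set D}
    (hX : #X ≤ κ) {n : α → D} (hn : n ∈ S.charts) (hnX : ∀ i, n i ∈ X) {F : Set (S.Dil hA)}
    (hFX : F ⊆ S.Over hA X) (htop : ⊤ ∈ F) (hinf : ∀ f ∈ F, ∀ g ∈ F, f ⊓ g ∈ F) {b : S.Dil hA}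
    (hbX : b ∈ S.Over hA X) (hb : ∀ f ∈ F, ¬ f ≤ b) :
    ∃ (X' : Set D) (P : Set (S.Dil hA)), X ⊆ X' ∧ #X' ≤ κ ∧ IsPrimeFilter P ∧ F ⊆ P ∧ b ∉ P ∧
      S.IsSaturated hA X' P := by
  obtain ⟨Y, hY, hYX⟩ := exists_subset_compl hκ.aleph0_le hD hX
  have hX' : #(X ∪ Y : Set D) ≤ κ := by
    refine (mk_union_le _ _).trans ?_
    rw [hY]
    exact add_le_of_le hκ.aleph0_le hX le_rfl
  -- the existential formulas over `X ∪ Y`, enumerated in order type `κ`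
  let Φ : Type u := 𝒥 × A.carrier × {x : S.V // ∀ i, x.1 i ∈ X ∪ Y}
  have hΦ : #Φ ≤ κ := by
    simp only [Φ, mk_prod, lift_id]
    exact mul_le_of_le hκ.aleph0_le hκ.index_le
      (mul_le_of_le hκ.aleph0_le hκ.carrier_le (mk_assignments_le hκ hX'))
  let I : Type u := κ.ord.ToType
  have hIκ : #I = κ := mk_toType κ.ord |>.trans (card_ord κ)
  obtain ⟨emb⟩ : #Φ ≤ #I := hΦ.trans_eq hIκ.symm
  have : Nonempty Φ :=
    ⟨⟨∅, S.empty_mem⟩, ⊤, ⟨n, S.chart_mem_V hn⟩, fun i => Or.inl (hnX i)⟩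
  let φ : I → Φ := Function.invFun emb
  have hφ : Function.Surjective φ := Function.invFun_surjective emb.injective
  have hI : ∀ i : I, #(Set.Iio i) < κ := fun i => (mk_Iio_lt i (by simp [I])).trans_eq hIκ
  have hα : ℵ₀ ≤ κ := hκ.aleph0_le
  have hN : ∀ i : I, #(⋃ j : Set.Iic i, Set.range (φ j).2.2.1.1 : Set D) < κ := by
    intro i
    have h1 : #(Set.Iic i) < κ := by
      rw [← Set.Iio_insert]
      exact mk_insert_le.trans_lt
        (add_lt_of_lt hα (hI i) (one_lt_aleph0.trans_le hα))
    have h2 : (⋃ j : Set.Iic i, Set.range (φ j).2.2.1.1 : Set D) =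
        Set.range fun q : Set.Iic i × α => (φ q.1).2.2.1.1 q.2 := by
      ext d
      simp
    rw [h2]
    refine mk_range_le.trans_lt ?_
    rw [mk_prod, lift_id, lift_id]
    exact mul_lt_of_lt hα h1 hκ.dim_lt
  obtain ⟨e, he⟩ := exists_fresh (α := α) (I := I) Y (hY ▸ hα) (by rwa [hY])
    (by rw [hY]; exact hκ.dim_lt) _ (by rwa [hY])
  have hxN : ∀ i j : I, j ≤ i → ∀ a c, e i a ≠ (φ j).2.2.1.1 c := by
    intro i j hji a c h
    exact ((he i).2 a).2.1 (Set.mem_iUnion.2 ⟨⟨j, hji⟩, c, h.symm⟩)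
  -- the witnessing assignments
  let y : I → α → D := fun i a => if a ∈ (φ i).1.1 then e i a else (φ i).2.2.1.1 a
  have hyJ : ∀ i, ∀ a ∈ (φ i).1.1, y i a = e i a := fun i a ha => if_pos ha
  have hyx : ∀ i, ∀ a, a ∉ (φ i).1.1 → y i a = (φ i).2.2.1.1 a := fun i a ha => if_neg ha
  have hyV : ∀ i, y i ∈ S.V := fun i => S.change_mem_V (φ i).2.2.1.2 (φ i).1.2 (hyx i)
  have hyX : ∀ i a, y i a ∈ X ∪ Y := by
    intro i a
    by_cases ha : a ∈ (φ i).1.1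
    · rw [hyJ i a ha]
      exact Or.inr ((he i).2 a).1
    · rw [hyx i a ha]
      exact (φ i).2.2.2 a
  have hinj : ∀ i, Set.InjOn (y i) (φ i).1.1 := by
    intro i a ha c hc hac
    rw [hyJ i a ha, hyJ i c hc] at hac
    exact (he i).1 hac
  have hfresh : ∀ i, ∀ a ∈ (φ i).1.1, y i a ∉ X := by
    intro i a ha
    rw [hyJ i a ha]
    exact hYX _ ((he i).2 a).1
  have hoffx : ∀ i a, (φ i).2.2.1.1 a ∉ y i '' (φ i).1.1 := by
    rintro i a ⟨c, hc, h⟩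
    rw [hyJ i c hc] at h
    exact hxN i i le_rfl c a h
  have hoffy : ∀ i j, j < i → ∀ a, y j a ∉ y i '' (φ i).1.1 := by
    rintro i j hji a ⟨c, hc, h⟩
    rw [hyJ i c hc] at h
    by_cases ha : a ∈ (φ j).1.1
    · rw [hyJ j a ha] at h
      exact ((he i).2 c).2.2 j hji a h
    · rw [hyx j a ha] at h
      exact hxN i j hji.le c a h
  obtain ⟨P, hP, hFP, hbP, hw⟩ := exists_prime_filter_with_witnesses F htop hinf b hb
    (fun i => S.ev hA (φ i).2.2.1 (A.c (φ i).1 (φ i).2.1))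
    (fun i => S.ev hA ⟨y i, hyV i⟩ (φ i).2.1) (by
      intro i f hf s hs hle
      refine inf_ev_c_le hA (J := (φ i).1) (y := ⟨y i, hyV i⟩) (hyx i) (hinj i) (hoffx i) ?_
        (hbX _ (φ i).1.2 _ (hfresh i)) hle
      refine indep_inf hA (φ i).1.2 (hFX hf _ (φ i).1.2 _ (hfresh i)) ?_
      refine Finset.inf_induction (top_mem_over hA X _ (φ i).1.2 _ (hfresh i))
        (fun _ h₁ _ h₂ => indep_inf hA (φ i).1.2 h₁ h₂) fun j hj => ?_
      exact indep_ev hA (φ i).1.2 (x := ⟨y j, hyV j⟩) (hoffy i j (hs j hj)) _)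
  refine ⟨X ∪ Y, P, Set.subset_union_left, hX', hP, hFP, hbP, fun J x p hx hp => ?_⟩
  obtain ⟨i, hi⟩ := hφ (J, p, ⟨x, hx⟩)
  have h1 := hw i
  have h2 := hyx i
  simp only [hi] at h1 h2
  exact ⟨⟨y i, hyV i⟩, hyX i, h2, h1 hp⟩

end ChartSystem

/-! ### The canonical Kripke system -/

namespace ChartSystem

variable {α : Type u} {G : Subsemigroup (Function.End α)} {𝒥 : Set (Set α)} {A : GAlg G 𝒥}
  {D : Type u} (S : ChartSystem G 𝒥 D) (hA : IsGPHA A) (κ : Cardinal.{u})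

/-- The worlds of the canonical Kripke system: a small set `X` of constants that contains the
range of a chart, with an `X`-saturated prime filter. Only the members of the filter that depend
on constants in `X` alone are significant. -/
structure World : Type u where
  X : Set D
  P : Set (S.Dil hA)
  mk_le : #X ≤ κ
  exists_chart : ∃ n ∈ S.charts, ∀ i, n i ∈ X
  prime : IsPrimeFilter P
  saturated : S.IsSaturated hA X P

variable {S hA κ} in
/-- Accessibility: more constants, and more true sentences about the old constants. -/
def World.Le (k l : S.World hA κ) : Prop :=
  k.X ⊆ l.X ∧ ∀ t ∈ S.Over hA k.X, t ∈ k.P → t ∈ l.P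

instance : Preorder (S.World hA κ) where
  le := World.Le
  le_refl k := ⟨subset_rfl, fun _ _ h => h⟩
  le_trans k l m hkl hlm := ⟨hkl.1.trans hlm.1, fun t ht htk =>
    hlm.2 t (over_mono hA hkl.1 ht) (hkl.2 t ht htk)⟩

/-- The canonical Kripke system. -/
def canonical [Nonempty α] : KripkeSystem G 𝒥 where
  K := S.World hA κ
  Dom := D
  X k := k.X
  V k := {x | x ∈ S.V ∧ ∀ i, x i ∈ k.X}
  X_nonempty k := by
    obtain ⟨n, hn, h⟩ := k.exists_chart
    exact ⟨_, h (Classical.arbitrary α)⟩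
  X_mono := fun k l (h : World.Le k l) => h.1
  V_nonempty k := by
    obtain ⟨n, hn, h⟩ := k.exists_chart
    exact ⟨n, S.chart_mem_V hn, h⟩
  V_mono := fun k l (h : World.Le k l) x hx => ⟨hx.1, fun i => h.1 (hx.2 i)⟩
  V_mem k x hx := hx.2
  V_comp k x hx τ hτ := ⟨S.comp_mem_V hx.1 ⟨τ, hτ⟩, fun i => hx.2 _⟩
  V_change k x hx J hJ y hy h := ⟨S.change_mem_V hx.1 hJ h, hy⟩

variable {S κ} (hκ : IsLarge A κ) (hD : κ < #D)

include hκ hD in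
/-- Every theory over `X` that omits `b` holds in an accessible world that omits `b`. -/
theorem World.exists_of_forall_not_le {X : Set D} (hX : #X ≤ κ)
    (hn : ∃ n ∈ S.charts, ∀ i, n i ∈ X) {F : Set (S.Dil hA)}
    (hFX : F ⊆ S.Over hA X) (htop : ⊤ ∈ F) (hinf : ∀ f ∈ F, ∀ g ∈ F, f ⊓ g ∈ F) {b : S.Dil hA}
    (hbX : b ∈ S.Over hA X) (hb : ∀ f ∈ F, ¬ f ≤ b) :
    ∃ l : S.World hA κ, X ⊆ l.X ∧ F ⊆ l.P ∧ b ∉ l.P := by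
  obtain ⟨n, hn, hnX⟩ := hn
  obtain ⟨X', P, hXX', hX', hP, hFP, hbP, hsat⟩ :=
    exists_saturated hA hκ hD hX hn hnX hFX htop hinf hbX hb
  exact ⟨⟨X', P, hX', ⟨n, hn, fun i => hXX' (hnX i)⟩, hP, hsat⟩, hXX', hFP, hbP⟩

include hκ hD in
/-- The semantics of implication in the canonical Kripke system. -/
theorem World.ev_himp_mem (k : S.World hA κ) {x : S.V} (hx : ∀ i, x.1 i ∈ k.X)
    (p r : A.carrier) : S.ev hA x (p ⇨ r) ∈ k.P ↔
      ∀ l : S.World hA κ, World.Le k l → S.ev hA x p ∈ l.P → S.ev hA x r ∈ l.P := by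
  constructor
  · intro h l hl hp
    have h1 := l.prime.inf_mem (hl.2 _ (ev_mem_over hA hx _) h) hp
    rw [ev_himp] at h1
    exact l.prime.mem_of_le himp_inf_le h1
  · intro h
    by_contra hn
    -- the theory of `k` with the hypothesis `p(x)` added does not contain `r(x)`
    obtain ⟨l, hXl, hFl, hbl⟩ := World.exists_of_forall_not_le hA hκ hD k.mk_le k.exists_chart
      (F := {t | t ∈ S.Over hA k.X ∧ S.ev hA x p ⇨ t ∈ k.P}) (fun t ht => ht.1)
      ⟨top_mem_over hA _, by rw [himp_top]; exact k.prime.top_mem⟩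
      (fun f hf g hg => ⟨inf_mem_over hA hf.1 hg.1, by
        rw [himp_inf_distrib]
        exact k.prime.inf_mem hf.2 hg.2⟩)
      (ev_mem_over hA hx r) (fun f hf hle => hn (by
        rw [ev_himp]
        exact k.prime.mem_of_le (himp_le_himp_left hle) hf.2))
    refine hbl (h l ⟨hXl, fun t ht htk => hFl ⟨ht, k.prime.mem_of_le le_himp htk⟩⟩ (hFl ?_))
    refine ⟨ev_mem_over hA hx p, ?_⟩
    rw [himp_self]
    exact k.prime.top_mem

include hκ hD in
open Classical in
/-- The semantics of universal quantification in the canonical Kripke system. -/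
theorem World.ev_q_mem (k : S.World hA κ) {x : S.V} (hx : ∀ i, x.1 i ∈ k.X) (J : 𝒥)
    (p : A.carrier) : S.ev hA x (A.q J p) ∈ k.P ↔
      ∀ l : S.World hA κ, World.Le k l → ∀ y : S.V, (∀ i, y.1 i ∈ l.X) →
        (∀ i, i ∉ J.1 → y.1 i = x.1 i) → S.ev hA y p ∈ l.P := by
  constructor
  · intro h l hl y _ hyx
    exact l.prime.mem_of_le (ev_q_le_ev hA hyx p) (hl.2 _ (ev_mem_over hA hx _) h)
  · intro h
    by_contra hn
    obtain ⟨Y, hY, hYX⟩ := exists_subset_compl hκ.aleph0_le hD k.mk_le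
    -- a counterexample `y` to `q_(J) p` is named by constants that are new for `k`
    obtain ⟨e⟩ : #α ≤ #Y := hY ▸ hκ.dim_lt.le
    let y : α → D := fun i => if i ∈ J.1 then (e i).1 else x.1 i
    have hyx : ∀ i, i ∉ J.1 → y i = x.1 i := fun i hi => if_neg hi
    have hyJ : ∀ i ∈ J.1, y i = (e i).1 := fun i hi => if_pos hi
    have hyV : y ∈ S.V := S.change_mem_V x.2 J.2 hyx
    have hfresh : ∀ i ∈ J.1, y i ∉ k.X := fun i hi => by
      rw [hyJ i hi]
      exact hYX _ (e i).2
    have hyX : ∀ i, y i ∈ k.X ∪ Y := by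
      intro i
      by_cases hi : i ∈ J.1
      · rw [hyJ i hi]
        exact Or.inr (e i).2
      · rw [hyx i hi]
        exact Or.inl (hx i)
    obtain ⟨m, hm, hmX⟩ := k.exists_chart
    obtain ⟨l, hXl, hFl, hbl⟩ := World.exists_of_forall_not_le hA hκ hD (X := k.X ∪ Y)
      (by
        refine (mk_union_le _ _).trans ?_
        rw [hY]
        exact add_le_of_le hκ.aleph0_le k.mk_le le_rfl)
      ⟨m, hm, fun i => Or.inl (hmX i)⟩
      (F := {t | t ∈ S.Over hA k.X ∧ t ∈ k.P})
      (fun t ht => over_mono hA Set.subset_union_left ht.1)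
      ⟨top_mem_over hA _, k.prime.top_mem⟩
      (fun f hf g hg => ⟨inf_mem_over hA hf.1 hg.1, k.prime.inf_mem hf.2 hg.2⟩)
      (ev_mem_over hA (x := ⟨y, hyV⟩) hyX p) (fun f hf hle => hn (by
        refine k.prime.mem_of_le (le_ev_q hA (y := ⟨y, hyV⟩) hyx ?_ ?_
          (hf.1 J.1 J.2 y hfresh) hle) hf.2
        · intro i hi j hj hij
          change y i = y j at hij
          rw [hyJ i hi, hyJ j hj] at hij
          exact e.injective (Subtype.ext hij)
        · rintro i ⟨j, hj, hji⟩
          exact hfresh j hj ((congrArg (· ∈ k.X) hji).mpr (hx i))))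
    exact hbl (h l ⟨Set.subset_union_left.trans hXl, fun t ht htk => hFl ⟨ht, htk⟩⟩
      ⟨y, hyV⟩ (fun i => hXl (hyX i)) hyx)

/-- The homomorphism from `A` to the set algebra of the canonical Kripke system. -/
def canonicalHom [Nonempty α] : GAlg.Hom A (S.canonical hA κ).setAlgebra where
  toFun p :=
    { val := fun (k : S.World hA κ) x => S.ev hA ⟨x.1, x.2.1⟩ p ∈ k.P
      mono := fun (k l : S.World hA κ) (h : World.Le k l) x hx =>
        h.2 _ (ev_mem_over hA x.2.2 p) hx }
  map_sup p r := KripkeSystem.Fam.ext (by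
    funext (k : S.World hA κ) x
    refine propext ?_
    change _ ∈ k.P ↔ (_ ∈ k.P ∨ _ ∈ k.P)
    rw [ev_sup]
    exact ⟨k.prime.mem_or_mem, fun h => h.elim (k.prime.mem_of_le le_sup_left)
      (k.prime.mem_of_le le_sup_right)⟩)
  map_inf p r := KripkeSystem.Fam.ext (by
    funext (k : S.World hA κ) x
    refine propext ?_
    change _ ∈ k.P ↔ (_ ∈ k.P ∧ _ ∈ k.P)
    rw [ev_inf]
    exact ⟨fun h => ⟨k.prime.mem_of_le inf_le_left h, k.prime.mem_of_le inf_le_right h⟩,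
      fun h => k.prime.inf_mem h.1 h.2⟩)
  map_himp p r := KripkeSystem.Fam.ext (by
    funext (k : S.World hA κ) x
    exact propext (World.ev_himp_mem hA hκ hD k (x := ⟨x.1, x.2.1⟩) x.2.2 p r))
  map_bot := KripkeSystem.Fam.ext (by
    funext (k : S.World hA κ) x
    refine propext ?_
    change _ ∈ k.P ↔ False
    rw [ev_bot]
    exact iff_of_false k.prime.bot_notMem id)
  map_s τ p := KripkeSystem.Fam.ext (by
    funext (k : S.World hA κ) x
    exact congrArg (· ∈ k.P) (ev_comp hA ⟨x.1, x.2.1⟩ τ p).symm)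
  map_c J p := KripkeSystem.Fam.ext (by
    funext (k : S.World hA κ) x
    refine propext ⟨fun h => ?_, ?_⟩
    · obtain ⟨y, hy, hyx, hp⟩ := k.saturated J ⟨x.1, x.2.1⟩ p x.2.2 h
      exact ⟨⟨y.1, y.2, hy⟩, hyx, hp⟩
    · rintro ⟨y, hyx, hp⟩
      exact k.prime.mem_of_le (ev_le_ev_c hA (x := ⟨x.1, x.2.1⟩) (y := ⟨y.1, y.2.1⟩) hyx p) hp)
  map_q J p := KripkeSystem.Fam.ext (by
    funext (k : S.World hA κ) x
    refine propext ((World.ev_q_mem hA hκ hD k (x := ⟨x.1, x.2.1⟩) x.2.2 J p).trans ?_)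
    exact ⟨fun h l hl y hyx => h l hl ⟨y.1, y.2.1⟩ y.2.2 hyx,
      fun h l hl y hy hyx => h l hl ⟨y.1, y.2, hy⟩ hyx⟩)

include S hA hκ hD in
/-- Representability, from the canonical homomorphism at a world that contains `a(n)` and omits
`b(n)`, where `n` is a chart and `¬ a ≤ b`. -/
theorem mem_RGA [Nonempty α] : A ∈ RGA G 𝒥 := by
  refine mem_SP_of_separating fun a b hab =>
    ⟨_, ⟨S.canonical hA κ, rfl⟩, canonicalHom hA hκ hD, fun hle => hab ?_⟩
  obtain ⟨n, hn⟩ := S.charts_nonempty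
  by_contra hab
  obtain ⟨l, hXl, hFl, hbl⟩ := World.exists_of_forall_not_le hA hκ hD (X := Set.range n)
    (mk_range_le.trans hκ.dim_lt.le) ⟨n, hn, fun i => ⟨i, rfl⟩⟩
    (F := {t | t ∈ S.Over hA (Set.range n) ∧ S.ev hA ⟨n, S.chart_mem_V hn⟩ a ≤ t})
    (fun t ht => ht.1) ⟨top_mem_over hA _, le_top⟩
    (fun f hf g hg => ⟨inf_mem_over hA hf.1 hg.1, le_inf hf.2 hg.2⟩)
    (ev_mem_over hA (x := ⟨n, S.chart_mem_V hn⟩) (Set.mem_range_self (f := n)) b)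
    (fun f hf hle => hab ((ev_le_ev_of_chart hA hn).1 (hf.2.trans hle)))
  exact hbl (hle l ⟨n, S.chart_mem_V hn, fun i => hXl ⟨i, rfl⟩⟩
    (hFl ⟨ev_mem_over hA (Set.mem_range_self (f := n)) a, le_rfl⟩))

end ChartSystem

/-- With `μ` the cardinality of `A ⊕ α`, the cardinal `2 ^ μ` is large, as `μ * #α = μ`. -/
theorem exists_isLarge {α : Type u} [Infinite α] {G : Subsemigroup (Function.End α)}
    {𝒥 : Set (Set α)} (A : GAlg G 𝒥) : ChartSystem.IsLarge A #(Set (A.carrier ⊕ α)) := by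
  have hμ : ℵ₀ ≤ #(A.carrier ⊕ α) := aleph0_le_mk _
  have hα : #α ≤ #(A.carrier ⊕ α) := mk_le_of_injective Sum.inr_injective
  have hlt : #(A.carrier ⊕ α) < #(Set (A.carrier ⊕ α)) := by
    rw [mk_set]
    exact cantor _
  refine ⟨hμ.trans hlt.le, (mk_le_of_injective Sum.inl_injective).trans hlt.le, ?_,
    hα.trans_lt hlt, ?_⟩
  · refine (mk_set_le 𝒥).trans ?_
    rw [mk_set, mk_set]
    exact power_le_power_left two_ne_zero hα
  · rw [mk_set, ← power_mul, mul_eq_left hμ hα (mk_ne_zero α)]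

/-- If there are chart systems for arbitrarily large sets of constants, then all algebras that
satisfy the axioms are representable. -/
theorem RGA_eq_GPHA_of_chartSystem {α : Type u} [Infinite α] {G : Subsemigroup (Function.End α)}
    {𝒥 : Set (Set α)} (h : ∀ E : Type u, Infinite E → Nonempty (ChartSystem G 𝒥 (α ⊕ E))) :
    RGA G 𝒥 = GPHA G 𝒥 := by
  refine RGA_subset_GPHA.antisymm fun A hA => ?_
  obtain ⟨S⟩ := h (Set (Set (A.carrier ⊕ α))) inferInstance
  refine ChartSystem.mem_RGA (S := S) hA (exists_isLarge A) ?_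
  refine (?_ : _ < #(Set (Set (A.carrier ⊕ α)))).trans_le (mk_le_of_injective Sum.inr_injective)
  rw [mk_set (α := Set (A.carrier ⊕ α))]
  exact cantor _

/-! ### Chart systems for all transformations -/

theorem exists_injective_cover {α E : Type u} [Infinite α] (R : Set (α ⊕ E)) (hR : #R ≤ #α) :
    ∃ n : α → α ⊕ E, Function.Injective n ∧ R ⊆ Set.range n := by
  have h : #(R ∪ Set.range Sum.inl : Set (α ⊕ E)) = #α := by
    refine le_antisymm ((mk_union_le _ _).trans ?_) ?_
    · exact add_le_of_le (aleph0_le_mk α) hR mk_range_le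
    · rw [← mk_range_eq (Sum.inl : α → α ⊕ E) Sum.inl_injective]
      exact mk_le_mk_of_subset Set.subset_union_right
  obtain ⟨e⟩ := Cardinal.eq.1 h
  refine ⟨fun i => (e.symm i).1, fun i j hij => e.symm.injective (Subtype.ext hij), fun d hd => ?_⟩
  exact ⟨e ⟨d, Or.inl hd⟩, by simp⟩

/-- The system of all injections of `α`. -/
def fullChartSystem {α : Type u} [Infinite α] {𝒥 : Set (Set α)}
    (h𝒥 : 𝒥 = Set.univ ∨ 𝒥 = finiteSets α) (E : Type u) :
    ChartSystem (⊤ : Subsemigroup (Function.End α)) 𝒥 (α ⊕ E) where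
  charts := {m | Function.Injective m}
  charts_nonempty := ⟨Sum.inl, Sum.inl_injective⟩
  injective _ hm := hm
  transition m hm n hn h := by
    choose ρ hρ using fun i => h (Set.mem_range_self i)
    have hinj : Function.Injective ρ := fun i j hij => hm (by rw [← hρ, ← hρ, hij])
    exact ⟨⟨ρ, trivial⟩, ⟨Function.invFun ρ, trivial⟩, fun i => (hρ i).symm,
      Function.leftInverse_invFun hinj⟩
  directed m _ n _ := by
    obtain ⟨l, hl, h⟩ := exists_injective_cover (Set.range m ∪ Set.range n)
      ((mk_union_le _ _).trans (add_le_of_le (aleph0_le_mk α) mk_range_le mk_range_le))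
    exact ⟨l, hl, Set.subset_union_left.trans h, Set.subset_union_right.trans h⟩
  change _ _ _ _ _ y _ := by
    obtain ⟨n, hn, h⟩ := exists_injective_cover (Set.range y) mk_range_le
    choose ρ hρ using fun i => h (Set.mem_range_self i)
    exact ⟨n, hn, ⟨ρ, trivial⟩, fun i => (hρ i).symm⟩
  preimage_mem n hn J hJ y := by
    rcases h𝒥 with rfl | rfl
    · trivial
    · exact (Set.Finite.image y hJ).preimage (Function.Injective.injOn hn)
  empty_mem := by
    rcases h𝒥 with rfl | rfl
    · trivial
    · exact Set.finite_empty

/-! ### Chart systems for strongly rich semigroups -/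

section Rich

variable {α : Type u} {G : Subsemigroup (Function.End α)}

/-- Strongly rich semigroups are closed under modifications at finitely many places. -/
theorem mem_of_finite_modification
    (hG : ∀ τ ∈ G, ∀ i j : α, modify τ {i} (fun _ => j) ∈ G) {F : Set α} (hF : F.Finite) :
    ∀ {τ : Function.End α}, τ ∈ G → ∀ τ' : Function.End α, (∀ i, i ∉ F → τ' i = τ i) →
      τ' ∈ G := by
  classical
  induction F, hF using Set.Finite.induction_on with
  | empty =>
    intro τ hτ τ' h
    rwa [show τ' = τ from funext fun i => h i (Set.notMem_empty i)]
  | @insert a F _ _ ih =>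
    intro τ hτ τ' h
    let τ₁ : α → α := fun i => if i = a then τ a else τ' i
    have h1 : τ₁ ∈ G := by
      refine ih hτ τ₁ fun i hi => ?_
      by_cases hia : i = a
      · rw [hia]
        exact if_pos rfl
      · exact (if_neg hia).trans (h i fun hmem => hmem.elim hia hi)
    have h2 : modify τ₁ {a} (fun _ => τ' a) = τ' := by
      funext i
      by_cases hi : i = a
      · rw [hi]
        exact if_pos rfl
      · exact (if_neg hi).trans (if_neg hi)
    exact h2 ▸ hG τ₁ h1 a (τ' a)

variable {σ π : α → α}

theorem iterate_ne_of_lt (hπ : Function.LeftInverse π σ) {j : α} (hj : j ∉ Set.range σ) {k l : ℕ}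
    (h : k < l) (a : α) : σ^[k] j ≠ σ^[l] a := by
  obtain ⟨m, rfl⟩ := Nat.exists_eq_add_of_lt h
  intro he
  rw [add_assoc, Function.iterate_add_apply, Function.iterate_succ_apply'] at he
  exact hj ⟨_, (hπ.injective.iterate k he).symm⟩

/-- The powers of `σ` leave room for arbitrarily many new constants. -/
theorem le_card_of_compl_range (hπ : Function.LeftInverse π σ) (hσ : Set.range σ ≠ Set.univ)
    {n : ℕ} {K : Finset α} (hK : (K : Set α) = (Set.range σ^[n])ᶜ) : n ≤ K.card := by
  classical
  obtain ⟨j, hj⟩ := (Set.ne_univ_iff_exists_notMem _).1 hσ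
  have hsub : (Finset.range n).image (fun k => σ^[k] j) ⊆ K := by
    intro i hi
    obtain ⟨k, hk, rfl⟩ := Finset.mem_image.1 hi
    rw [← Finset.mem_coe, hK]
    rintro ⟨a, ha⟩
    exact iterate_ne_of_lt hπ hj (Finset.mem_range.1 hk) a ha.symm
  have hinj : Function.Injective fun k => σ^[k] j := by
    intro k l hkl
    rcases lt_trichotomy k l with h | h | h
    · exact absurd hkl (iterate_ne_of_lt hπ hj h j)
    · exact h
    · exact absurd hkl.symm (iterate_ne_of_lt hπ hj h j)
  simpa [Finset.card_image_of_injective _ hinj] using Finset.card_le_card hsub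

variable (G) in
/-- Charts of a strongly rich semigroup: injections `m : α → α ⊕ E` that agree with a
member of `G` up to finitely many places, and whose range contains `α`, with the coordinate map
`i ↦ m⁻¹(i)` from `α` to `α` in `G`. -/
structure IsRichChart {E : Type u} (m : α → α ⊕ E) : Prop where
  injective : Function.Injective m
  exists_approx : ∃ g ∈ G, {i | m i ≠ Sum.inl (g i)}.Finite
  exists_coord : ∃ h ∈ G, ∀ i, m (h i) = Sum.inl i

theorem iterate_mem {τ : α → α} (hid : (id : α → α) ∈ G) (hτ : τ ∈ G) (n : ℕ) : τ^[n] ∈ G := by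
  induction n with
  | zero => exact hid
  | succ n ih => exact G.mul_mem (x := τ^[n]) (y := τ) ih hτ

open Classical in
/-- The chart is `π^n` on the range of `σ^n`, and enumerates the required new constants on the
finite complement of this range. -/
theorem exists_richChart (hG : IsStronglyRich G) {E : Type u} [Infinite E] {R : Set (α ⊕ E)}
    (hR : R.Finite) : ∃ m, IsRichChart G m ∧ R ⊆ Set.range m := by
  obtain ⟨hmod, σ, hσG, π, hπG, hπ, hσ, -, hfin, -⟩ := hG
  have hid : (id : α → α) ∈ G := by
    rw [show (id : α → α) = π * σ from funext fun i => (hπ i).symm]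
    exact G.mul_mem hπG hσG
  let R' : Finset E := (hR.preimage Sum.inr_injective.injOn).toFinset
  let n := R'.card
  have hπn : ∀ i, π^[n] (σ^[n] i) = i := Function.LeftInverse.iterate hπ n
  have hcompl : (Set.range σ^[n])ᶜ.Finite := by
    refine (hfin n).subset fun i hi h => hi ⟨_, h⟩
  let K : Finset α := hcompl.toFinset
  have hK : (K : Set α) = (Set.range σ^[n])ᶜ := hcompl.coe_toFinset
  have hKmem : ∀ i, i ∉ K → ∃ a, σ^[n] a = i := by
    intro i hi
    rw [← Finset.mem_coe, hK, Set.mem_compl_iff, not_not] at hi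
    exact hi
  have hKσ : ∀ a, σ^[n] a ∉ K := by
    intro a ha
    rw [← Finset.mem_coe, hK] at ha
    exact ha ⟨a, rfl⟩
  obtain ⟨T, hRT, hT⟩ := Infinite.exists_superset_card_eq R' K.card
    (le_card_of_compl_range hπ hσ hK)
  let e : K ≃ T := Finset.equivOfCardEq hT.symm
  let m : α → α ⊕ E := fun i => if h : i ∈ K then Sum.inr (e ⟨i, h⟩).1 else Sum.inl (π^[n] i)
  have hmK : ∀ i (h : i ∈ K), m i = Sum.inr (e ⟨i, h⟩).1 := fun i h => dif_pos h
  have hmK' : ∀ i, i ∉ K → m i = Sum.inl (π^[n] i) := fun i h => dif_neg h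
  have hmσ : ∀ a, m (σ^[n] a) = Sum.inl a := fun a => by rw [hmK' _ (hKσ a), hπn]
  refine ⟨m, ⟨?_, ?_, σ^[n], iterate_mem hid hσG n, hmσ⟩, ?_⟩
  · intro i j hij
    by_cases hi : i ∈ K <;> by_cases hj : j ∈ K
    · rw [hmK i hi, hmK j hj] at hij
      simpa using hij
    · rw [hmK i hi, hmK' j hj] at hij
      simp at hij
    · rw [hmK' i hi, hmK j hj] at hij
      simp at hij
    · obtain ⟨a, rfl⟩ := hKmem i hi
      obtain ⟨c, rfl⟩ := hKmem j hj
      rw [hmσ, hmσ, Sum.inl.injEq] at hij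
      rw [hij]
  · refine ⟨π^[n], iterate_mem hid hπG n, K.finite_toSet.subset fun i hi => ?_⟩
    by_contra hiK
    exact hi (hmK' i hiK)
  · rintro (a | d) hd
    · exact ⟨σ^[n] a, hmσ a⟩
    · have hdT : d ∈ T := hRT (by simpa [R'] using hd)
      refine ⟨(e.symm ⟨d, hdT⟩).1, ?_⟩
      rw [hmK _ (e.symm ⟨d, hdT⟩).2]
      simp

theorem IsRichChart.range_subset {E : Type u} {m n : α → α ⊕ E} (hn : IsRichChart G n)
    {F : Set α} (hF : ∀ i, i ∉ F → ∃ a, m i = Sum.inl a) (h : m '' F ⊆ Set.range n) :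
    Set.range m ⊆ Set.range n := by
  rintro _ ⟨i, rfl⟩
  by_cases hi : i ∈ F
  · exact h ⟨i, hi, rfl⟩
  · obtain ⟨c, -, hc⟩ := hn.exists_coord
    obtain ⟨a, ha⟩ := hF i hi
    exact ⟨c a, by rw [hc, ha]⟩

/-- Up to finitely many places, the transition map from `m` to `n` is the approximation of `m`
followed by the coordinate map of `n`, and its left inverse is obtained in the same way. -/
theorem IsRichChart.transition (hG : IsStronglyRich G) {E : Type u} {m n : α → α ⊕ E}
    (hm : IsRichChart G m) (hn : IsRichChart G n) (h : Set.range m ⊆ Set.range n) :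
    ∃ ρ π : G, (∀ i, m i = n (ρ.1 i)) ∧ ∀ i, π.1 (ρ.1 i) = i := by
  classical
  obtain ⟨g, hg, hgm⟩ := hm.exists_approx
  obtain ⟨c, hc, hcm⟩ := hm.exists_coord
  obtain ⟨g', hg', hgn⟩ := hn.exists_approx
  obtain ⟨c', hc', hcn⟩ := hn.exists_coord
  choose ρ hρ using fun i => h (Set.mem_range_self i)
  have hρG : ρ ∈ G := by
    refine mem_of_finite_modification hG.1 hgm (G.mul_mem hc' hg) ρ fun i hi => hn.injective ?_
    rw [hρ, not_not.1 hi]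
    exact (hcn (g i)).symm
  let π : α → α := fun i => if h : ∃ a, m a = n i then h.choose else c (g' i)
  have hπG : π ∈ G := by
    refine mem_of_finite_modification hG.1 hgn (G.mul_mem hc hg') π fun i hi => ?_
    have h1 : m (c (g' i)) = n i := by rw [hcm, not_not.1 hi]
    have h2 : ∃ a, m a = n i := ⟨_, h1⟩
    exact (dif_pos h2).trans (hm.injective (h2.choose_spec.trans h1.symm))
  refine ⟨⟨ρ, hρG⟩, ⟨π, hπG⟩, fun i => (hρ i).symm, fun i => ?_⟩
  have h2 : ∃ a, m a = n (ρ i) := ⟨i, (hρ i).symm⟩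
  exact (dif_pos h2).trans (hm.injective (h2.choose_spec.trans (hρ i)))

/-- The chart system of a strongly rich semigroup. -/
def richChartSystem (hG : IsStronglyRich G) (E : Type u) [Infinite E] :
    ChartSystem G (finiteSets α) (α ⊕ E) where
  charts := {m | IsRichChart G m}
  charts_nonempty := by
    obtain ⟨m, hm, -⟩ := exists_richChart hG (E := E) Set.finite_empty
    exact ⟨m, hm⟩
  injective _ hm := hm.injective
  transition _ hm _ hn h := hm.transition hG hn h
  directed m hm n hn := by
    obtain ⟨g, -, hg⟩ := hm.exists_approx
    obtain ⟨g', -, hg'⟩ := hn.exists_approx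
    obtain ⟨l, hl, h⟩ := exists_richChart hG ((hg.image m).union (hg'.image n))
    exact ⟨l, hl, hl.range_subset (fun i hi => ⟨_, not_not.1 hi⟩) (Set.subset_union_left.trans h),
      hl.range_subset (fun i hi => ⟨_, not_not.1 hi⟩) (Set.subset_union_right.trans h)⟩
  change m hm τ J hJ y hy := by
    obtain ⟨g, -, hg⟩ := hm.exists_approx
    obtain ⟨n, hn, h⟩ := exists_richChart hG ((hg.image m).union (Set.Finite.image y hJ))
    have hmn : Set.range m ⊆ Set.range n :=
      hn.range_subset (fun i hi => ⟨_, not_not.1 hi⟩) (Set.subset_union_left.trans h)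
    obtain ⟨κ, -, hκ, -⟩ := hm.transition hG hn hmn
    have hyn : ∀ i, y i ∈ Set.range n := by
      intro i
      by_cases hi : i ∈ J
      · exact h (Or.inr ⟨i, hi, rfl⟩)
      · rw [hy i hi]
        exact hmn ⟨_, rfl⟩
    choose ρ hρ using hyn
    have hρG : ρ ∈ G := by
      refine mem_of_finite_modification hG.1 hJ (G.mul_mem κ.2 τ.2) ρ fun i hi => hn.injective ?_
      rw [hρ, hy i hi, hκ]
      rfl
    exact ⟨n, hn, ⟨ρ, hρG⟩, fun i => (hρ i).symm⟩
  preimage_mem n hn J hJ y := (Set.Finite.image y hJ).preimage hn.injective.injOn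
  empty_mem := Set.finite_empty

theorem RGA_eq_GPHA_of_isStronglyRich [Infinite α] (hG : IsStronglyRich G) :
    RGA G (finiteSets α) = GPHA G (finiteSets α) :=
  RGA_eq_GPHA_of_chartSystem fun E _ => ⟨richChartSystem hG E⟩

end Rich

theorem RGA_eq_GPHA_top {α : Type u} [Infinite α] {𝒥 : Set (Set α)}
    (h𝒥 : 𝒥 = Set.univ ∨ 𝒥 = finiteSets α) :
    RGA (⊤ : Subsemigroup (Function.End α)) 𝒥 = GPHA (⊤ : Subsemigroup (Function.End α)) 𝒥 :=
  RGA_eq_GPHA_of_chartSystem fun E _ => ⟨fullChartSystem h𝒥 E⟩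

/-! ### Finite transformations: independence of coordinates -/

section FiniteTransformations

variable {β : Type u} {B : GAlg (finTrans β) (finiteSets β)} (hB : IsGPHA B)

/-- The one-element sets of indices. -/
def single (i : β) : finiteSets β := ⟨{i}, Set.finite_singleton i⟩

include hB

theorem c_comm {J J' : finiteSets β} (p : B.carrier) : B.c J (B.c J' p) = B.c J' (B.c J p) := by
  have h : (J.1 ∪ J'.1) ∈ finiteSets β := Set.Finite.union J.2 J'.2
  rw [← hB.c_union J J' ⟨_, h⟩ rfl, ← hB.c_union J' J ⟨_, h⟩ (Set.union_comm _ _)]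

theorem q_comm {J J' : finiteSets β} (p : B.carrier) : B.q J (B.q J' p) = B.q J' (B.q J p) := by
  have h : (J.1 ∪ J'.1) ∈ finiteSets β := Set.Finite.union J.2 J'.2
  rw [← hB.q_union J J' ⟨_, h⟩ rfl, ← hB.q_union J' J ⟨_, h⟩ (Set.union_comm _ _)]

theorem c_eq_self_of_forall {p : B.carrier} {J : finiteSets β}
    (h : ∀ i ∈ J.1, B.c (single i) p = p) : B.c J p = p := by
  obtain ⟨J, hJ⟩ := J
  induction J, hJ using Set.Finite.induction_on with
  | empty => exact hB.c_empty _ rfl p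
  | @insert a F _ hF ih =>
    rw [hB.c_union (single a) ⟨F, hF⟩ _ (Set.insert_eq a F),
      ih fun i hi => h i (Set.mem_insert_of_mem a hi)]
    exact h a (Set.mem_insert a F)

/-- A transformation that moves `J` to a single place outside acts trivially on the elements closed
under a quantifier over `J`, while both quantifiers over `J` act trivially on its values. Hence
both quantifiers have the same closed elements. -/
theorem c_eq_self_iff_q_eq_self [Infinite β] (J : finiteSets β) (p : B.carrier) :
    B.c J p = p ↔ B.q J p = p := by
  classical
  obtain ⟨j, hj⟩ := Set.Finite.exists_notMem J.2
  let τ : finTrans β := ⟨fun i => if i ∈ J.1 then j else i, by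
    refine Set.Finite.subset J.2 fun i hi => ?_
    by_contra hn
    exact hi (if_neg hn)⟩
  let ε : finTrans β := ⟨fun i => i, by
    refine Set.finite_empty.subset fun i hi => hi rfl⟩
  let o : finiteSets β := ⟨∅, Set.finite_empty⟩
  have hoff : ∀ i, i ∉ J.1 → τ.1 i = ε.1 i := fun i hi => if_neg hi
  have hpre : ∀ i, i ∈ o.1 ↔ τ.1 i ∈ J.1 := by
    refine fun i => ⟨fun h => h.elim, fun h => ?_⟩
    by_cases hi : i ∈ J.1
    · rw [show τ.1 i = j from if_pos hi] at h
      exact hj h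
    · rw [hoff i hi] at h
      exact hi h
  have hc : B.c J (B.s τ p) = B.s τ p := by
    rw [hB.c_s τ J o hpre (fun i _ h => h.elim), hB.c_empty o rfl]
  have hq : B.q J (B.s τ p) = B.s τ p := by
    rw [hB.q_s τ J o hpre (fun i _ h => h.elim), hB.q_empty o rfl]
  constructor
  · intro h
    have h1 := hB.s_c τ ε J hoff p
    rw [h, hB.s_id ε fun _ => rfl] at h1
    rwa [h1] at hq
  · intro h
    have h1 := hB.s_q τ ε J hoff p
    rw [h, hB.s_id ε fun _ => rfl] at h1
    rwa [h1] at hc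

end FiniteTransformations

/-! ### Elements with finitely many additional dimensions -/

section Bounded

variable {α : Type u}

/-- The coordinates in `α`, and the additional coordinates below `N`. -/
def IsLow (N : ℕ) (x : α ⊕ ℕ) : Prop := ∀ n, x = Sum.inr n → n < N

theorem exists_low_bound {F : Set (α ⊕ ℕ)} (hF : F.Finite) : ∃ N, ∀ x ∈ F, IsLow N x := by
  obtain ⟨N, hN⟩ := (hF.preimage (f := Sum.inr) Sum.inr_injective.injOn).bddAbove
  refine ⟨N + 1, fun x hx n hn => Nat.lt_succ_of_le (hN ?_)⟩
  rw [Set.mem_preimage, ← hn]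
  exact hx

theorem IsLow.mono {N M : ℕ} (h : N ≤ M) {x : α ⊕ ℕ} (hx : IsLow N x) : IsLow M x :=
  fun n hn => (hx n hn).trans_le h

theorem exists_of_not_isLow {N : ℕ} {x : α ⊕ ℕ} (hx : ¬ IsLow N x) :
    ∃ n, N ≤ n ∧ x = Sum.inr n := by
  simp only [IsLow, not_forall, not_lt] at hx
  obtain ⟨n, hn, h⟩ := hx
  exact ⟨n, h, hn⟩

variable (α) in
/-- The transformations of `α ⊕ ℕ` that move only finitely many points of `α`; their action on
`ℕ` is arbitrary. -/
def semiFin : Subsemigroup (Function.End (α ⊕ ℕ)) where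
  carrier := {τ | {i : α | τ (Sum.inl i) ≠ Sum.inl i}.Finite}
  mul_mem' := by
    intro σ τ hσ hτ
    refine (Set.Finite.union hσ hτ).subset fun i hi => ?_
    by_contra h
    simp only [Set.mem_union, Set.mem_ofPred_eq, not_or, not_not] at h
    apply hi
    change σ (τ (Sum.inl i)) = Sum.inl i
    rw [h.2, h.1]

theorem finite_moved_low (τ : semiFin α) (N : ℕ) : {x | IsLow N x ∧ τ.1 x ≠ x}.Finite := by
  refine ((Set.Finite.image Sum.inl τ.2).union
    ((Set.finite_Iio N).image Sum.inr)).subset ?_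
  rintro (i | n) ⟨h1, h2⟩
  · exact Or.inl ⟨i, h2, rfl⟩
  · exact Or.inr ⟨n, h1 n rfl, rfl⟩

theorem exists_low_image (τ : semiFin α) (N : ℕ) :
    ∃ M, ∀ x, IsLow N x → IsLow M (τ.1 x) := by
  obtain ⟨M, hM⟩ := exists_low_bound ((finite_moved_low τ N).image τ.1)
  refine ⟨max M N, fun x hx => ?_⟩
  by_cases h : τ.1 x = x
  · rw [h]
    exact hx.mono (le_max_right _ _)
  · exact (hM _ ⟨x, ⟨hx, h⟩, rfl⟩).mono (le_max_left _ _)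

open Classical in
/-- The finite transformation that agrees with `τ` on the low coordinates and is the identity
elsewhere. -/
noncomputable def trunc (τ : semiFin α) (N : ℕ) : finTrans (α ⊕ ℕ) :=
  ⟨fun x => if IsLow N x then τ.1 x else x, by
    refine (finite_moved_low τ N).subset fun x hx => ?_
    by_cases h : IsLow N x
    · exact ⟨h, fun h' => hx ((if_pos h).trans h')⟩
    · exact absurd (if_neg h) hx⟩

theorem trunc_of_low (τ : semiFin α) {N : ℕ} {x : α ⊕ ℕ} (h : IsLow N x) :
    (trunc τ N).1 x = τ.1 x := if_pos h

theorem trunc_of_not_low (τ : semiFin α) {N : ℕ} {x : α ⊕ ℕ} (h : ¬ IsLow N x) :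
    (trunc τ N).1 x = x := if_neg h

variable {B : GAlg (finTrans (α ⊕ ℕ)) (finiteSets (α ⊕ ℕ))}

/-- `p` is independent of the additional coordinates from `N` on. -/
def IsBdd (N : ℕ) (p : B.carrier) : Prop := ∀ n, N ≤ n → B.c (single (Sum.inr n)) p = p

theorem IsBdd.mono {N M : ℕ} (h : N ≤ M) {p : B.carrier} (hp : IsBdd N p) : IsBdd M p :=
  fun n hn => hp n (h.trans hn)

variable (hB : IsGPHA B)

section Closure

include hB

theorem IsBdd.sup {N : ℕ} {p r : B.carrier} (hp : IsBdd N p) (hr : IsBdd N r) :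
    IsBdd N (p ⊔ r) := by
  intro n hn
  have := (hB.c_quantifier (single (Sum.inr n))).map_sup p r
  rwa [hp n hn, hr n hn] at this

theorem IsBdd.inf {N : ℕ} {p r : B.carrier} (hp : IsBdd N p) (hr : IsBdd N r) :
    IsBdd N (p ⊓ r) := by
  intro n hn
  have := (hB.c_quantifier (single (Sum.inr n))).map_inf p r
  rwa [hp n hn, hr n hn] at this

theorem IsBdd.himp {N : ℕ} {p r : B.carrier} (hp : IsBdd N p) (hr : IsBdd N r) :
    IsBdd N (p ⇨ r) := by
  intro n hn
  have := (hB.c_quantifier (single (Sum.inr n))).map_himp p r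
  rwa [hp n hn, hr n hn] at this

theorem isBdd_bot (N : ℕ) : IsBdd N (⊥ : B.carrier) :=
  fun n _ => (hB.c_quantifier (single (Sum.inr n))).map_bot

theorem isBdd_top (N : ℕ) : IsBdd N (⊤ : B.carrier) :=
  fun n _ => top_le_iff.1 ((hB.c_quantifier (single (Sum.inr n))).le_apply _)

theorem IsBdd.c {N : ℕ} {p : B.carrier} (hp : IsBdd N p) (J : finiteSets (α ⊕ ℕ)) :
    IsBdd N (B.c J p) := by
  intro n hn
  rw [c_comm hB, hp n hn]

theorem IsBdd.q {N : ℕ} {p : B.carrier} (hp : IsBdd N p) (J : finiteSets (α ⊕ ℕ)) :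
    IsBdd N (B.q J p) := by
  have : Infinite (α ⊕ ℕ) := Infinite.of_injective _ Sum.inr_injective
  intro n hn
  have h := (c_eq_self_iff_q_eq_self hB _ _).1 (hp n hn)
  rw [c_eq_self_iff_q_eq_self hB, q_comm hB, h]

/-- Coordinates that `σ` neither moves nor has as values of moved coordinates are irrelevant for
`s_σ p` if they are for `p`. -/
theorem IsBdd.exists_s {N : ℕ} {p : B.carrier} (hp : IsBdd N p) (σ : finTrans (α ⊕ ℕ)) :
    ∃ M, IsBdd M (B.s σ p) := by
  obtain ⟨M, hM⟩ := exists_low_bound (Set.Finite.union σ.2 (Set.Finite.image σ.1 σ.2))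
  refine ⟨max M N, fun n hn => ?_⟩
  have hlow : ¬ IsLow M (Sum.inr n : α ⊕ ℕ) :=
    fun h => (h n rfl).not_ge ((le_max_left _ _).trans hn)
  have h1 : σ.1 (Sum.inr n) = Sum.inr n := by
    by_contra h
    exact hlow (hM _ (Or.inl h))
  rw [hB.c_s σ (single (Sum.inr n)) (single (Sum.inr n)), hp n ((le_max_right _ _).trans hn)]
  · refine fun i => ⟨?_, fun h => ?_⟩
    · rintro rfl
      exact h1
    · by_contra hi
      refine hlow (hM _ (Or.inr ⟨i, fun h' => hi ?_, h⟩))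
      exact h'.symm.trans h
  · rintro i j rfl rfl _
    rfl

/-- The action of a finite transformation on a bounded element depends only on the low
coordinates. -/
theorem IsBdd.s_congr {N : ℕ} {p : B.carrier} (hp : IsBdd N p) {σ τ : finTrans (α ⊕ ℕ)}
    (h : ∀ x, IsLow N x → σ.1 x = τ.1 x) : B.s σ p = B.s τ p := by
  let J : finiteSets (α ⊕ ℕ) := ⟨{x | σ.1 x ≠ τ.1 x}, by
    refine (Set.Finite.union σ.2 τ.2).subset fun x hx => ?_
    by_contra hn
    rw [Set.mem_union, not_or] at hn
    exact hx ((not_not.1 hn.1).trans (not_not.1 hn.2).symm)⟩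
  have hJ : B.c J p = p := by
    refine c_eq_self_of_forall hB fun x hx => ?_
    obtain ⟨n, hn, rfl⟩ := exists_of_not_isLow fun hlow => hx (h x hlow)
    exact hp n hn
  have := hB.s_c σ τ J (fun x hx => not_not.1 hx) p
  rwa [hJ] at this

end Closure

variable (B) in
/-- The universe of the bounded elements. -/
abbrev Bounded : Type u := {p : B.carrier // ∃ N, IsBdd N p}

theorem exists_common_bound (p r : Bounded B) : ∃ N, IsBdd N p.1 ∧ IsBdd N r.1 := by
  obtain ⟨N, hN⟩ := p.2
  obtain ⟨M, hM⟩ := r.2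
  exact ⟨max N M, hN.mono (le_max_left _ _), hM.mono (le_max_right _ _)⟩

/-- The Heyting algebra of the bounded elements. -/
abbrev boundedHeyting : HeytingAlgebra (Bounded B) where
  sup p r := ⟨p.1 ⊔ r.1, (exists_common_bound p r).imp fun _ h => h.1.sup hB h.2⟩
  inf p r := ⟨p.1 ⊓ r.1, (exists_common_bound p r).imp fun _ h => h.1.inf hB h.2⟩
  himp p r := ⟨p.1 ⇨ r.1, (exists_common_bound p r).imp fun _ h => h.1.himp hB h.2⟩
  compl p := ⟨p.1 ⇨ ⊥, p.2.imp fun _ h => h.himp hB (isBdd_bot hB _)⟩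
  bot := ⟨⊥, 0, isBdd_bot hB 0⟩
  top := ⟨⊤, 0, isBdd_top hB 0⟩
  le_sup_left p _ := le_sup_left (a := p.1)
  le_sup_right p _ := le_sup_right (a := p.1)
  sup_le p _ _ h h' := sup_le (a := p.1) h h'
  inf_le_left p _ := inf_le_left (a := p.1)
  inf_le_right p _ := inf_le_right (a := p.1)
  le_inf p r _ h h' := le_inf (show p.1 ≤ r.1 from h) h'
  le_top p := le_top (a := p.1)
  bot_le p := bot_le (a := p.1)
  le_himp_iff p _ _ := le_himp_iff (a := p.1)
  himp_bot _ := rfl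

/-- The algebra of the bounded elements. Every `τ` in `semiFin α` acts on a bounded element, as a
finite transformation that agrees with `τ` on the low coordinates. -/
noncomputable def boundedAlg : GAlg (semiFin α) (finiteSets (α ⊕ ℕ)) where
  carrier := Bounded B
  heyting := boundedHeyting hB
  s τ p := ⟨B.s (trunc τ p.2.choose) p.1, p.2.choose_spec.exists_s hB _⟩
  c J p := ⟨B.c J p.1, p.2.imp fun _ h => h.c hB J⟩
  q J p := ⟨B.q J p.1, p.2.imp fun _ h => h.q hB J⟩

theorem boundedAlg_s_val {τ : semiFin α} {p : Bounded B} {N : ℕ} (hp : IsBdd N p.1)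
    {σ : finTrans (α ⊕ ℕ)} (hσ : ∀ x, IsLow N x → σ.1 x = τ.1 x) :
    ((boundedAlg hB).s τ p : Bounded B).1 = B.s σ p.1 := by
  change B.s (trunc τ p.2.choose) p.1 = B.s σ p.1
  have h1 : B.s (trunc τ p.2.choose) p.1 = B.s (trunc τ (max p.2.choose N)) p.1 :=
    p.2.choose_spec.s_congr hB fun x hx => by
      rw [trunc_of_low τ hx, trunc_of_low τ (hx.mono (le_max_left _ _))]
  rw [h1]
  exact hp.s_congr hB fun x hx => by rw [trunc_of_low τ (hx.mono (le_max_right _ _)), hσ x hx]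

theorem boundedAlg_s_trunc (τ : semiFin α) {p : Bounded B} {N : ℕ} (hp : IsBdd N p.1) :
    ((boundedAlg hB).s τ p : Bounded B).1 = B.s (trunc τ N) p.1 :=
  boundedAlg_s_val hB hp fun _ hx => trunc_of_low τ hx

/-- Truncation far enough out preserves the preimages of finite sets. -/
theorem mem_iff_trunc_mem {σ : semiFin α} {J J' : finiteSets (α ⊕ ℕ)}
    (hJ : ∀ i, i ∈ J'.1 ↔ σ.1 i ∈ J.1) {N : ℕ} (hN : ∀ x ∈ J.1 ∪ J'.1, IsLow N x) (i : α ⊕ ℕ) :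
    i ∈ J'.1 ↔ (trunc σ N).1 i ∈ J.1 := by
  by_cases hi : IsLow N i
  · rw [trunc_of_low σ hi, hJ]
  · rw [trunc_of_not_low σ hi]
    exact iff_of_false (fun h => hi (hN i (Or.inr h))) (fun h => hi (hN i (Or.inl h)))

theorem exists_bound_of_finite (p : Bounded B) (J J' : finiteSets (α ⊕ ℕ)) :
    ∃ N, IsBdd N p.1 ∧ ∀ x ∈ J.1 ∪ J'.1, IsLow N x := by
  obtain ⟨N, hN⟩ := p.2
  obtain ⟨M, hM⟩ := exists_low_bound (Set.Finite.union J.2 J'.2)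
  exact ⟨max N M, hN.mono (le_max_left _ _), fun x hx => (hM x hx).mono (le_max_right _ _)⟩

theorem isGPHA_boundedAlg : IsGPHA (boundedAlg hB) where
  s_sup τ p r := by
    obtain ⟨N, hp, hr⟩ := exists_common_bound p r
    refine Subtype.ext ?_
    change ((boundedAlg hB).s τ _ : Bounded B).1 =
      ((boundedAlg hB).s τ p : Bounded B).1 ⊔ ((boundedAlg hB).s τ r : Bounded B).1
    rw [boundedAlg_s_trunc hB τ hp, boundedAlg_s_trunc hB τ hr, ← hB.s_sup]
    exact boundedAlg_s_trunc hB τ (p := ⟨p.1 ⊔ r.1, N, hp.sup hB hr⟩) (hp.sup hB hr)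
  s_inf τ p r := by
    obtain ⟨N, hp, hr⟩ := exists_common_bound p r
    refine Subtype.ext ?_
    change ((boundedAlg hB).s τ _ : Bounded B).1 =
      ((boundedAlg hB).s τ p : Bounded B).1 ⊓ ((boundedAlg hB).s τ r : Bounded B).1
    rw [boundedAlg_s_trunc hB τ hp, boundedAlg_s_trunc hB τ hr, ← hB.s_inf]
    exact boundedAlg_s_trunc hB τ (p := ⟨p.1 ⊓ r.1, N, hp.inf hB hr⟩) (hp.inf hB hr)
  s_himp τ p r := by
    obtain ⟨N, hp, hr⟩ := exists_common_bound p r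
    refine Subtype.ext ?_
    change ((boundedAlg hB).s τ _ : Bounded B).1 =
      ((boundedAlg hB).s τ p : Bounded B).1 ⇨ ((boundedAlg hB).s τ r : Bounded B).1
    rw [boundedAlg_s_trunc hB τ hp, boundedAlg_s_trunc hB τ hr, ← hB.s_himp]
    exact boundedAlg_s_trunc hB τ (p := ⟨p.1 ⇨ r.1, N, hp.himp hB hr⟩) (hp.himp hB hr)
  s_bot τ := Subtype.ext (hB.s_bot _)
  c_quantifier J :=
    { map_bot := Subtype.ext (hB.c_quantifier J).map_bot
      le_apply := fun p => (hB.c_quantifier J).le_apply p.1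
      map_inf := fun p r => Subtype.ext ((hB.c_quantifier J).map_inf p.1 r.1)
      map_himp := fun p r => Subtype.ext ((hB.c_quantifier J).map_himp p.1 r.1)
      map_sup := fun p r => Subtype.ext ((hB.c_quantifier J).map_sup p.1 r.1)
      idem := fun p => Subtype.ext ((hB.c_quantifier J).idem p.1) }
  q_quantifier J :=
    { map_top := Subtype.ext (hB.q_quantifier J).map_top
      apply_le := fun p => (hB.q_quantifier J).apply_le p.1
      map_himp := fun p r => (hB.q_quantifier J).map_himp p.1 r.1
      idem := fun p => Subtype.ext ((hB.q_quantifier J).idem p.1) }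
  s_id ε hε p := by
    obtain ⟨N, hp⟩ := p.2
    refine Subtype.ext ((boundedAlg_s_trunc hB ε hp).trans (hB.s_id _ (fun i => ?_) _))
    by_cases hi : IsLow N i
    · rw [trunc_of_low ε hi, hε]
    · exact trunc_of_not_low ε hi
  s_comp σ τ p := by
    obtain ⟨N, hp⟩ := p.2
    obtain ⟨M, hM⟩ := exists_low_image τ N
    obtain ⟨M', hM'⟩ := ((boundedAlg hB).s τ p : Bounded B).2
    have h1 := boundedAlg_s_trunc hB σ (p := (boundedAlg hB).s τ p)
      (hM'.mono (le_max_right M M'))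
    rw [boundedAlg_s_trunc hB τ hp, ← hB.s_comp] at h1
    refine Subtype.ext (Eq.trans ?_ h1.symm)
    refine boundedAlg_s_val hB hp fun x hx => ?_
    change (trunc σ _).1 ((trunc τ N).1 x) = σ.1 (τ.1 x)
    rw [trunc_of_low τ hx, trunc_of_low σ ((hM x hx).mono (le_max_left M M'))]
  c_empty J hJ p := Subtype.ext (hB.c_empty J hJ p.1)
  q_empty J hJ p := Subtype.ext (hB.q_empty J hJ p.1)
  c_union J J' L hL p := Subtype.ext (hB.c_union J J' L hL p.1)
  q_union J J' L hL p := Subtype.ext (hB.q_union J J' L hL p.1)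
  s_c σ τ J h p := by
    obtain ⟨N, hp⟩ := p.2
    refine Subtype.ext ((boundedAlg_s_trunc hB σ (p := (boundedAlg hB).c J p) (hp.c hB J)).trans
      (Eq.trans ?_ (boundedAlg_s_trunc hB τ (p := (boundedAlg hB).c J p) (hp.c hB J)).symm))
    refine hB.s_c _ _ J (fun i hi => ?_) p.1
    by_cases hl : IsLow N i
    · rw [trunc_of_low σ hl, trunc_of_low τ hl, h i hi]
    · rw [trunc_of_not_low σ hl, trunc_of_not_low τ hl]
  s_q σ τ J h p := by
    obtain ⟨N, hp⟩ := p.2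
    refine Subtype.ext ((boundedAlg_s_trunc hB σ (p := (boundedAlg hB).q J p) (hp.q hB J)).trans
      (Eq.trans ?_ (boundedAlg_s_trunc hB τ (p := (boundedAlg hB).q J p) (hp.q hB J)).symm))
    refine hB.s_q _ _ J (fun i hi => ?_) p.1
    by_cases hl : IsLow N i
    · rw [trunc_of_low σ hl, trunc_of_low τ hl, h i hi]
    · rw [trunc_of_not_low σ hl, trunc_of_not_low τ hl]
  c_s σ J J' hJ hσ p := by
    obtain ⟨N, hp, hN⟩ := exists_bound_of_finite p J J'
    refine Subtype.ext (Eq.trans ?_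
      (boundedAlg_s_trunc hB σ (p := (boundedAlg hB).c J' p) (hp.c hB J')).symm)
    refine (congrArg (B.c J) (boundedAlg_s_trunc hB σ hp)).trans
      (hB.c_s _ J J' (mem_iff_trunc_mem hJ hN) (fun i j hi hj hij => hσ i j hi hj ?_) p.1)
    rwa [trunc_of_low σ (hN i (Or.inr hi)), trunc_of_low σ (hN j (Or.inr hj))] at hij
  q_s σ J J' hJ hσ p := by
    obtain ⟨N, hp, hN⟩ := exists_bound_of_finite p J J'
    refine Subtype.ext (Eq.trans ?_
      (boundedAlg_s_trunc hB σ (p := (boundedAlg hB).q J' p) (hp.q hB J')).symm)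
    refine (congrArg (B.q J) (boundedAlg_s_trunc hB σ hp)).trans
      (hB.q_s _ J J' (mem_iff_trunc_mem hJ hN) (fun i j hi hj hij => hσ i j hi hj ?_) p.1)
    rwa [trunc_of_low σ (hN i (Or.inr hi)), trunc_of_low σ (hN j (Or.inr hj))] at hij

end Bounded

/-! ### The semigroup `semiFin α` is strongly rich -/

section SemiFin

variable {α : Type u}

/-- The shift of the additional coordinates. -/
def shiftUp : α ⊕ ℕ → α ⊕ ℕ := Sum.map id Nat.succ

/-- The left inverse of the shift. -/
def shiftDown : α ⊕ ℕ → α ⊕ ℕ := Sum.map id Nat.pred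

theorem shiftDown_shiftUp (x : α ⊕ ℕ) : shiftDown (shiftUp x) = x := by
  cases x <;> rfl

theorem iterate_shift_inl (n : ℕ) (i : α) :
    shiftUp^[n] (shiftDown^[n] (Sum.inl i : α ⊕ ℕ)) = Sum.inl i := by
  have h1 : shiftDown^[n] (Sum.inl i : α ⊕ ℕ) = Sum.inl i := Function.iterate_fixed rfl n
  rw [h1]
  exact Function.iterate_fixed rfl n

theorem iterate_shift_inr (n k : ℕ) :
    shiftUp^[n] (shiftDown^[n] (Sum.inr (k + n) : α ⊕ ℕ)) = Sum.inr (k + n) := by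
  have h : ∀ k, shiftUp^[n] (Sum.inr k : α ⊕ ℕ) = Sum.inr (k + n) := by
    intro k
    induction n with
    | zero => rfl
    | succ n ih =>
      rw [Function.iterate_succ_apply', ih]
      rfl
  rw [← h k, Function.LeftInverse.iterate shiftDown_shiftUp n]

theorem isStronglyRich_semiFin : IsStronglyRich (semiFin α) := by
  refine ⟨fun τ hτ i j => ?_, shiftUp, ?_, shiftDown, ?_, shiftDown_shiftUp, ?_, fun τ hτ => ?_,
    fun n => ?_, fun n => ?_⟩
  · refine (Set.Finite.union hτ ((Set.finite_singleton i).preimage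
      (f := Sum.inl) Sum.inl_injective.injOn)).subset fun a ha => ?_
    by_contra hn
    rw [Set.mem_union, not_or] at hn
    exact ha ((if_neg hn.2).trans (not_not.1 hn.1))
  · exact Set.finite_empty.subset fun a ha => ha rfl
  · exact Set.finite_empty.subset fun a ha => ha rfl
  · intro h
    obtain ⟨x, hx⟩ : (Sum.inr 0 : α ⊕ ℕ) ∈ Set.range shiftUp := h ▸ Set.mem_univ _
    rcases x with i | n
    · cases hx
    · cases hx
  · refine Set.Finite.subset hτ fun a ha hτa => ha ?_
    have h1 : (Sum.inl a : α ⊕ ℕ) ∉ (Set.range shiftUp)ᶜ := fun h => h ⟨Sum.inl a, rfl⟩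
    refine (if_neg h1).trans ?_
    change shiftUp (τ (Sum.inl a)) = Sum.inl a
    rw [hτa]
    rfl
  · refine ((Set.finite_Iio n).image (Sum.inr : ℕ → α ⊕ ℕ)).subset ?_
    rintro (i | k) h
    · exact absurd (iterate_shift_inl n i) h
    · refine ⟨k, ?_, rfl⟩
      by_contra hk
      obtain ⟨m, rfl⟩ := Nat.exists_eq_add_of_le' (not_lt.1 hk)
      exact h (iterate_shift_inr n m)
  · rintro _ h ⟨x, rfl⟩
    refine h ?_
    change shiftUp^[n] (shiftDown^[n] (shiftUp^[n] x)) = shiftUp^[n] x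
    rw [Function.LeftInverse.iterate shiftDown_shiftUp n]

end SemiFin

/-! ### Reducts of representable algebras -/

section Reducts

variable {α : Type u}

theorem extendId_inl (τ : finTrans α) (i : α) :
    (extendId (Function.Embedding.inl : α ↪ α ⊕ ℕ) τ).1 (Sum.inl i) = Sum.inl (τ.1 i) := by
  change Function.extend (Sum.inl : α → α ⊕ ℕ) (fun i => Sum.inl (τ.1 i)) id (Sum.inl i) = _
  rw [Sum.inl_injective.extend_apply]

theorem extendId_inr (τ : finTrans α) (n : ℕ) :
    (extendId (Function.Embedding.inl : α ↪ α ⊕ ℕ) τ).1 (Sum.inr n) = Sum.inr n := by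
  change Function.extend (Sum.inl : α → α ⊕ ℕ) (fun i => Sum.inl (τ.1 i)) id (Sum.inr n) = _
  rw [Function.extend_apply' _ _ _ (by simp)]
  rfl

/-- The extension of a finite transformation of `α`, as a member of `semiFin α`. -/
noncomputable def extendSemi (τ : finTrans α) : semiFin α :=
  ⟨(extendId (Function.Embedding.inl : α ↪ α ⊕ ℕ) τ).1,
    Set.Finite.preimage Sum.inl_injective.injOn (extendId _ τ).2⟩

/-- The reduct to the dimension `α` of an algebra over `semiFin α`. -/
noncomputable def semiReduct (C : GAlg (semiFin α) (finiteSets (α ⊕ ℕ))) :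
    GAlg (finTrans α) (finiteSets α) where
  carrier := C.carrier
  s τ := C.s (extendSemi τ)
  c J := C.c (imageSet Function.Embedding.inl J)
  q J := C.q (imageSet Function.Embedding.inl J)

/-- Homomorphisms between reducts. -/
noncomputable def GAlg.Hom.semiReduct {C C' : GAlg (semiFin α) (finiteSets (α ⊕ ℕ))}
    (f : GAlg.Hom C C') :
    GAlg.Hom (HeytingPolyadic.semiReduct C) (HeytingPolyadic.semiReduct C') where
  toFun := f.toFun
  map_sup := f.map_sup
  map_inf := f.map_inf
  map_himp := f.map_himp
  map_bot := f.map_bot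
  map_s _ := f.map_s _
  map_c _ := f.map_c _
  map_q _ := f.map_q _

variable (𝔎 : KripkeSystem (semiFin α) (finiteSets (α ⊕ ℕ)))

/-- The Kripke system of dimension `α` obtained by fixing the values of the additional
coordinates, in the worlds above a given one. -/
def sliceSystem (k₀ : 𝔎.K) (u : 𝔎.V k₀) : KripkeSystem (finTrans α) (finiteSets α) where
  K := {k // k₀ ≤ k}
  Dom := 𝔎.Dom
  X k := 𝔎.X k.1
  V k := {y | Sum.elim y (u.1 ∘ Sum.inr) ∈ 𝔎.V k.1}
  X_nonempty k := 𝔎.X_nonempty k.1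
  X_mono k l h := 𝔎.X_mono k.1 l.1 h
  V_nonempty k := by
    refine ⟨u.1 ∘ Sum.inl, ?_⟩
    change Sum.elim (u.1 ∘ Sum.inl) (u.1 ∘ Sum.inr) ∈ 𝔎.V k.1
    rw [Sum.elim_comp_inl_inr]
    exact 𝔎.V_mono _ _ k.2 u.2
  V_mono k l h y hy := 𝔎.V_mono k.1 l.1 h hy
  V_mem k y hy i := 𝔎.V_mem k.1 _ hy (Sum.inl i)
  V_comp k y hy τ hτ := by
    have e : Sum.elim (fun i => y (τ i)) (u.1 ∘ Sum.inr) =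
        fun x => Sum.elim y (u.1 ∘ Sum.inr) ((extendSemi ⟨τ, hτ⟩).1 x) := by
      funext x
      rcases x with i | n
      · exact (congrArg (Sum.elim y (u.1 ∘ Sum.inr)) (extendId_inl ⟨τ, hτ⟩ i)).symm
      · exact (congrArg (Sum.elim y (u.1 ∘ Sum.inr)) (extendId_inr ⟨τ, hτ⟩ n)).symm
    exact (congrArg (· ∈ 𝔎.V k.1) e).mpr (𝔎.V_comp k.1 _ hy _ (extendSemi ⟨τ, hτ⟩).2)
  V_change k x hx J hJ y hy h := by
    refine 𝔎.V_change k.1 _ hx (Sum.inl '' J) (Set.Finite.image _ hJ) _ ?_ ?_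
    · rintro (i | n)
      · exact hy i
      · exact 𝔎.V_mem k.1 _ hx (Sum.inr n)
    · rintro (i | n) hi
      · exact h i fun hiJ => hi ⟨i, hiJ, rfl⟩
      · rfl

variable {𝔎} in
/-- Assignments that agree off `α` with a slice belong to the slice. -/
theorem elim_of_agree {k₀ : 𝔎.K} {u : 𝔎.V k₀} {y : α → 𝔎.Dom} {J : Set α} {z : α ⊕ ℕ → 𝔎.Dom}
    (h : ∀ x, x ∉ Sum.inl '' J → z x = Sum.elim y (u.1 ∘ Sum.inr) x) :
    Sum.elim (z ∘ Sum.inl) (u.1 ∘ Sum.inr) = z := by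
  funext x
  rcases x with i | n
  · rfl
  · exact (h (Sum.inr n) (by rintro ⟨_, _, hx⟩; cases hx)).symm

theorem KripkeSystem.Fam.val_of_eq {α : Type u} {G : Subsemigroup (Function.End α)}
    {𝒥 : Set (Set α)} {𝔎 : KripkeSystem G 𝒥} (f : Fam 𝔎) {k : 𝔎.K} {x y : 𝔎.V k}
    (h : x.1 = y.1) (hx : f.val k x) : f.val k y := by
  rwa [← Subtype.ext h]

/-- Restriction to a slice is a homomorphism of the reduct. -/
noncomputable def sliceHom (k₀ : 𝔎.K) (u : 𝔎.V k₀) :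
    GAlg.Hom (semiReduct 𝔎.setAlgebra) (sliceSystem 𝔎 k₀ u).setAlgebra where
  toFun f :=
    { val := fun k y => KripkeSystem.Fam.val (𝔎 := 𝔎) f k.1 ⟨Sum.elim y.1 (u.1 ∘ Sum.inr), y.2⟩
      mono := fun k l h y hy => KripkeSystem.Fam.mono (𝔎 := 𝔎) f k.1 l.1 h _ hy }
  map_sup _ _ := rfl
  map_inf _ _ := rfl
  map_himp f g := KripkeSystem.Fam.ext (by
    funext k y
    exact propext ⟨fun h l hl => h l.1 hl, fun h l hl => h ⟨l, k.2.trans hl⟩ hl⟩)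
  map_bot := rfl
  map_s τ f := KripkeSystem.Fam.ext (by
    funext k y
    refine congrArg (KripkeSystem.Fam.val (𝔎 := 𝔎) f k.1) (Subtype.ext (funext fun x => ?_))
    rcases x with i | n
    · exact congrArg (Sum.elim y.1 (u.1 ∘ Sum.inr)) (extendId_inl τ i)
    · exact congrArg (Sum.elim y.1 (u.1 ∘ Sum.inr)) (extendId_inr τ n))
  map_c J f := KripkeSystem.Fam.ext (by
    funext (k : {k // k₀ ≤ k}) y
    refine propext ⟨?_, ?_⟩
    · rintro ⟨z, hz, hf⟩
      have e := elim_of_agree hz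
      refine ⟨⟨z.1 ∘ Sum.inl, (congrArg (· ∈ 𝔎.V k.1) e).mpr z.2⟩,
        fun i hi => hz (Sum.inl i) ?_, KripkeSystem.Fam.val_of_eq (𝔎 := 𝔎) f e.symm hf⟩
      rintro ⟨j, hj, hji⟩
      cases hji
      exact hi hj
    · rintro ⟨z, hz, hf⟩
      refine ⟨⟨_, z.2⟩, ?_, hf⟩
      rintro (i | n) hi
      · exact hz i fun hiJ => hi ⟨i, hiJ, rfl⟩
      · rfl)
  map_q J f := KripkeSystem.Fam.ext (by
    funext (k : {k // k₀ ≤ k}) y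
    refine propext ⟨?_, ?_⟩
    · intro h l hl z hz
      refine h l.1 hl ⟨_, z.2⟩ ?_
      rintro (i | n) hi
      · exact hz i fun hiJ => hi ⟨i, hiJ, rfl⟩
      · rfl
    · intro h l hl z hz
      have e := elim_of_agree hz
      have hf := h ⟨l, k.2.trans hl⟩ hl
        ⟨z.1 ∘ Sum.inl, (congrArg (· ∈ 𝔎.V l) e).mpr z.2⟩ fun i hi => hz (Sum.inl i) (by
          rintro ⟨j, hj, hji⟩
          cases hji
          exact hi hj)
      exact KripkeSystem.Fam.val_of_eq (𝔎 := 𝔎) f e hf)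

theorem SNr_subset_RGA [Infinite α] : SNr (Function.Embedding.inl : α ↪ α ⊕ ℕ) ⊆
    RGA (finTrans α) (finiteSets α) := by
  rintro A ⟨-, B, hB, f, hf, hdim⟩
  have hB : IsGPHA B := hB
  have hbdd : ∀ a, IsBdd (B := B) 0 (f.toFun a) := by
    intro a n _
    by_contra h
    obtain ⟨i, hi⟩ := hdim a (show Sum.inr n ∈ dimSet B (f.toFun a) from h)
    cases hi
  let g : GAlg.Hom A (semiReduct (boundedAlg hB)) :=
    { toFun := fun a => ⟨f.toFun a, 0, hbdd a⟩
      map_sup := fun p r => Subtype.ext (show (f.toFun (p ⊔ r) : B.carrier) =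
        max (α := B.carrier) (f.toFun p) (f.toFun r) from f.map_sup p r)
      map_inf := fun p r => Subtype.ext (show (f.toFun (p ⊓ r) : B.carrier) =
        min (α := B.carrier) (f.toFun p) (f.toFun r) from f.map_inf p r)
      map_himp := fun p r => Subtype.ext (show (f.toFun (p ⇨ r) : B.carrier) =
        himp (α := B.carrier) (f.toFun p) (f.toFun r) from f.map_himp p r)
      map_bot := Subtype.ext (show (f.toFun ⊥ : B.carrier) = ⊥ from f.map_bot)
      map_s := fun τ p => Subtype.ext ((f.map_s τ p).trans
        (boundedAlg_s_val hB (N := 0) (τ := extendSemi τ) (p := ⟨f.toFun p, 0, hbdd p⟩) (hbdd p)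
          fun _ _ => rfl).symm)
      map_c := fun J p => Subtype.ext (f.map_c J p)
      map_q := fun J p => Subtype.ext (f.map_q J p) }
  have hg : Function.Injective g.toFun := fun a b hab => hf (congrArg Subtype.val hab)
  have : Infinite (α ⊕ ℕ) := Infinite.of_injective _ Sum.inr_injective
  obtain ⟨I, C, hC, e, he⟩ : boundedAlg hB ∈ RGA (semiFin α) (finiteSets (α ⊕ ℕ)) := by
    rw [RGA_eq_GPHA_of_isStronglyRich isStronglyRich_semiFin]
    exact isGPHA_boundedAlg hB
  refine mem_SP_of_separating fun a b hab => ?_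
  obtain ⟨i, hi⟩ := not_forall.1 (show ¬ e.toFun (g.toFun a) ≤ e.toFun (g.toFun b) from
    fun h => hab ((GAlg.Hom.le_iff g hg).1 ((GAlg.Hom.le_iff e he).1 h)))
  obtain ⟨𝔎, h𝔎⟩ := hC i
  have hp : ∃ p : GAlg.Hom (boundedAlg hB) (C i),
      ¬ p.toFun (g.toFun a) ≤ p.toFun (g.toFun b) := ⟨(GAlg.Hom.proj C i).comp e, hi⟩
  rw [h𝔎] at hp
  obtain ⟨p, hp⟩ := hp
  obtain ⟨k, hk⟩ := not_forall.1 hp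
  obtain ⟨u, hu⟩ := not_forall.1 hk
  refine ⟨_, ⟨sliceSystem 𝔎 k u, rfl⟩, (sliceHom 𝔎 k u).comp (p.semiReduct.comp g),
    fun hle => hu fun ha => ?_⟩
  have e : Sum.elim (u.1 ∘ Sum.inl) (u.1 ∘ Sum.inr) = u.1 := Sum.elim_comp_inl_inr u.1
  refine KripkeSystem.Fam.val_of_eq (𝔎 := 𝔎) (p.toFun (g.toFun b)) e
    (hle ⟨k, le_rfl⟩ ⟨u.1 ∘ Sum.inl, (congrArg (· ∈ 𝔎.V k) e).mpr u.2⟩ ?_)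
  exact KripkeSystem.Fam.val_of_eq (𝔎 := 𝔎) (p.toFun (g.toFun a)) e.symm ha

end Reducts

/-! ### Representable algebras as neat subreducts -/

section Cylinder

variable {α : Type u} (𝔎 : KripkeSystem (finTrans α) (finiteSets α))

/-- The Kripke system of dimension `α ⊕ ℕ` whose assignments extend those of a system of
dimension `α` by arbitrary values. -/
def cylinderSystem : KripkeSystem (finTrans (α ⊕ ℕ)) (finiteSets (α ⊕ ℕ)) where
  K := 𝔎.K
  Dom := 𝔎.Dom
  X := 𝔎.X
  V k := {x | x ∘ Sum.inl ∈ 𝔎.V k ∧ ∀ i, x i ∈ 𝔎.X k}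
  X_nonempty := 𝔎.X_nonempty
  X_mono := 𝔎.X_mono
  V_nonempty k := by
    obtain ⟨y, hy⟩ := 𝔎.V_nonempty k
    obtain ⟨d, hd⟩ := 𝔎.X_nonempty k
    refine ⟨Sum.elim y fun _ => d, hy, ?_⟩
    rintro (i | n)
    · exact 𝔎.V_mem k y hy i
    · exact hd
  V_mono k l h x hx := ⟨𝔎.V_mono k l h hx.1, fun i => 𝔎.X_mono k l h (hx.2 i)⟩
  V_mem k x hx := hx.2
  V_comp k x hx τ hτ := by
    refine ⟨𝔎.V_change k _ hx.1 {i | τ (Sum.inl i) ≠ Sum.inl i}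
      (Set.Finite.preimage Sum.inl_injective.injOn hτ) _ (fun i => hx.2 _) fun i hi => ?_,
      fun i => hx.2 _⟩
    exact congrArg x (not_not.1 hi)
  V_change k x hx J hJ y hy h :=
    ⟨𝔎.V_change k _ hx.1 (Sum.inl ⁻¹' J) (Set.Finite.preimage Sum.inl_injective.injOn hJ) _
      (fun _ => hy _) fun i hi => h (Sum.inl i) hi, hy⟩

/-- An assignment of the cylinder changed on `α`. -/
theorem elim_mem_cylinder {k : 𝔎.K} {x : α ⊕ ℕ → 𝔎.Dom} (hx : ∀ i, x i ∈ 𝔎.X k)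
    {y : α → 𝔎.Dom} (hy : y ∈ 𝔎.V k) :
    Sum.elim y (x ∘ Sum.inr) ∈ (cylinderSystem 𝔎).V k := by
  refine ⟨hy, ?_⟩
  rintro (i | n)
  · exact 𝔎.V_mem k y hy i
  · exact hx _

theorem elim_eq_of_agree {J : Set α} {x : α ⊕ ℕ → 𝔎.Dom} {y : α → 𝔎.Dom}
    (h : ∀ i, i ∉ J → y i = x (Sum.inl i)) :
    ∀ i, i ∉ (Sum.inl '' J : Set (α ⊕ ℕ)) → Sum.elim y (x ∘ Sum.inr) i = x i := by
  rintro (i | n) hi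
  · exact h i fun hJ => hi ⟨i, hJ, rfl⟩
  · rfl

/-- The embedding of a set algebra in the reduct of the set algebra of the cylinder. -/
noncomputable def cylinderHom :
    GAlg.Hom 𝔎.setAlgebra (reduct Function.Embedding.inl (cylinderSystem 𝔎).setAlgebra) where
  toFun f :=
    { val := fun k x => KripkeSystem.Fam.val (𝔎 := 𝔎) f k ⟨x.1 ∘ Sum.inl, x.2.1⟩
      mono := fun k l h x hx => KripkeSystem.Fam.mono (𝔎 := 𝔎) f k l h _ hx }
  map_sup _ _ := rfl
  map_inf _ _ := rfl
  map_himp _ _ := rfl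
  map_bot := rfl
  map_s τ f := KripkeSystem.Fam.ext (by
    funext k x
    refine congrArg (KripkeSystem.Fam.val (𝔎 := 𝔎) f k) (Subtype.ext (funext fun i => ?_))
    exact congrArg x.1 (extendId_inl τ i).symm)
  map_c J f := KripkeSystem.Fam.ext (by
    funext k x
    refine propext ⟨?_, ?_⟩
    · rintro ⟨y, hy, hf⟩
      exact ⟨⟨_, elim_mem_cylinder 𝔎 x.2.2 y.2⟩, elim_eq_of_agree 𝔎 hy, hf⟩
    · rintro ⟨z, hz, hf⟩
      refine ⟨⟨z.1 ∘ Sum.inl, z.2.1⟩, fun i hi => hz _ ?_, hf⟩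
      rintro ⟨j, hj, hji⟩
      cases hji
      exact hi hj)
  map_q J f := KripkeSystem.Fam.ext (by
    funext k x
    refine propext ⟨?_, ?_⟩
    · intro h l hl z hz
      refine h l hl ⟨z.1 ∘ Sum.inl, z.2.1⟩ fun i hi => hz _ ?_
      rintro ⟨j, hj, hji⟩
      cases hji
      exact hi hj
    · intro h l hl y hy
      exact h l hl ⟨_, elim_mem_cylinder 𝔎 (fun i => 𝔎.X_mono k l hl (x.2.2 i)) y.2⟩
        (elim_eq_of_agree 𝔎 hy))

theorem cylinderHom_injective : Function.Injective (cylinderHom 𝔎).toFun := by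
  intro f g h
  refine KripkeSystem.Fam.ext ?_
  funext k y
  obtain ⟨d, hd⟩ := 𝔎.X_nonempty k
  exact congrFun (congrFun (congrArg KripkeSystem.Fam.val h) k)
    ⟨_, elim_mem_cylinder 𝔎 (x := fun _ => d) (fun _ => hd) y.2⟩

theorem c_cylinderHom (f : KripkeSystem.Fam 𝔎) (n : ℕ) :
    (cylinderSystem 𝔎).setAlgebra.c (single (Sum.inr n)) ((cylinderHom 𝔎).toFun f) =
      (cylinderHom 𝔎).toFun f := by
  refine KripkeSystem.Fam.ext ?_
  funext k x
  refine propext ⟨?_, fun h => ⟨x, fun _ _ => rfl, h⟩⟩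
  rintro ⟨z, hz, hf⟩
  refine KripkeSystem.Fam.val_of_eq f (funext fun i => hz (Sum.inl i) ?_) hf
  intro h
  cases h

end Cylinder

section NeatSubreducts

variable {α β : Type u}

theorem mem_SNr_of_forall {ι : α ↪ β} {A : GAlg (finTrans α) (finiteSets α)}
    (hA : IsGPHA A) {B : GAlg (finTrans β) (finiteSets β)} (hB : IsGPHA B)
    (f : GAlg.Hom A (reduct ι B)) (hf : Function.Injective f.toFun)
    (h : ∀ a, ∀ i, i ∉ Set.range ι → B.c (single i) (f.toFun a) = f.toFun a) : A ∈ SNr ι := by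
  refine ⟨hA, B, hB, f, hf, fun a i hi => ?_⟩
  by_contra hn
  exact hi (h a i hn)

theorem c_eq_self_of_dimSet_subset {ι : α ↪ β} {B : GAlg (finTrans β) (finiteSets β)}
    {p : B.carrier} (h : dimSet B p ⊆ Set.range ι) {i : β} (hi : i ∉ Set.range ι) :
    B.c (single i) p = p := by
  by_contra hn
  exact hi (h hn)

/-- Products of homomorphisms to reducts. -/
noncomputable def reductPi {ι : α ↪ β} {I : Type u} {A : I → GAlg (finTrans α) (finiteSets α)}
    {B : I → GAlg (finTrans β) (finiteSets β)} (f : ∀ i, GAlg.Hom (A i) (reduct ι (B i))) :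
    GAlg.Hom (GAlg.prod A) (reduct ι (GAlg.prod B)) where
  toFun p i := (f i).toFun (p i)
  map_sup _ _ := funext fun i => (f i).map_sup _ _
  map_inf _ _ := funext fun i => (f i).map_inf _ _
  map_himp _ _ := funext fun i => (f i).map_himp _ _
  map_bot := funext fun i => (f i).map_bot
  map_s _ _ := funext fun i => (f i).map_s _ _
  map_c _ _ := funext fun i => (f i).map_c _ _
  map_q _ _ := funext fun i => (f i).map_q _ _

theorem reductPi_injective {ι : α ↪ β} {I : Type u}
    {A : I → GAlg (finTrans α) (finiteSets α)} {B : I → GAlg (finTrans β) (finiteSets β)}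
    {f : ∀ i, GAlg.Hom (A i) (reduct ι (B i))} (hf : ∀ i, Function.Injective (f i).toFun) :
    Function.Injective (reductPi f).toFun :=
  fun _ _ h => funext fun i => hf i (congrFun h i)

theorem SNr_subalgebra {ι : α ↪ β} {A B : GAlg (finTrans α) (finiteSets α)}
    (f : GAlg.Hom A B) (hf : Function.Injective f.toFun) (hB : B ∈ SNr ι) : A ∈ SNr ι := by
  obtain ⟨hB, C, hC, g, hg, hdim⟩ := hB
  exact ⟨IsGPHA.of_injective f hf hB, C, hC, g.comp f, hg.comp hf, fun a => hdim _⟩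

theorem SNr_prod {ι : α ↪ β} {I : Type u} {A : I → GAlg (finTrans α) (finiteSets α)}
    (hA : ∀ i, A i ∈ SNr ι) : GAlg.prod A ∈ SNr ι := by
  choose hA B hB f hf hdim using hA
  exact mem_SNr_of_forall (IsGPHA.prod hA) (IsGPHA.prod hB) (reductPi f) (reductPi_injective hf)
    fun a i hi => funext fun j => c_eq_self_of_dimSet_subset (hdim j (a j)) hi

theorem setAlgebra_mem_SNr (𝔎 : KripkeSystem (finTrans α) (finiteSets α)) :
    𝔎.setAlgebra ∈ SNr (Function.Embedding.inl : α ↪ α ⊕ ℕ) := by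
  refine mem_SNr_of_forall 𝔎.isGPHA_setAlgebra (cylinderSystem 𝔎).isGPHA_setAlgebra
    (cylinderHom 𝔎) (cylinderHom_injective 𝔎) ?_
  rintro f (i | n) hi
  · exact absurd ⟨i, rfl⟩ hi
  · exact c_cylinderHom 𝔎 f n

theorem RGA_eq_SNr [Infinite α] : RGA (finTrans α) (finiteSets α) =
    SNr (Function.Embedding.inl : α ↪ α ⊕ ℕ) := by
  refine Set.Subset.antisymm ?_ SNr_subset_RGA
  rintro A ⟨I, B, hB, f, hf⟩
  refine SNr_subalgebra f hf (SNr_prod fun i => ?_)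
  obtain ⟨𝔎, h⟩ := hB i
  rw [h]
  exact setAlgebra_mem_SNr 𝔎

end NeatSubreducts

/-! ### Quotients by filters -/

section Filters

variable {β : Type u} {B : GAlg (finTrans β) (finiteSets β)}

/-- Nonempty sets closed under meets and under the universal quantifiers. The filters generated by
them are the kernels of homomorphisms; upward closure itself is not needed. -/
structure IsPolyadicFilter (F : Set B.carrier) : Prop where
  top_mem : ⊤ ∈ F
  inf_mem : ∀ {p r}, p ∈ F → r ∈ F → p ⊓ r ∈ F
  q_mem : ∀ (J : finiteSets β) {p}, p ∈ F → B.q J p ∈ F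

namespace IsPolyadicFilter

variable {F : Set B.carrier} (hF : IsPolyadicFilter F)

/-- The quotient of the Heyting reduct by the filter generated by `F`. -/
def pre : PreHeyting B.carrier where
  le p r := ∃ f ∈ F, f ⊓ p ≤ r
  sup := (· ⊔ ·)
  inf := (· ⊓ ·)
  himp := (· ⇨ ·)
  bot := ⊥
  top := ⊤
  le_refl p := ⟨⊤, hF.top_mem, inf_le_right⟩
  le_trans := by
    rintro p r t ⟨f, hf, h⟩ ⟨g, hg, h'⟩
    refine ⟨g ⊓ f, hF.inf_mem hg hf, ?_⟩
    rw [inf_assoc]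
    exact (inf_le_inf_left g h).trans h'
  le_sup_left p r := ⟨⊤, hF.top_mem, inf_le_right.trans le_sup_left⟩
  le_sup_right p r := ⟨⊤, hF.top_mem, inf_le_right.trans le_sup_right⟩
  sup_le := by
    rintro p r t ⟨f, hf, h⟩ ⟨g, hg, h'⟩
    refine ⟨f ⊓ g, hF.inf_mem hf hg, ?_⟩
    rw [inf_sup_left]
    exact sup_le ((inf_le_inf_right p inf_le_left).trans h)
      ((inf_le_inf_right r inf_le_right).trans h')
  inf_le_left p r := ⟨⊤, hF.top_mem, inf_le_right.trans inf_le_left⟩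
  inf_le_right p r := ⟨⊤, hF.top_mem, inf_le_right.trans inf_le_right⟩
  le_inf := by
    rintro p r t ⟨f, hf, h⟩ ⟨g, hg, h'⟩
    exact ⟨f ⊓ g, hF.inf_mem hf hg, le_inf ((inf_le_inf_right p inf_le_left).trans h)
      ((inf_le_inf_right p inf_le_right).trans h')⟩
  bot_le p := ⟨⊤, hF.top_mem, inf_le_right.trans bot_le⟩
  le_top p := ⟨⊤, hF.top_mem, le_top⟩
  le_himp_iff p r t := by
    simp only [le_himp_iff, inf_assoc]

theorem map_mono {e : B.carrier → B.carrier}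
    (he : ∀ p r, hF.pre.le p r → hF.pre.le (e p) (e r)) :
    ∀ p r, hF.pre.setoid p r → hF.pre.setoid (e p) (e r) :=
  fun p r h => ⟨he p r h.1, he r p h.2⟩

variable (hB : IsGPHA B)

include hB in
theorem le_s (τ : finTrans β) (p r : B.carrier) (h : hF.pre.le p r) :
    hF.pre.le (B.s τ p) (B.s τ r) := by
  obtain ⟨f, hf, hle⟩ := h
  let J : finiteSets β := ⟨_, τ.2⟩
  let ε : finTrans β := ⟨fun i => i, Set.finite_empty.subset fun i hi => hi rfl⟩
  have h1 : B.s τ (B.q J f) = B.q J f :=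
    (hB.s_q τ ε J (fun i hi => not_not.1 hi) f).trans (hB.s_id ε (fun _ => rfl) _)
  refine ⟨B.q J f, hF.q_mem J hf, ?_⟩
  have h2 := hB.s_mono τ ((inf_le_inf_right p ((hB.q_quantifier J).apply_le f)).trans hle)
  rwa [hB.s_inf, h1] at h2

include hB in
theorem le_c [Infinite β] (J : finiteSets β) (p r : B.carrier) (h : hF.pre.le p r) :
    hF.pre.le (B.c J p) (B.c J r) := by
  obtain ⟨f, hf, hle⟩ := h
  have h1 : B.c J (B.q J f) = B.q J f :=
    (c_eq_self_iff_q_eq_self hB J _).2 ((hB.q_quantifier J).idem f)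
  refine ⟨B.q J f, hF.q_mem J hf, ?_⟩
  have h2 := (hB.c_quantifier J).monotone
    ((inf_le_inf_right p ((hB.q_quantifier J).apply_le f)).trans hle)
  have h3 := (hB.c_quantifier J).map_inf p (B.q J f)
  rw [h1, inf_comm p] at h3
  rwa [h3, inf_comm] at h2

include hB in
theorem le_q (J : finiteSets β) (p r : B.carrier) (h : hF.pre.le p r) :
    hF.pre.le (B.q J p) (B.q J r) := by
  obtain ⟨f, hf, hle⟩ := h
  exact ⟨B.q J f, hF.q_mem J hf,
    ((hB.q_quantifier J).inf_le f p).trans ((hB.q_quantifier J).monotone hle)⟩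

/-- The quotient algebra by a filter. -/
def quot [Infinite β] : GAlg (finTrans β) (finiteSets β) where
  carrier := hF.pre.Quot
  s τ := Quotient.map (B.s τ) (hF.map_mono (hF.le_s hB τ))
  c J := Quotient.map (B.c J) (hF.map_mono (hF.le_c hB J))
  q J := Quotient.map (B.q J) (hF.map_mono (hF.le_q hB J))

/-- The projection to the quotient algebra. -/
def toQuot [Infinite β] : GAlg.Hom B (hF.quot hB) where
  toFun := hF.pre.cls
  map_sup _ _ := rfl
  map_inf _ _ := rfl
  map_himp _ _ := rfl
  map_bot := rfl
  map_s _ _ := rfl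
  map_c _ _ := rfl
  map_q _ _ := rfl

theorem isGPHA_quot [Infinite β] : IsGPHA (hF.quot hB) :=
  IsGPHA.of_surjective (hF.toQuot hB) hF.pre.cls_surjective hB

end IsPolyadicFilter

end Filters

/-! ### Neat subreducts form a variety -/

section Variety

variable {α β : Type u} {ι : α ↪ β}

/-- The universal quantifier over a finite subset of `β` acts on a neat reduct as one over a
finite subset of `α`. -/
theorem exists_q_eq [Infinite β] {A : GAlg (finTrans α) (finiteSets α)}
    {B : GAlg (finTrans β) (finiteSets β)} (hB : IsGPHA B) (g : GAlg.Hom A (reduct ι B))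
    (hdim : ∀ a, dimSet B (g.toFun a) ⊆ Set.range ι) (J : finiteSets β) :
    ∃ J' : finiteSets α, ∀ a, B.q J (g.toFun a) = g.toFun (A.q J' a) := by
  let J₁ : finiteSets α := ⟨ι ⁻¹' J.1, Set.Finite.preimage ι.injective.injOn J.2⟩
  let J₂ : finiteSets β := ⟨J.1 \ Set.range ι, Set.Finite.sdiff J.2⟩
  refine ⟨J₁, fun a => ?_⟩
  have h2 : B.q J₂ (g.toFun a) = g.toFun a :=
    (c_eq_self_iff_q_eq_self hB J₂ _).1
      (c_eq_self_of_forall hB fun i hi => c_eq_self_of_dimSet_subset (hdim a) hi.2)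
  have hJ : J.1 = (imageSet ι J₁).1 ∪ J₂.1 := by
    change J.1 = ι '' (ι ⁻¹' J.1) ∪ J.1 \ Set.range ι
    rw [Set.image_preimage_eq_inter_range, Set.inter_union_sdiff]
  exact (hB.q_union (imageSet ι J₁) J₂ J hJ _).trans
    ((congrArg (B.q (imageSet ι J₁)) h2).trans (g.map_q J₁ a).symm)

/-- The filter generated in `B` by the kernel of a homomorphism defined on a neat subreduct. -/
theorem isPolyadicFilter_generated [Infinite β] {A C : GAlg (finTrans α) (finiteSets α)}
    (hC : IsGPHA C) {B : GAlg (finTrans β) (finiteSets β)} (hB : IsGPHA B) (f : GAlg.Hom A C)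
    (g : GAlg.Hom A (reduct ι B)) (hdim : ∀ a, dimSet B (g.toFun a) ⊆ Set.range ι) :
    IsPolyadicFilter {b : B.carrier | ∃ a, f.toFun a = ⊤ ∧ (g.toFun a : B.carrier) ≤ b} where
  top_mem := ⟨⊤, f.map_top, le_top⟩
  inf_mem := by
    rintro p r ⟨a, ha, hp⟩ ⟨a', ha', hr⟩
    refine ⟨a ⊓ a', ?_, ?_⟩
    · rw [f.map_inf, ha, ha', inf_top_eq]
    · exact (g.map_inf a a').le.trans (inf_le_inf hp hr)
  q_mem := by
    rintro J p ⟨a, ha, hp⟩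
    obtain ⟨J', hJ'⟩ := exists_q_eq hB g hdim J
    refine ⟨A.q J' a, ?_, ?_⟩
    · rw [f.map_q, ha, (hC.q_quantifier J').map_top]
    · exact (hJ' a).ge.trans ((hB.q_quantifier J).monotone hp)

theorem SNr_hom_image [Infinite β] {A C : GAlg (finTrans α) (finiteSets α)} (f : GAlg.Hom A C)
    (hf : Function.Surjective f.toFun) (hA : A ∈ SNr ι) : C ∈ SNr ι := by
  obtain ⟨hA, B, hB, g, hg, hdim⟩ := hA
  have hB : IsGPHA B := hB
  have hC : IsGPHA C := IsGPHA.of_surjective f hf hA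
  let F := isPolyadicFilter_generated hC hB f g hdim
  have hle : ∀ a a', F.pre.cls (g.toFun a) ≤ F.pre.cls (g.toFun a') ↔
      f.toFun a ≤ f.toFun a' := by
    intro a a'
    constructor
    · rintro ⟨b, ⟨x, hx, hxb⟩, h⟩
      have h1 : g.toFun (x ⊓ a) ≤ g.toFun a' :=
        (g.map_inf x a).le.trans ((inf_le_inf_right _ hxb).trans h)
      have h2 := f.monotone ((g.le_iff hg).1 h1)
      rwa [f.map_inf, hx, top_inf_eq] at h2
    · intro h
      refine ⟨g.toFun (a ⇨ a'), ⟨a ⇨ a', ?_, le_rfl⟩, ?_⟩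
      · rw [f.map_himp, himp_eq_top_iff.2 h]
      · exact (g.map_inf (a ⇨ a') a).ge.trans (g.monotone himp_inf_le)
  let φ : C.carrier → F.pre.Quot := fun c => F.pre.cls (g.toFun (Function.surjInv hf c))
  have hφ : ∀ a, φ (f.toFun a) = F.pre.cls (g.toFun a) := by
    intro a
    have h := Function.surjInv_eq hf (f.toFun a)
    exact le_antisymm ((hle _ _).2 h.le) ((hle _ _).2 h.ge)
  let e : GAlg.Hom C (reduct ι (F.quot hB)) :=
    { toFun := φ
      map_sup := hf.forall₂.2 fun p r => by
        rw [← f.map_sup, hφ, hφ, hφ]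
        exact congrArg F.pre.cls (g.map_sup p r)
      map_inf := hf.forall₂.2 fun p r => by
        rw [← f.map_inf, hφ, hφ, hφ]
        exact congrArg F.pre.cls (g.map_inf p r)
      map_himp := hf.forall₂.2 fun p r => by
        rw [← f.map_himp, hφ, hφ, hφ]
        exact congrArg F.pre.cls (g.map_himp p r)
      map_bot := by
        rw [← f.map_bot, hφ]
        exact congrArg F.pre.cls g.map_bot
      map_s := fun τ => hf.forall.2 fun p => by
        rw [← f.map_s, hφ, hφ]
        exact congrArg F.pre.cls (g.map_s τ p)
      map_c := fun J => hf.forall.2 fun p => by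
        rw [← f.map_c, hφ, hφ]
        exact congrArg F.pre.cls (g.map_c J p)
      map_q := fun J => hf.forall.2 fun p => by
        rw [← f.map_q, hφ, hφ]
        exact congrArg F.pre.cls (g.map_q J p) }
  refine mem_SNr_of_forall hC (F.isGPHA_quot hB) e ?_ ?_
  · refine hf.forall₂.2 fun a a' h => ?_
    have h' : F.pre.cls (g.toFun a) = F.pre.cls (g.toFun a') := by
      rw [← hφ, ← hφ]
      exact h
    exact le_antisymm ((hle _ _).1 h'.le) ((hle _ _).1 h'.ge)
  · intro c i hi
    exact congrArg F.pre.cls (c_eq_self_of_dimSet_subset (hdim (Function.surjInv hf c)) hi)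

theorem isVariety_SNr [Infinite α] (ι : α ↪ β) : IsVariety (SNr ι) := by
  have : Infinite β := Infinite.of_injective ι ι.injective
  exact
    { hom_image := fun _ _ f hf hA => SNr_hom_image f hf hA
      subalgebra := fun _ _ f hf hB => SNr_subalgebra f hf hB
      prod := fun _ _ hB => SNr_prod hB }

end Variety

end HeytingPolyadic

theorem mainTheorem1 :
    (∀ (α : Type u) [Infinite α] [Countable α] (G : Subsemigroup (Function.End α)),
      HeytingPolyadic.IsStronglyRich G →
      HeytingPolyadic.RGA G (HeytingPolyadic.finiteSets α) =
        HeytingPolyadic.GPHA G (HeytingPolyadic.finiteSets α)) ∧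
    (∀ (α : Type u) [Infinite α] (𝒥 : Set (Set α)),
      (𝒥 = Set.univ ∨ 𝒥 = HeytingPolyadic.finiteSets α) →
      HeytingPolyadic.RGA (⊤ : Subsemigroup (Function.End α)) 𝒥 =
        HeytingPolyadic.GPHA (⊤ : Subsemigroup (Function.End α)) 𝒥) ∧
    (∀ (α : Type u) [Infinite α],
      HeytingPolyadic.RGA (HeytingPolyadic.finTrans α) (HeytingPolyadic.finiteSets α) =
        HeytingPolyadic.SNr (Function.Embedding.inl : α ↪ α ⊕ ℕ) ∧
      HeytingPolyadic.IsVariety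
        (HeytingPolyadic.RGA (HeytingPolyadic.finTrans α) (HeytingPolyadic.finiteSets α))) ∧
    (∀ (α β : Type u) [Infinite α] (ι : α ↪ β),
      HeytingPolyadic.IsVariety (HeytingPolyadic.SNr ι)) := by
  refine ⟨fun α _ _ G hG => HeytingPolyadic.RGA_eq_GPHA_of_isStronglyRich hG,
    fun α _ 𝒥 h𝒥 => HeytingPolyadic.RGA_eq_GPHA_top h𝒥,
    fun α _ => ⟨HeytingPolyadic.RGA_eq_SNr, ?_⟩,
    fun α β _ ι => HeytingPolyadic.isVariety_SNr ι⟩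
  rw [HeytingPolyadic.RGA_eq_SNr]
  exact HeytingPolyadic.isVariety_SNr _
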